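/- **Model.** In the plane $\mathbb R^2$, sensors, access points (APs) and sinks form independent homogeneous Poisson point processes $\Phi_s,\Phi_{ap},\Phi_{sk}$ with intensities $\lambda_s,\lambda_{ap},\lambda_{sk}>0$. Each sensor is active (transmitting) with probability $\rho_s\in(0,1)$, and each AP is active (forwarding data to a sink) with probability $\rho_{ap}\in(0,1)$, independently of each other and of all locations; $\Phi_{s,a}$ and $\Phi_{ap,a}$ denote the sets of active sensors and active APs. Each AP has $M\ge 1$ antennas; sensors and sinks have one. All scalar channel coefficients (from each sensor to each antenna of each AP, from each antenna of an AP to each antenna of another AP, and from each antenna of an AP to each sink) are i.i.d. standard circularly symmetric complex Gaussian (Rayleigh fading), independent of locations and activities. Let $\alpha>2$ be the path loss exponent, $P_s,P_{ap}>0$ the transmit powers of sensors and APs, $\delta^2\ge0$ the noise power, and $\mu=P_{ap}/P_s$. A sensor is associated with the nearest AP that is not active, and an AP $j$ with its nearest sink $sk_j$. The SINR of a sensor $s_0$ at its associated AP $ap_0$ after maximal-ratio combining is $$\gamma_{ap}=\frac{\|\mathbf h_{s_0,ap_0}\|^2|X_{s_0,ap_0}|^{-\alpha}}{I_{s,ap}+I_{ap,ap}+\delta^2/P_s},\qquad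 I_{s,ap}=\sum_{i\in\Phi_{s,a}\setminus\{s_0\}}\Big|\tfrac{\mathbf h_{s_0,ap_0}^\dagger}{\|\mathbf h_{s_0,ap_0}\|}\mathbf h_{i,ap_0}\Big|^2|X_{i,ap_0}|^{-\alpha},$$ $$I_{ap,ap}=\mu\sum_{j\in\Phi_{ap,a}\setminus\{ap_0\}}\Big|\tfrac{\mathbf h_{s_0,ap_0}^\dagger}{\|\mathbf h_{s_0,ap_0}\|}\mathbf H_{j,ap_0}\tfrac{\mathbf h_{j,sk_j}^\dagger}{\|\mathbf h_{j,sk_j}\|}\Big|^2|X_{j,ap_0}|^{-\alpha},$$ where $\mathbf h_{i,k}\in\mathbb C^{M\times 1}$, $\mathbf H_{j,k}\in\mathbb C^{M\times M}$ and $\mathbf h_{j,sk_j}\in\mathbb C^{1\times M}$ are the channels from sensor $i$ to AP $k$, from AP $j$ to AP $k$, and from AP $j$ to its sink, and $|X_{a,b}|$ is the distance between $a$ and $b$. Let $F_{\gamma_{ap}}$ be the CDF of $\gamma_{ap}$ for a typical active sensor $s_0$ in the sense of Palm probability: for a Borel set $B\subset\mathbb R^2$ with $0<|B|<\infty$, $F_{\gamma_{ap}}(\gamma_{th})$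 is the mean number of active sensors in $B$ whose SINR is at most $\gamma_{th}$, divided by the mean number of active sensors in $B$. **Lemma.** Put $\Lambda_1=(\lambda_s\rho_s+\lambda_{ap}\rho_{ap}\mu^{2/\alpha})\,\pi\,\Gamma(1+2/\alpha)\Gamma(1-2/\alpha)$ and, for $r>0$, $$E(r)=\exp\Big\{-\Lambda_1\gamma_{th}^{2/\alpha}r^2-\frac{\gamma_{th}r^\alpha\delta^2}{P_s}-\pi\lambda_{ap}(1-\rho_{ap})r^2\Big\}.$$ Then, for every such $B$ and every $\gamma_{th}\ge0$, all the integrals below converge absolutely and $$F_{\gamma_{ap}}(\gamma_{th})=1-2\pi\lambda_{ap}(1-\rho_{ap})\int_0^\infty rE(r)\,dr-2\pi\lambda_{ap}(1-\rho_{ap})\sum_{m=1}^{M-1}\frac1{(-1)^m}\sum_{(m_1,\dots,m_m)}\frac1{\prod_{l=1}^m m_l!\,l!^{m_l}}$$ $$\times\int_0^\infty (r^\alpha)^m\,rE(r)\Big[-\tfrac2\alpha\Lambda_1\gamma_{th}^{2/\alpha}r^{2-\alpha}-\frac{\gamma_{th}\delta^2}{P_s}\Big]^{m_1}\prod_{l=2}^m\Big[-\Lambda_1\gamma_{th}^{2/\alpha}\prod_{j=0}^{l-1}\big(\tfrac2\alpha-j\big)\,r^{2-l\alpha}\Big]^{m_l}dr,$$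 where the inner sum is over all tuples of nonnegative integers $(m_1,\dots,m_m)$ with $\sum_{l=1}^m l\,m_l=m$. -/

import Mathlib

open MeasureTheory ProbabilityTheory
open scoped ENNReal Matrix

noncomputable section

namespace WSN

/-- The sensing field. -/
abbrev Plane : Type := EuclideanSpace ℝ (Fin 2)

/-! ### Homogeneous Poisson point processes -/

/-- Number of points of the configuration `X 0 ω, X 1 ω, …` that lie in `B`. -/
def pointCount {Ω : Type*} (X : ℕ → Ω → Plane) (B : Set Plane) (ω : Ω) : ℝ≥0∞ :=
  ∑' n, B.indicator (fun _ => (1 : ℝ≥0∞)) (X n ω)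

/-- The random points `X 0, X 1, …` form a homogeneous Poisson point process of intensity `lam`
on the plane. (For `lam > 0` such a process has infinitely many points almost surely, so that its
points can be enumerated by `ℕ`; no particular order of the enumeration is required.) -/
structure IsHPPP {Ω : Type*} [MeasurableSpace Ω] (μ : Measure Ω) (lam : ℝ)
    (X : ℕ → Ω → Plane) : Prop where
  measurable : ∀ n, Measurable (X n)
  poisson : ∀ B : Set Plane, MeasurableSet B → volume B ≠ ∞ → ∀ k : ℕ,
    μ {ω | pointCount X B ω = k} =
      ENNReal.ofReal (Real.exp (-(lam * (volume B).toReal)) *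
        (lam * (volume B).toReal) ^ k / (k.factorial : ℝ))
  indep : ∀ (N : ℕ) (B : Fin N → Set Plane), (∀ i, MeasurableSet (B i)) →
    (∀ i, volume (B i) ≠ ∞) → Pairwise (Function.onFun Disjoint B) →
    iIndepFun (fun i => pointCount X (B i)) μ

/-! ### Rayleigh fading -/

/-- The standard circularly symmetric complex Gaussian law: independent real and imaginary parts,
each of mean `0` and variance `1 / 2`. -/
def stdComplexGaussian : Measure ℂ :=
  ((gaussianReal 0 (1 / 2)).prod (gaussianReal 0 (1 / 2))).map
    (fun p : ℝ × ℝ => (⟨p.1, p.2⟩ : ℂ))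

/-- The Euclidean norm of a complex vector. -/
def vecNorm {M : ℕ} (v : Fin M → ℂ) : ℝ := ‖WithLp.toLp 2 v‖

/-- The normalised vector `v / ‖v‖`. -/
def unitVec {M : ℕ} (v : Fin M → ℂ) : Fin M → ℂ := ((vecNorm v : ℂ))⁻¹ • v

/-! ### The network -/

/-- Index of a point nearest to `x` among the points `p k` with `E k`. -/
def nearestIdx (p : ℕ → Plane) (E : ℕ → Prop) (x : Plane) : ℕ :=
  sInf {k | E k ∧ ∀ l, E l → dist x (p k) ≤ dist x (p l)}

/-- Numerical parameters: intensities of sensors, access points and sinks, activity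
probabilities of sensors and access points, path loss exponent, transmit powers of the sensors and
of the access points, noise power. -/
structure Params where
  lamS : ℝ
  lamAp : ℝ
  lamSk : ℝ
  rhoS : ℝ
  rhoAp : ℝ
  alpha : ℝ
  powS : ℝ
  powAp : ℝ
  noise : ℝ

/-- The random quantities of the network, with `M` antennas at every access point. -/
structure Network (Ω : Type*) (M : ℕ) where
  /-- locations -/
  sensor : ℕ → Ω → Plane
  ap : ℕ → Ω → Plane
  sink : ℕ → Ω → Plane
  /-- is sensor `i` triggered to transmit? -/
  sensorActive : ℕ → Ω → Bool
  /-- is access point `j` forwarding data to its sink? -/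
  apActive : ℕ → Ω → Bool
  /-- `hSensor i k p`: channel from sensor `i` to antenna `p` of access point `k` -/
  hSensor : ℕ → ℕ → Fin M → Ω → ℂ
  /-- `hAp j k p q`: channel from antenna `q` of access point `j` to antenna `p` of
  access point `k` -/
  hAp : ℕ → ℕ → Fin M → Fin M → Ω → ℂ
  /-- `hSink j l q`: channel from antenna `q` of access point `j` to sink `l` -/
  hSink : ℕ → ℕ → Fin M → Ω → ℂ

/-- The independent sources of randomness: the three point processes, the activity of each node,
and each scalar fading coefficient. -/
inductive Source (M : ℕ) : Type where
  | sensors : Source M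
  | aps : Source M
  | sinks : Source M
  | sensorAct (i : ℕ) : Source M
  | apAct (j : ℕ) : Source M
  | sensorCh (i k : ℕ) (p : Fin M) : Source M
  | apCh (j k : ℕ) (p q : Fin M) : Source M
  | sinkCh (j l : ℕ) (q : Fin M) : Source M

namespace Network

variable {Ω : Type*} {M : ℕ}

/-- The sigma-algebra generated by a source of randomness. -/
def sourceSigma (W : Network Ω M) : Source M → MeasurableSpace Ω
  | .sensors => MeasurableSpace.comap (fun ω n => W.sensor n ω) inferInstance
  | .aps => MeasurableSpace.comap (fun ω n => W.ap n ω) inferInstance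
  | .sinks => MeasurableSpace.comap (fun ω n => W.sink n ω) inferInstance
  | .sensorAct i => MeasurableSpace.comap (W.sensorActive i) inferInstance
  | .apAct j => MeasurableSpace.comap (W.apActive j) inferInstance
  | .sensorCh i k p => MeasurableSpace.comap (W.hSensor i k p) inferInstance
  | .apCh j k p q => MeasurableSpace.comap (W.hAp j k p q) inferInstance
  | .sinkCh j l q => MeasurableSpace.comap (W.hSink j l q) inferInstance

/-- The distributional assumptions of the model: sensors, access points and sinks are homogeneous
Poisson point processes, every sensor (access point) is active with probability `rhoS` (`rhoAp`),
all fading coefficients are standard complex Gaussian (Rayleigh fading), and all these sources are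
independent. -/
structure IsModel [MeasurableSpace Ω] (W : Network Ω M) (P : Params) (μ : Measure Ω) : Prop where
  sensor_hppp : IsHPPP μ P.lamS W.sensor
  ap_hppp : IsHPPP μ P.lamAp W.ap
  sink_hppp : IsHPPP μ P.lamSk W.sink
  sensorActive_meas : ∀ i, Measurable (W.sensorActive i)
  sensorActive_prob : ∀ i, μ {ω | W.sensorActive i ω = true} = ENNReal.ofReal P.rhoS
  apActive_meas : ∀ j, Measurable (W.apActive j)
  apActive_prob : ∀ j, μ {ω | W.apActive j ω = true} = ENNReal.ofReal P.rhoAp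
  hSensor_meas : ∀ i k p, Measurable (W.hSensor i k p)
  hSensor_law : ∀ i k p, μ.map (W.hSensor i k p) = stdComplexGaussian
  hAp_meas : ∀ j k p q, Measurable (W.hAp j k p q)
  hAp_law : ∀ j k p q, μ.map (W.hAp j k p q) = stdComplexGaussian
  hSink_meas : ∀ j l q, Measurable (W.hSink j l q)
  hSink_law : ∀ j l q, μ.map (W.hSink j l q) = stdComplexGaussian
  indep : iIndep W.sourceSigma μ

/-- Channel vector from sensor `i` to access point `k`. -/
def sensorVec (W : Network Ω M) (i k : ℕ) (ω : Ω) : Fin M → ℂ := fun p => W.hSensor i k p ω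

/-- Channel matrix from access point `j` to access point `k`. -/
def apMat (W : Network Ω M) (j k : ℕ) (ω : Ω) : Matrix (Fin M) (Fin M) ℂ :=
  Matrix.of fun p q => W.hAp j k p q ω

/-- The sink associated with access point `j`: the nearest one. -/
def sinkOf (W : Network Ω M) (j : ℕ) (ω : Ω) : ℕ :=
  nearestIdx (fun l => W.sink l ω) (fun _ => True) (W.ap j ω)

/-- Channel (row) vector from access point `j` to its associated sink. -/
def sinkVec (W : Network Ω M) (j : ℕ) (ω : Ω) : Fin M → ℂ :=
  fun q => W.hSink j (W.sinkOf j ω) q ω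

/-- The access point associated with sensor `n`: the nearest one among those that are not
forwarding data (access points are half-duplex). -/
def apOf (W : Network Ω M) (n : ℕ) (ω : Ω) : ℕ :=
  nearestIdx (fun k => W.ap k ω) (fun k => W.apActive k ω = false) (W.sensor n ω)

open scoped Classical in
/-- Interference of the active sensors other than `n` at the access point `k`, which combines its
antennas with the maximal-ratio combiner of sensor `n`. -/
def interfSensor (W : Network Ω M) (P : Params) (n k : ℕ) (ω : Ω) : ℝ≥0∞ :=
  ∑' i, if W.sensorActive i ω = true ∧ i ≠ n then
    ENNReal.ofReal (‖star (unitVec (W.sensorVec n k ω)) ⬝ᵥ W.sensorVec i k ω‖ ^ 2 *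
      dist (W.sensor i ω) (W.ap k ω) ^ (-P.alpha)) else 0

open scoped Classical in
/-- Interference of the active access points other than `k` at the access point `k`, which combines
its antennas with the maximal-ratio combiner of sensor `n`; every active access point `j` uses
maximal-ratio transmission towards its own sink. -/
def interfAp (W : Network Ω M) (P : Params) (n k : ℕ) (ω : Ω) : ℝ≥0∞ :=
  ENNReal.ofReal (P.powAp / P.powS) *
    ∑' j, if W.apActive j ω = true ∧ j ≠ k then
      ENNReal.ofReal (‖star (unitVec (W.sensorVec n k ω)) ⬝ᵥ
          (W.apMat j k ω *ᵥ star (unitVec (W.sinkVec j ω)))‖ ^ 2 *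
        dist (W.ap j ω) (W.ap k ω) ^ (-P.alpha)) else 0

/-- The SINR of sensor `n` at its associated access point after maximal-ratio combining. -/
def sinr (W : Network Ω M) (P : Params) (n : ℕ) (ω : Ω) : ℝ≥0∞ :=
  ENNReal.ofReal (vecNorm (W.sensorVec n (W.apOf n ω) ω) ^ 2 *
      dist (W.sensor n ω) (W.ap (W.apOf n ω) ω) ^ (-P.alpha)) /
    (W.interfSensor P n (W.apOf n ω) ω + W.interfAp P n (W.apOf n ω) ω +
      ENNReal.ofReal (P.noise / P.powS))

open scoped Classical in
/-- Expected number of active sensors `n` in the region `B` for which the event `E n` occurs. -/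
def meanActive [MeasurableSpace Ω] (W : Network Ω M) (μ : Measure Ω) (B : Set Plane)
    (E : ℕ → Ω → Prop) : ℝ≥0∞ :=
  ∫⁻ ω, ∑' n, (if W.sensor n ω ∈ B ∧ W.sensorActive n ω = true ∧ E n ω then 1 else 0) ∂μ

/-- The CDF at `γ` of the SINR of the typical (active) sensor at its associated access point, in the
sense of Palm probability: the mean number of active sensors in `B` with SINR at most `γ`, divided
by the mean number of active sensors in `B`. -/
def typicalCdf [MeasurableSpace Ω] (W : Network Ω M) (P : Params) (μ : Measure Ω) (B : Set Plane)
    (γ : ℝ) : ℝ≥0∞ :=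
  W.meanActive μ B (fun n ω => W.sinr P n ω ≤ ENNReal.ofReal γ) /
    W.meanActive μ B (fun _ _ => True)

end Network

/-! ### The closed form -/

/-- The tuples `(m₁, …, mₘ)` of natural numbers with `∑ l * mₗ = m`
(`k l` stands for `mₗ₊₁`, as `l` runs over `0, …, m - 1`). -/
def multiIndices (m : ℕ) : Finset (Fin m → ℕ) :=
  {k ∈ Fintype.piFinset fun _ : Fin m => Finset.range (m + 1) |
    ∑ l : Fin m, (l.val + 1) * k l = m}

theorem mem_multiIndices {m : ℕ} {k : Fin m → ℕ} :
    k ∈ multiIndices m ↔ ∑ l : Fin m, (l.val + 1) * k l = m := by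
  simp only [multiIndices, Finset.mem_filter, Fintype.mem_piFinset, Finset.mem_range,
    and_iff_right_iff_imp]
  intro h l
  have h1 : (l.val + 1) * k l ≤ ∑ l : Fin m, (l.val + 1) * k l :=
    Finset.single_le_sum (f := fun l : Fin m => (l.val + 1) * k l)
      (fun _ _ => Nat.zero_le _) (Finset.mem_univ l)
  nlinarith

namespace Params

/-- `Λ₁ = (λₛ ρₛ + λₐₚ ρₐₚ μ^(2/α)) π Γ(1 + 2/α) Γ(1 - 2/α)`, with `μ = Pₐₚ / Pₛ`. -/
def Lam1 (P : Params) : ℝ :=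
  (P.lamS * P.rhoS + P.lamAp * P.rhoAp * (P.powAp / P.powS) ^ (2 / P.alpha)) * Real.pi *
    Real.Gamma (1 + 2 / P.alpha) * Real.Gamma (1 - 2 / P.alpha)

/-- The integrand of the main term. -/
def mainIntegrand (P : Params) (γ r : ℝ) : ℝ :=
  r * Real.exp (-P.Lam1 * γ ^ (2 / P.alpha) * r ^ 2 - γ * r ^ P.alpha * P.noise / P.powS -
    Real.pi * P.lamAp * (1 - P.rhoAp) * r ^ 2)

/-- The bracket with exponent `mₗ`, for `l ≥ 1`. -/
def bracket (P : Params) (γ r : ℝ) (l : ℕ) : ℝ :=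
  if l = 1 then
    -(2 / P.alpha) * P.Lam1 * γ ^ (2 / P.alpha) * r ^ (2 - P.alpha) - γ * P.noise / P.powS
  else
    -P.Lam1 * γ ^ (2 / P.alpha) * (∏ j ∈ Finset.range l, (2 / P.alpha - (j : ℝ))) *
      r ^ (2 - (l : ℝ) * P.alpha)

/-- The integrand of the correction term with index `(m₁, …, mₘ)`. -/
def corrIntegrand (P : Params) (γ : ℝ) {m : ℕ} (k : Fin m → ℕ) (r : ℝ) : ℝ :=
  (r ^ P.alpha) ^ m * P.mainIntegrand γ r * ∏ l : Fin m, P.bracket γ r (l.val + 1) ^ k l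

/-- The closed form of the CDF, for access points with `M` antennas. -/
def closedForm (P : Params) (M : ℕ) (γ : ℝ) : ℝ :=
  1 - 2 * Real.pi * P.lamAp * (1 - P.rhoAp) * (∫ r in Set.Ioi (0 : ℝ), P.mainIntegrand γ r) -
    2 * Real.pi * P.lamAp * (1 - P.rhoAp) *
      ∑ m ∈ Finset.Icc 1 (M - 1), (1 / (-1 : ℝ) ^ m) *
        ∑ k ∈ multiIndices m,
          (1 / ∏ l : Fin m, ((k l).factorial : ℝ) * ((l.val + 1).factorial : ℝ) ^ k l) *
            ∫ r in Set.Ioi (0 : ℝ), P.corrIntegrand γ k r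

end Params

end WSN

end

/-! Call a pair (sensor `n`, access point `k`) a link when `n` is active and lies in `B`, and `k` is
idle and strictly nearer to `n` than every other idle access point. To a link belong three data: its
distance, the squared norm of its channel, and the interference at `k`. The SINR is a function of
these data, so everything reduces to the measure `linkMeasure` that gives the mean number of links
with given data.

The key fact is that this measure is a constant times a product measure (`exists_linkMeasure_eq`):
distance, gain and interference of a typical link are independent. It is read off from the joint
transform, the mean of the sum over links of `1_A(distance) 1_D(gain) exp(-s I)`. The indicator of
the link event times `exp(-s I)` is an infinite product with one factor for each other sensor and
each other access point. Activities and channels of these nodes are independent marks and can be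
averaged factor by factor (`lintegral_iprod_marks`). Combiner and precoder are unit vectors, so a
projected channel is again standard complex Gaussian, whatever the direction; its squared modulus is
exponential, and an active node at distance `d` contributes the mean factor `1 / (1 + t d^(-α))`.

What is left depends on locations only. The sums over sensors and over access points are evaluated
by the Mecke formula, obtained here by differentiating the Laplace functional of the Poisson
process. For the access points the factors depend on the serving point itself, whence
`mecke_dependent`. The mean factor of an access point is a convex combination of "active and
interfering" and "idle and farther away", so in the exponent the interference integral and the area
of an empty disc simply add. This is why interference decouples from distance. The outcome is
`laplace_linkMeasure`, and uniqueness of Laplace transforms (`ext_of_laplace`) upgrades it to a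
product of laws.

The total mass of links equals the mean number of active sensors in `B`. Hence almost every active
sensor in `B` has a link, and the existence and uniqueness of a nearest idle access point need no
geometric argument.

The gain has the Gamma law with parameters `M` and `1`. Given distance `r` and interference `I`, the
SINR therefore exceeds `γ` with probability `∑_{m<M} t^m e^(-t) / m!`, where `t = s (I + δ²/P_s)`
and `s = γ r^α`. Averaging over `I` turns the powers of `I + δ²/P_s` into derivatives at `s` of
`exp(φ)`, with `φ(s) = -Λ₁ s^(2/α) - s δ²/P_s`. Faà di Bruno's formula, as a sum over the tuples
with `∑ l m_l = m`, yields the brackets of the closed form, and integration over `r` against the law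
of the service distance finishes. -/

namespace WSN

/-! ### The function `exp (-x)` on `[0, ∞]` and infinite products of numbers in `[0, 1]` -/

/-- `exp (-x)` for `x ∈ [0, ∞]`. -/
noncomputable def expNeg (x : ℝ≥0∞) : ℝ≥0∞ := EReal.exp (-(x : EReal))

@[simp] theorem expNeg_zero : expNeg 0 = 1 := by simp [expNeg]

@[simp] theorem expNeg_top : expNeg ∞ = 0 := by simp [expNeg]

theorem expNeg_antitone : Antitone expNeg := fun _ _ h =>
  EReal.exp_monotone (EReal.neg_le_neg_iff.2 (EReal.coe_ennreal_le_coe_ennreal_iff.2 h))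

theorem expNeg_strictAnti : StrictAnti expNeg := fun _ _ h =>
  EReal.exp_strictMono (EReal.neg_lt_neg_iff.2 (EReal.coe_ennreal_lt_coe_ennreal_iff.2 h))

theorem expNeg_injective : Function.Injective expNeg := expNeg_strictAnti.injective

theorem expNeg_le_one (x : ℝ≥0∞) : expNeg x ≤ 1 := by
  simpa using expNeg_antitone (zero_le (a := x))

theorem expNeg_ne_top (x : ℝ≥0∞) : expNeg x ≠ ∞ := ne_top_of_le_ne_top (by simp) (expNeg_le_one x)

theorem expNeg_ofReal {t : ℝ} (ht : 0 ≤ t) :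
    expNeg (ENNReal.ofReal t) = ENNReal.ofReal (Real.exp (-t)) := by
  rw [expNeg, EReal.coe_ennreal_ofReal, max_eq_left ht, ← EReal.coe_neg, EReal.exp_coe]

theorem expNeg_of_ne_top {x : ℝ≥0∞} (hx : x ≠ ∞) :
    expNeg x = ENNReal.ofReal (Real.exp (-x.toReal)) := by
  conv_lhs => rw [← ENNReal.ofReal_toReal hx]
  exact expNeg_ofReal ENNReal.toReal_nonneg

theorem expNeg_add (x y : ℝ≥0∞) : expNeg (x + y) = expNeg x * expNeg y := by
  rcases eq_or_ne x ∞ with rfl | hx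
  · simp
  rcases eq_or_ne y ∞ with rfl | hy
  · simp
  rw [expNeg_of_ne_top hx, expNeg_of_ne_top hy, expNeg_of_ne_top (ENNReal.add_ne_top.2 ⟨hx, hy⟩),
    ENNReal.toReal_add hx hy, neg_add, Real.exp_add, ENNReal.ofReal_mul (Real.exp_pos _).le]

theorem continuous_expNeg : Continuous expNeg :=
  ENNReal.continuous_exp.comp (continuous_neg.comp continuous_coe_ennreal_ereal)

@[fun_prop] theorem measurable_expNeg : Measurable expNeg := continuous_expNeg.measurable

theorem expNeg_sum {ι : Type*} (s : Finset ι) (f : ι → ℝ≥0∞) :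
    expNeg (∑ i ∈ s, f i) = ∏ i ∈ s, expNeg (f i) := by
  classical
  induction s using Finset.induction_on with
  | empty => simp
  | insert a s ha ih => rw [Finset.sum_insert ha, Finset.prod_insert ha, expNeg_add, ih]

theorem expNeg_nsmul (n : ℕ) (x : ℝ≥0∞) : expNeg (n * x) = expNeg x ^ n := by
  have := expNeg_sum (Finset.range n) (fun _ => x)
  simpa using this

/-- `-log v` for `v ∈ [0, 1]`. -/
noncomputable def negLog (v : ℝ≥0∞) : ℝ≥0∞ := (-ENNReal.log v).toENNReal

theorem expNeg_negLog {v : ℝ≥0∞} (hv : v ≤ 1) : expNeg (negLog v) = v := by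
  have h : 0 ≤ -ENNReal.log v := by
    rw [← neg_zero, EReal.neg_le_neg_iff]
    exact ENNReal.log_le_zero_iff.2 hv
  rw [expNeg, negLog, EReal.coe_toENNReal h, neg_neg, ENNReal.exp_log]

@[simp] theorem negLog_one : negLog 1 = 0 := by simp [negLog]

@[fun_prop] theorem measurable_negLog : Measurable negLog := by
  unfold negLog
  fun_prop

/-- The infinite product of the numbers `f 0, f 1, … ∈ [0, 1]`. -/
noncomputable def iprod (f : ℕ → ℝ≥0∞) : ℝ≥0∞ := ⨅ N, ∏ i ∈ Finset.range N, f i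

theorem antitone_prod_range {f : ℕ → ℝ≥0∞} (hf : ∀ i, f i ≤ 1) :
    Antitone fun N => ∏ i ∈ Finset.range N, f i :=
  antitone_nat_of_succ_le fun n => by
    rw [Finset.prod_range_succ]
    exact mul_le_of_le_one_right' (hf n)

theorem tendsto_prod_range {f : ℕ → ℝ≥0∞} (hf : ∀ i, f i ≤ 1) :
    Filter.Tendsto (fun N => ∏ i ∈ Finset.range N, f i) Filter.atTop (nhds (iprod f)) :=
  tendsto_atTop_iInf (antitone_prod_range hf)

/-- In `[0, ∞]` every series converges and `expNeg` is continuous up to `∞`, so partial products of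
exponentials converge with no summability condition. This is how sums over points become products
over points. -/
theorem expNeg_tsum (f : ℕ → ℝ≥0∞) : expNeg (∑' i, f i) = iprod fun i => expNeg (f i) := by
  have h1 : Filter.Tendsto (fun N => expNeg (∑ i ∈ Finset.range N, f i)) Filter.atTop
      (nhds (expNeg (∑' i, f i))) :=
    (continuous_expNeg.tendsto _).comp ENNReal.summable.hasSum.tendsto_sum_nat
  refine tendsto_nhds_unique h1 ?_
  simp only [expNeg_sum]
  exact tendsto_prod_range fun i => expNeg_le_one _

theorem iprod_mono {f g : ℕ → ℝ≥0∞} (h : ∀ i, f i ≤ g i) : iprod f ≤ iprod g :=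
  iInf_mono fun _ => Finset.prod_le_prod' fun i _ => h i

theorem iprod_le_one (f : ℕ → ℝ≥0∞) : iprod f ≤ 1 := iInf_le_of_le 0 (by simp)

/-- Taking logarithms reduces the algebra of infinite products, including vanishing factors, to that
of unconditional sums in `[0, ∞]`. -/
theorem iprod_eq_expNeg {f : ℕ → ℝ≥0∞} (hf : ∀ i, f i ≤ 1) :
    iprod f = expNeg (∑' i, negLog (f i)) := by
  rw [expNeg_tsum]
  simp only [expNeg_negLog (hf _)]

theorem iprod_mul {f g : ℕ → ℝ≥0∞} (hf : ∀ i, f i ≤ 1) (hg : ∀ i, g i ≤ 1) :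
    iprod (fun i => f i * g i) = iprod f * iprod g := by
  conv_lhs => enter [1, i]; rw [← expNeg_negLog (hf i), ← expNeg_negLog (hg i), ← expNeg_add]
  rw [← expNeg_tsum, ENNReal.tsum_add, expNeg_add, ← iprod_eq_expNeg hf, ← iprod_eq_expNeg hg]

/-- The sequence is the product of one that is `1` off `n` and one that is `1` at `n`. -/
theorem iprod_pull {f : ℕ → ℝ≥0∞} (hf : ∀ i, f i ≤ 1) (n : ℕ) :
    iprod f = f n * iprod (fun i => if i = n then 1 else f i) := by
  have h1 : ∀ i, (if i = n then f n else 1) ≤ (1 : ℝ≥0∞) := fun i => by split_ifs <;> simp [hf]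
  have h2 : ∀ i, (if i = n then 1 else f i) ≤ (1 : ℝ≥0∞) := fun i => by split_ifs <;> simp [hf]
  have h3 : f = fun i => (if i = n then f n else 1) * (if i = n then 1 else f i) := by
    funext i
    split_ifs with h
    · simp [h]
    · simp
  conv_lhs => rw [h3]
  rw [iprod_mul h1 h2, iprod_eq_expNeg h1, tsum_eq_single n]
  · simp [expNeg_negLog (hf n)]
  · intro i hi
    simp [hi]

@[simp] theorem iprod_one : iprod (fun _ => 1) = 1 := by simp [iprod]

/-- Two infima commute; for a finite product, an infimum along a decreasing sequence is a limit and
passes through the factors. -/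
theorem iprod_antitone_iInf {f : ℕ → ℕ → ℝ≥0∞} (hf : ∀ m i, f m i ≤ 1) (ha : Antitone f) :
    iprod (fun i => ⨅ m, f m i) = ⨅ m, iprod (f m) := by
  unfold iprod
  rw [iInf_comm]
  refine iInf_congr fun N => ?_
  have hm : ∀ i, Antitone fun m => f m i := fun i a b h => ha h i
  have h1 : Filter.Tendsto (fun m => ∏ i ∈ Finset.range N, f m i) Filter.atTop
      (nhds (∏ i ∈ Finset.range N, ⨅ m, f m i)) := by
    refine ENNReal.tendsto_finsetProd_of_ne_top _ (fun i _ => tendsto_atTop_iInf (hm i)) ?_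
    intro i _
    exact ne_top_of_le_ne_top ENNReal.one_ne_top (iInf_le_of_le 0 (hf 0 i))
  refine tendsto_nhds_unique h1 (tendsto_atTop_iInf fun a b h => ?_)
  exact Finset.prod_le_prod' fun i _ => ha h i

@[fun_prop] theorem measurable_iprod {α : Type*} [MeasurableSpace α] {f : ℕ → α → ℝ≥0∞}
    (hf : ∀ i, Measurable (f i)) : Measurable fun a => iprod fun i => f i a :=
  Measurable.iInf fun _ => Finset.measurable_fun_prod _ fun i _ => hf i


/-! ### Poisson point processes: Laplace functional and Mecke formula -/

section Poisson

open Filter Topology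

theorem measurable_pointCount {Ω : Type*} [MeasurableSpace Ω] {X : ℕ → Ω → Plane}
    (hX : ∀ n, Measurable (X n)) {B : Set Plane} (hB : MeasurableSet B) :
    Measurable (pointCount X B) := by
  unfold pointCount
  exact Measurable.tsum fun n => (measurable_const.indicator hB).comp (hX n)

theorem tendsto_tsum_of_monotone {f : ℕ → ℕ → ℝ≥0∞} {F : ℕ → ℝ≥0∞} (hm : Monotone f)
    (hF : ∀ n, Tendsto (fun k => f k n) atTop (𝓝 (F n))) :
    Tendsto (fun k => ∑' n, f k n) atTop (𝓝 (∑' n, F n)) := by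
  simp only [← lintegral_count]
  exact lintegral_tendsto_of_tendsto_of_monotone (fun k => (measurable_of_countable _).aemeasurable)
    (ae_of_all _ fun n a b h => hm h n) (ae_of_all _ hF)

/-- This is the integral of a simple function against the point measure `∑ δ_{X n}`. The value `0`
is left out because its level set may have infinite volume, where `IsHPPP` gives no information. -/
theorem tsum_simpleFunc {Ω : Type*} {X : ℕ → Ω → Plane} (g : SimpleFunc Plane ℝ≥0∞) (ω : Ω) :
    ∑' n, g (X n ω) = ∑ c ∈ g.range.filter (· ≠ 0), c * pointCount X (g ⁻¹' {c}) ω := by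
  have h := SimpleFunc.lintegral_eq_lintegral g (Measure.sum fun n => Measure.dirac (X n ω))
  rw [lintegral_sum_measure] at h
  simp only [lintegral_dirac' _ g.measurable] at h
  rw [h, SimpleFunc.lintegral, Finset.sum_filter_of_ne]
  · refine Finset.sum_congr rfl fun c _ => ?_
    rw [Measure.sum_apply _ (g.measurableSet_preimage _), pointCount]
    congr 1
    refine tsum_congr fun n => ?_
    rw [Measure.dirac_apply' _ (g.measurableSet_preimage _)]
    rfl
  · intro c _ hc h0
    exact hc (by simp [h0])

variable {Ω : Type*} [MeasurableSpace Ω] {μ : Measure Ω} [IsProbabilityMeasure μ] {lam : ℝ}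
  {X : ℕ → Ω → Plane}

/-- The Poisson weights sum to `1`, so the count is almost surely a natural number and the
probability space splits into the events of a given count. No measurability of `F` is needed. -/
theorem IsHPPP.lintegral_comp_pointCount (hX : IsHPPP μ lam X) (hlam : 0 ≤ lam) {B : Set Plane}
    (hB : MeasurableSet B) (hB' : volume B ≠ ∞) (F : ℝ≥0∞ → ℝ≥0∞) :
    ∫⁻ ω, F (pointCount X B ω) ∂μ = ∑' k : ℕ, F k *
      ENNReal.ofReal (Real.exp (-(lam * (volume B).toReal)) *
        (lam * (volume B).toReal) ^ k / (k.factorial : ℝ)) := by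
  set m := lam * (volume B).toReal with hm
  have hm0 : 0 ≤ m := by positivity
  have hN := measurable_pointCount hX.measurable hB
  let S : ℕ → Set Ω := fun k => {ω | pointCount X B ω = k}
  have hS : ∀ k, MeasurableSet (S k) := fun k => hN (measurableSet_singleton _)
  have hdis : Pairwise (Function.onFun Disjoint S) := by
    intro i j hij
    refine Set.disjoint_left.2 fun ω h1 h2 => hij ?_
    have h3 : ((i : ℕ) : ℝ≥0∞) = j := h1.symm.trans h2
    exact_mod_cast h3
  have hp : ∀ k, μ (S k) = ENNReal.ofReal (Real.exp (-m) * m ^ k / (k.factorial : ℝ)) :=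
    fun k => hX.poisson B hB hB' k
  have hsum : HasSum (fun k : ℕ => Real.exp (-m) * m ^ k / (k.factorial : ℝ)) 1 := by
    have h := (NormedSpace.expSeries_div_hasSum_exp m).mul_left (Real.exp (-m))
    rw [← Real.exp_eq_exp_ℝ, ← Real.exp_add, neg_add_cancel, Real.exp_zero] at h
    simpa only [mul_div_assoc] using h
  have hU : μ (⋃ k, S k) = 1 := by
    rw [measure_iUnion hdis hS]
    simp only [hp]
    rw [← ENNReal.ofReal_tsum_of_nonneg (fun k => by positivity) hsum.summable, hsum.tsum_eq,
      ENNReal.ofReal_one]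
  have hU' : ∀ᵐ ω ∂μ, ω ∈ ⋃ k, S k :=
    (prob_compl_eq_zero_iff (MeasurableSet.iUnion hS)).2 hU
  rw [← Measure.restrict_eq_self_of_ae_mem hU', lintegral_iUnion hS hdis]
  refine tsum_congr fun k => ?_
  rw [setLIntegral_congr_fun (hS k) (g := fun _ => F k)
    (fun ω hω => by show F (pointCount X B ω) = F k; rw [show pointCount X B ω = k from hω]),
    setLIntegral_const, hp]

theorem IsHPPP.laplace_pointCount (hX : IsHPPP μ lam X) (hlam : 0 ≤ lam) {B : Set Plane}
    (hB : MeasurableSet B) (hB' : volume B ≠ ∞) {c : ℝ≥0∞} (hc : c ≠ ∞) :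
    ∫⁻ ω, expNeg (c * pointCount X B ω) ∂μ =
      expNeg (ENNReal.ofReal lam * ((1 - expNeg c) * volume B)) := by
  rw [hX.lintegral_comp_pointCount hlam hB hB' (fun x => expNeg (c * x))]
  set m := (volume B).toReal with hm
  have hm0 : 0 ≤ m := ENNReal.toReal_nonneg
  set q := Real.exp (-c.toReal) with hq
  have hq0 : 0 ≤ q := (Real.exp_pos _).le
  have hq1 : q ≤ 1 := Real.exp_le_one_iff.2 (neg_nonpos.2 ENNReal.toReal_nonneg)
  have hsum : HasSum (fun k : ℕ => Real.exp (-(lam * m)) * ((lam * m * q) ^ k / (k.factorial : ℝ)))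
      (Real.exp (-(lam * m)) * Real.exp (lam * m * q)) := by
    have h := (NormedSpace.expSeries_div_hasSum_exp (lam * m * q)).mul_left (Real.exp (-(lam * m)))
    rwa [← Real.exp_eq_exp_ℝ] at h
  have h1 : ∀ k : ℕ, expNeg (c * k) *
      ENNReal.ofReal (Real.exp (-(lam * m)) * (lam * m) ^ k / (k.factorial : ℝ)) =
      ENNReal.ofReal (Real.exp (-(lam * m)) * ((lam * m * q) ^ k / (k.factorial : ℝ))) := by
    intro k
    rw [mul_comm c, expNeg_nsmul, expNeg_of_ne_top hc, ← ENNReal.ofReal_pow hq0,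
      ← ENNReal.ofReal_mul (by positivity)]
    congr 1
    rw [mul_pow (lam * m) q]
    ring
  simp only [h1]
  rw [← ENNReal.ofReal_tsum_of_nonneg (fun k => by positivity) hsum.summable, hsum.tsum_eq,
    ← Real.exp_add, ← ENNReal.ofReal_toReal hB', expNeg_of_ne_top hc, ← hm, ← hq,
    ← ENNReal.ofReal_one, ← ENNReal.ofReal_sub _ hq0,
    ← ENNReal.ofReal_mul (by linarith), ← ENNReal.ofReal_mul hlam, expNeg_ofReal]
  · congr 2
    ring
  · have : 0 ≤ 1 - q := by linarith
    positivity

/-- The nonzero level sets are disjoint and of finite volume, so their counts are independent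
Poisson variables and the transform is a product of Poisson generating functions. -/
theorem IsHPPP.laplace_simpleFunc (hX : IsHPPP μ lam X) (hlam : 0 ≤ lam)
    (g : SimpleFunc Plane ℝ≥0∞) (hg : ∀ x, g x ≠ ∞) (hg' : volume {x | g x ≠ 0} ≠ ∞) :
    ∫⁻ ω, expNeg (∑' n, g (X n ω)) ∂μ =
      expNeg (ENNReal.ofReal lam * ∫⁻ x, (1 - expNeg (g x))) := by
  set s := g.range.filter (· ≠ 0) with hs
  have hvol : ∀ c ∈ s, volume (g ⁻¹' {c}) ≠ ∞ := by
    intro c hc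
    refine ne_top_of_le_ne_top hg' (measure_mono fun x hx => ?_)
    have : g x = c := hx
    simpa [this] using (Finset.mem_filter.1 hc).2
  let e := s.equivFin
  let C : Fin s.card → Set Plane := fun i => g ⁻¹' {((e.symm i : s) : ℝ≥0∞)}
  have hind := hX.indep s.card C (fun i => g.measurableSet_preimage _)
    (fun i => hvol _ (e.symm i).2) (by
      intro i j hij
      refine Set.disjoint_left.2 fun x h1 h2 => hij ?_
      have h3 : ((e.symm i : s) : ℝ≥0∞) = (e.symm j : s) := Eq.trans (Eq.symm h1) h2
      exact e.symm.injective (Subtype.ext h3))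
  have hind' : iIndepFun (fun i ω => expNeg (((e.symm i : s) : ℝ≥0∞) * pointCount X (C i) ω)) μ :=
    hind.comp (fun i x => expNeg (((e.symm i : s) : ℝ≥0∞) * x)) (fun i => by fun_prop)
  have hprod := lintegral_prod_eq_prod_lintegral_of_indepFun Finset.univ _ hind'
    (fun i => measurable_expNeg.comp ((measurable_pointCount hX.measurable
      (g.measurableSet_preimage _)).const_mul _))
  have hL : ∀ ω, expNeg (∑' n, g (X n ω)) =
      ∏ i, expNeg (((e.symm i : s) : ℝ≥0∞) * pointCount X (C i) ω) := by
    intro ω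
    rw [tsum_simpleFunc, ← hs, expNeg_sum,
      ← Finset.prod_coe_sort s (fun c => expNeg (c * pointCount X (g ⁻¹' {c}) ω))]
    exact (Equiv.prod_comp e.symm fun c : s =>
      expNeg ((c : ℝ≥0∞) * pointCount X (g ⁻¹' {(c : ℝ≥0∞)}) ω)).symm
  simp only [hL]
  rw [hprod]
  have h1 : ∀ i, ∫⁻ ω, expNeg (((e.symm i : s) : ℝ≥0∞) * pointCount X (C i) ω) ∂μ =
      expNeg (ENNReal.ofReal lam * ((1 - expNeg ((e.symm i : s) : ℝ≥0∞)) * volume (C i))) := by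
    intro i
    refine hX.laplace_pointCount hlam (g.measurableSet_preimage _) (hvol _ (e.symm i).2) ?_
    obtain ⟨x, hx⟩ := SimpleFunc.mem_range.1 (Finset.mem_filter.1 (e.symm i).2).1
    rw [← hx]
    exact hg x
  simp only [h1]
  rw [← expNeg_sum, ← Finset.mul_sum]
  congr 2
  have h2 := Equiv.sum_comp e.symm fun c : s =>
      (1 - expNeg (c : ℝ≥0∞)) * volume (g ⁻¹' {(c : ℝ≥0∞)})
  rw [h2, Finset.sum_coe_sort s (fun c => (1 - expNeg c) * volume (g ⁻¹' {c}))]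
  have h3 := SimpleFunc.lintegral_eq_lintegral (g.map fun c => 1 - expNeg c) volume
  rw [SimpleFunc.map_lintegral] at h3
  have h4 : ∀ x, (g.map fun c => 1 - expNeg c) x = 1 - expNeg (g x) := fun x => rfl
  simp only [h4] at h3
  rw [h3, hs, Finset.sum_filter_of_ne]
  intro c _ hc h0
  exact hc (by simp [h0])

/-- The Laplace functional of a homogeneous Poisson point process. -/
theorem IsHPPP.laplace (hX : IsHPPP μ lam X) (hlam : 0 ≤ lam) {g : Plane → ℝ≥0∞}
    (hg : Measurable g) :
    ∫⁻ ω, expNeg (∑' n, g (X n ω)) ∂μ =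
      expNeg (ENNReal.ofReal lam * ∫⁻ x, (1 - expNeg (g x))) := by
  -- Cutting off at a ball of radius `k` gives the approximations supports of finite volume, as the
  -- simple case requires; they still increase to `g`.
  let G : ℕ → SimpleFunc Plane ℝ≥0∞ := fun k =>
    (SimpleFunc.eapprox g k).restrict (Metric.ball 0 k)
  have hG : ∀ k x, G k x = (Metric.ball (0 : Plane) k).indicator (SimpleFunc.eapprox g k) x :=
    fun k x => SimpleFunc.restrict_apply _ Metric.isOpen_ball.measurableSet x
  have hmono : ∀ x, Monotone fun k => G k x := by
    intro x a b hab
    simp only [hG]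
    refine (Set.indicator_le_indicator (SimpleFunc.monotone_eapprox g hab x)).trans ?_
    refine Set.indicator_le_indicator_of_subset (Metric.ball_subset_ball (by exact_mod_cast hab))
      (fun _ => zero_le) x
  have hlim : ∀ x, Tendsto (fun k => G k x) atTop (𝓝 (g x)) := by
    intro x
    have h1 : Tendsto (fun k => SimpleFunc.eapprox g k x) atTop (𝓝 (g x)) := by
      rw [← SimpleFunc.iSup_eapprox_apply hg x]
      exact tendsto_atTop_iSup fun a b h => SimpleFunc.monotone_eapprox g h x
    refine h1.congr' ?_
    obtain ⟨K, hK⟩ := exists_nat_gt ‖x‖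
    filter_upwards [eventually_ge_atTop K] with k hk
    rw [hG, Set.indicator_of_mem]
    have : (K : ℝ) ≤ k := by exact_mod_cast hk
    simpa using hK.trans_le this
  have hk : ∀ k, ∫⁻ ω, expNeg (∑' n, G k (X n ω)) ∂μ =
      expNeg (ENNReal.ofReal lam * ∫⁻ x, (1 - expNeg (G k x))) := by
    intro k
    refine hX.laplace_simpleFunc hlam _ (fun x => ?_) ?_
    · rw [hG]
      exact ne_top_of_le_ne_top (SimpleFunc.eapprox_lt_top g k x).ne (Set.indicator_le_self _ _ x)
    · refine ne_top_of_le_ne_top (measure_ball_lt_top (μ := volume) (x := (0 : Plane)) (r := k)).ne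
        (measure_mono fun x hx => ?_)
      rw [Set.mem_ofPred_eq, hG] at hx
      exact Set.mem_of_indicator_ne_zero hx
  have hL : Tendsto (fun k => ∫⁻ ω, expNeg (∑' n, G k (X n ω)) ∂μ) atTop
      (𝓝 (∫⁻ ω, expNeg (∑' n, g (X n ω)) ∂μ)) := by
    refine tendsto_lintegral_of_dominated_convergence (fun _ => 1) (fun k => ?_)
      (fun k => ae_of_all _ fun ω => expNeg_le_one _) (by simp) (ae_of_all _ fun ω => ?_)
    · exact measurable_expNeg.comp (Measurable.tsum fun n =>
        (G k).measurable.comp (hX.measurable n))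
    · exact (continuous_expNeg.tendsto _).comp
        (tendsto_tsum_of_monotone (fun a b h n => hmono _ h) fun n => hlim _)
  have hR : Tendsto (fun k => expNeg (ENNReal.ofReal lam * ∫⁻ x, (1 - expNeg (G k x)))) atTop
      (𝓝 (expNeg (ENNReal.ofReal lam * ∫⁻ x, (1 - expNeg (g x))))) := by
    refine (continuous_expNeg.tendsto _).comp
      (ENNReal.Tendsto.const_mul ?_ (Or.inr ENNReal.ofReal_ne_top))
    refine lintegral_tendsto_of_tendsto_of_monotone (fun k => ?_) (ae_of_all _ fun x a b h => ?_)
      (ae_of_all _ fun x => ?_)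
    · exact (measurable_const.sub (measurable_expNeg.comp (G k).measurable)).aemeasurable
    · exact tsub_le_tsub_left (expNeg_antitone (hmono x h)) 1
    · exact ENNReal.Tendsto.sub tendsto_const_nhds ((continuous_expNeg.tendsto _).comp (hlim x))
        (Or.inl (by simp))
  simp only [hk] at hL
  exact tendsto_nhds_unique hL hR

end Poisson


/-! ### The Mecke formula with a weight that does not depend on the distinguished point. -/

section Mecke

open Filter Topology

theorem tendsto_two_pow_mul {f : ℝ → ℝ} {c : ℝ} (hf : HasDerivAt f c 0) (h0 : f 0 = 0) :
    Tendsto (fun m : ℕ => (2 : ℝ) ^ m * f ((2 ^ m)⁻¹)) atTop (𝓝 c) := by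
  have h1 : Tendsto (fun m : ℕ => ((2 : ℝ) ^ m)⁻¹) atTop (𝓝[≠] 0) := by
    refine tendsto_nhdsWithin_iff.2 ⟨?_, Eventually.of_forall fun m => ?_⟩
    · exact tendsto_inv_atTop_zero.comp (tendsto_pow_atTop_atTop_of_one_lt one_lt_two)
    · simp
  have h2 := (hasDerivAt_iff_tendsto_slope.1 hf).comp h1
  refine h2.congr fun m => ?_
  simp [slope, h0]

/-- With `q = exp(-x / 2^(m+1))` the claim is `1 - q² ≤ 2 (1 - q)`. Dyadic scales are used because
halving the argument gives exactly this square, which makes monotone convergence available in the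
differentiation below. -/
theorem two_pow_mul_one_sub_expNeg_mono (x : ℝ≥0∞) :
    Monotone fun m : ℕ => (2 : ℝ≥0∞) ^ m * (1 - expNeg ((2 ^ m)⁻¹ * x)) := by
  refine monotone_nat_of_le_succ fun m => ?_
  set q := expNeg ((2 ^ (m + 1))⁻¹ * x) with hq
  have h1 : expNeg ((2 ^ m)⁻¹ * x) = q * q := by
    rw [hq, ← expNeg_add, ← two_mul, ← mul_assoc, pow_succ,
      ENNReal.mul_inv (by simp) (by simp), mul_comm (2 : ℝ≥0∞), mul_assoc _ _ (2 : ℝ≥0∞),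
      ENNReal.inv_mul_cancel (by simp) (by simp), mul_one]
  have hq1 : q ≤ 1 := expNeg_le_one _
  rw [h1, pow_succ, mul_assoc]
  gcongr
  rw [two_mul, tsub_le_iff_right]
  have h2 : (1 - q) + q = 1 := tsub_add_cancel_of_le hq1
  calc (1 : ℝ≥0∞) = (1 - q) + q * 1 := by rw [mul_one, h2]
    _ = (1 - q) + q * ((1 - q) + q) := by rw [h2]
    _ = (1 - q) + (q * (1 - q) + q * q) := by rw [mul_add]
    _ ≤ (1 - q) + (1 * (1 - q) + q * q) := by gcongr
    _ = (1 - q) + (1 - q) + q * q := by rw [one_mul, add_assoc]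

theorem ofReal_two_pow_mul_one_sub {q : ℝ} (hq : 0 ≤ q) (m : ℕ) :
    (2 : ℝ≥0∞) ^ m * (1 - ENNReal.ofReal q) = ENNReal.ofReal ((2 : ℝ) ^ m * (1 - q)) := by
  rw [← ENNReal.ofReal_one, ← ENNReal.ofReal_sub _ hq, ENNReal.ofReal_mul (by positivity),
    ENNReal.ofReal_pow (by norm_num), ENNReal.ofReal_ofNat]

theorem tendsto_two_pow_mul_one_sub_expNeg (x : ℝ≥0∞) :
    Tendsto (fun m : ℕ => (2 : ℝ≥0∞) ^ m * (1 - expNeg ((2 ^ m)⁻¹ * x))) atTop (𝓝 x) := by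
  rcases eq_or_ne x ∞ with rfl | hx
  · have h : ∀ m : ℕ, ((2 : ℝ≥0∞) ^ m)⁻¹ * ∞ = ∞ := fun m => ENNReal.mul_top (by simp)
    simp only [h, expNeg_top, tsub_zero, mul_one]
    exact ENNReal.tendsto_pow_atTop_nhds_top_iff.2 (by norm_num)
  · have hd : HasDerivAt (fun t : ℝ => 1 - Real.exp (-(t * x.toReal))) x.toReal 0 := by
      have := ((((hasDerivAt_id (0 : ℝ)).mul_const x.toReal).neg).exp).const_sub 1
      simpa using this
    have h := ENNReal.tendsto_ofReal (tendsto_two_pow_mul hd (by simp))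
    rw [ENNReal.ofReal_toReal hx] at h
    refine h.congr fun m => ?_
    rw [← ofReal_two_pow_mul_one_sub (Real.exp_pos _).le, ← expNeg_ofReal (by positivity),
      ENNReal.ofReal_mul (by positivity), ENNReal.ofReal_toReal hx,
      ENNReal.ofReal_inv_of_pos (by positivity), ENNReal.ofReal_pow (by norm_num),
      ENNReal.ofReal_ofNat]

theorem tendsto_two_pow_mul_one_sub_expNeg_comp {θ : ℝ≥0∞} (hθ : θ ≠ ∞) :
    Tendsto (fun m : ℕ => (2 : ℝ≥0∞) ^ m * (1 - expNeg (θ * (1 - expNeg ((2 ^ m)⁻¹)))))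
      atTop (𝓝 θ) := by
  have hd : HasDerivAt (fun t : ℝ => 1 - Real.exp (-(θ.toReal * (1 - Real.exp (-t)))))
      θ.toReal 0 := by
    have := ((((((hasDerivAt_id (0 : ℝ)).neg).exp).const_sub 1).const_mul θ.toReal).neg.exp).const_sub 1
    simpa using this
  have h := ENNReal.tendsto_ofReal (tendsto_two_pow_mul hd (by simp))
  rw [ENNReal.ofReal_toReal hθ] at h
  refine h.congr fun m => ?_
  have h1 : (2 ^ m : ℝ≥0∞)⁻¹ = ENNReal.ofReal ((2 ^ m)⁻¹) := by
    rw [ENNReal.ofReal_inv_of_pos (by positivity), ENNReal.ofReal_pow (by norm_num),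
      ENNReal.ofReal_ofNat]
  have h2 : (0 : ℝ) ≤ 1 - Real.exp (-(2 ^ m)⁻¹) := by
    rw [sub_nonneg, Real.exp_le_one_iff, neg_nonpos]
    positivity
  rw [h1, expNeg_ofReal (by positivity), ← ENNReal.ofReal_one,
    ← ENNReal.ofReal_sub _ (Real.exp_pos _).le, ← ENNReal.ofReal_toReal hθ,
    ← ENNReal.ofReal_mul ENNReal.toReal_nonneg, expNeg_ofReal (by positivity),
    ENNReal.ofReal_one, ofReal_two_pow_mul_one_sub (Real.exp_pos _).le,
    ENNReal.toReal_ofReal ENNReal.toReal_nonneg]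

theorem measure_ext_of_volume_ne_top {ν ν' : Measure Plane}
    (h : ∀ C, MeasurableSet C → volume C ≠ ∞ → ν C = ν' C) : ν = ν' := by
  refine (Measure.ext_iff_of_iUnion_eq_univ (Metric.iUnion_ball_nat (0 : Plane))).2 fun k => ?_
  refine Measure.ext fun C hC => ?_
  rw [Measure.restrict_apply hC, Measure.restrict_apply hC]
  refine h _ (hC.inter Metric.isOpen_ball.measurableSet) ?_
  exact ne_top_of_le_ne_top measure_ball_lt_top.ne (measure_mono Set.inter_subset_right)

theorem lintegral_withDensity_fun {α : Type*} [MeasurableSpace α] {ν : Measure α}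
    {w f : α → ℝ≥0∞} (hw : Measurable w) (hf : Measurable f) :
    ∫⁻ a, f a ∂(ν.withDensity w) = ∫⁻ a, w a * f a ∂ν :=
  lintegral_withDensity_eq_lintegral_mul _ hw hf

/-- The intensity measure of the points `X n`, weighted by the random weights `w n`. -/
noncomputable def weightedIntensity {Ω : Type*} [MeasurableSpace Ω] (μ : Measure Ω)
    (X : ℕ → Ω → Plane) (w : ℕ → Ω → ℝ≥0∞) : Measure Plane :=
  Measure.sum fun n => (μ.withDensity (w n)).map (X n)

variable {Ω : Type*} [MeasurableSpace Ω] {μ : Measure Ω} {lam : ℝ} {X : ℕ → Ω → Plane}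

theorem lintegral_weightedIntensity (hX : ∀ n, Measurable (X n)) {w : ℕ → Ω → ℝ≥0∞}
    (hw : ∀ n, Measurable (w n)) {f : Plane → ℝ≥0∞} (hf : Measurable f) :
    ∫⁻ x, f x ∂(weightedIntensity μ X w) = ∑' n, ∫⁻ ω, f (X n ω) * w n ω ∂μ := by
  rw [weightedIntensity, lintegral_sum_measure]
  refine tsum_congr fun n => ?_
  have hfX : Measurable fun ω => f (X n ω) := hf.comp (hX n)
  rw [lintegral_map hf (hX n), lintegral_withDensity_fun (hw n) hfX]
  exact lintegral_congr fun ω => mul_comm _ _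

theorem weightedIntensity_apply (hX : ∀ n, Measurable (X n)) {w : ℕ → Ω → ℝ≥0∞}
    (hw : ∀ n, Measurable (w n)) {C : Set Plane} (hC : MeasurableSet C) :
    weightedIntensity μ X w C = ∑' n, ∫⁻ ω, C.indicator 1 (X n ω) * w n ω ∂μ := by
  rw [← lintegral_weightedIntensity hX hw (measurable_one.indicator hC), lintegral_indicator_one hC]

variable [IsProbabilityMeasure μ]

/-- Replace `g` by `g + t 1_C` in the Laplace functional and differentiate at `t = 0`: the left side
brings down the number of points in `C`, the right side `λ ∫_C exp(-g)`. The derivative is taken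
along `t = 2^(-m)`, where the difference quotients increase. -/
theorem IsHPPP.lintegral_count_mul_expNeg (hX : IsHPPP μ lam X) (hlam : 0 ≤ lam)
    {g : Plane → ℝ≥0∞} (hg : Measurable g) {C : Set Plane} (hC : MeasurableSet C)
    (hC' : volume C ≠ ∞) :
    ∫⁻ ω, pointCount X C ω * expNeg (∑' n, g (X n ω)) ∂μ =
      expNeg (ENNReal.ofReal lam * ∫⁻ x, (1 - expNeg (g x))) *
        (ENNReal.ofReal lam * ∫⁻ x in C, expNeg (g x)) := by
  set L := expNeg (ENNReal.ofReal lam * ∫⁻ x, (1 - expNeg (g x))) with hL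
  have hLtop : L ≠ ∞ := expNeg_ne_top _
  set J := ∫⁻ x in C, expNeg (g x) with hJ
  have hJtop : J ≠ ∞ := by
    refine ne_top_of_le_ne_top hC' ?_
    calc J ≤ ∫⁻ x in C, 1 := lintegral_mono fun x => expNeg_le_one _
      _ = volume C := by simp
  have hN := measurable_pointCount hX.measurable hC
  have hG : Measurable fun ω => expNeg (∑' n, g (X n ω)) :=
    measurable_expNeg.comp (Measurable.tsum fun n => hg.comp (hX.measurable n))
  have htilt : ∀ t : ℝ≥0∞, ∫⁻ ω, expNeg (t * pointCount X C ω) * expNeg (∑' n, g (X n ω)) ∂μ =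
      L * expNeg (ENNReal.ofReal lam * J * (1 - expNeg t)) := by
    intro t
    have h1 := hX.laplace hlam (g := fun x => C.indicator (fun _ => t) x + g x)
      ((measurable_const.indicator hC).add hg)
    have h2 : ∀ ω, ∑' n, (C.indicator (fun _ => t) (X n ω) + g (X n ω)) =
        t * pointCount X C ω + ∑' n, g (X n ω) := by
      intro ω
      rw [ENNReal.tsum_add, pointCount, ← ENNReal.tsum_mul_left]
      congr 1
      refine tsum_congr fun n => ?_
      by_cases h : X n ω ∈ C <;> simp [h]
    have h3 : ∀ x, 1 - expNeg (C.indicator (fun _ => t) x + g x) =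
        (1 - expNeg (g x)) + C.indicator (fun x => expNeg (g x) * (1 - expNeg t)) x := by
      intro x
      by_cases h : x ∈ C
      · rw [Set.indicator_of_mem h, Set.indicator_of_mem h, expNeg_add,
          ENNReal.mul_sub (fun _ _ => expNeg_ne_top _), mul_one, mul_comm]
        refine (tsub_add_tsub_cancel (expNeg_le_one _) ?_).symm
        exact mul_le_of_le_one_right' (expNeg_le_one _)
      · simp [h]
    simp only [h2, h3] at h1
    simp only [expNeg_add] at h1
    have hmg : Measurable fun x => 1 - expNeg (g x) :=
      measurable_const.sub (measurable_expNeg.comp hg)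
    have hmg' : Measurable fun x => expNeg (g x) := measurable_expNeg.comp hg
    rw [h1, lintegral_add_left hmg, lintegral_indicator hC, lintegral_mul_const _ hmg', mul_add,
      expNeg_add, mul_assoc (ENNReal.ofReal lam)]
  have h0 := htilt 0
  simp only [zero_mul, expNeg_zero, one_mul, tsub_self, mul_zero, mul_one] at h0
  have hdiff : ∀ t : ℝ≥0∞,
      ∫⁻ ω, (1 - expNeg (t * pointCount X C ω)) * expNeg (∑' n, g (X n ω)) ∂μ =
        L * (1 - expNeg (ENNReal.ofReal lam * J * (1 - expNeg t))) := by
    intro t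
    rw [ENNReal.mul_sub (fun _ _ => hLtop), mul_one, ← htilt t, ← h0, ← lintegral_sub]
    · refine lintegral_congr fun ω => ?_
      rw [ENNReal.sub_mul (fun _ _ => expNeg_ne_top _), one_mul]
    · exact (measurable_expNeg.comp (hN.const_mul t)).mul hG
    · rw [htilt]
      exact ENNReal.mul_ne_top (expNeg_ne_top _) (expNeg_ne_top _)
    · exact ae_of_all _ fun ω => mul_le_of_le_one_left' (expNeg_le_one _)
  have hlim1 : Tendsto (fun m : ℕ => ∫⁻ ω, ((2 : ℝ≥0∞) ^ m *
      (1 - expNeg ((2 ^ m)⁻¹ * pointCount X C ω))) * expNeg (∑' n, g (X n ω)) ∂μ) atTop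
      (𝓝 (∫⁻ ω, pointCount X C ω * expNeg (∑' n, g (X n ω)) ∂μ)) := by
    refine lintegral_tendsto_of_tendsto_of_monotone (fun m => ?_)
      (ae_of_all _ fun ω a b h => ?_) (ae_of_all _ fun ω => ?_)
    · exact (((measurable_const.sub (measurable_expNeg.comp (hN.const_mul _))).const_mul _).mul
        hG).aemeasurable
    · exact mul_le_mul_left (two_pow_mul_one_sub_expNeg_mono (pointCount X C ω) h) _
    · exact ENNReal.Tendsto.mul_const (tendsto_two_pow_mul_one_sub_expNeg _)
        (Or.inr (expNeg_ne_top _))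
  have hθ : ENNReal.ofReal lam * J ≠ ∞ := ENNReal.mul_ne_top ENNReal.ofReal_ne_top hJtop
  have hlim2 : Tendsto (fun m : ℕ => L * ((2 : ℝ≥0∞) ^ m *
      (1 - expNeg (ENNReal.ofReal lam * J * (1 - expNeg ((2 ^ m)⁻¹)))))) atTop
      (𝓝 (L * (ENNReal.ofReal lam * J))) :=
    ENNReal.Tendsto.const_mul (tendsto_two_pow_mul_one_sub_expNeg_comp hθ) (Or.inr hLtop)
  refine tendsto_nhds_unique hlim1 (hlim2.congr fun m => ?_)
  have hmeas : Measurable fun ω => (1 - expNeg ((2 ^ m)⁻¹ * pointCount X C ω)) *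
      expNeg (∑' n, g (X n ω)) :=
    (measurable_const.sub (measurable_expNeg.comp (hN.const_mul _))).mul hG
  rw [mul_left_comm, ← hdiff, ← lintegral_const_mul _ hmeas]
  exact lintegral_congr fun ω => (mul_assoc _ _ _).symm

/-- Weighting each point by the full product `∏ v(X i)` gives, by the differentiated Laplace
functional with `g = -log v`, the intensity `λ L v(x) dx`. Testing it against `f / v` removes the
factor of the distinguished point. -/
theorem IsHPPP.mecke_of_ne_zero (hX : IsHPPP μ lam X) (hlam : 0 ≤ lam) {v : Plane → ℝ≥0∞}
    (hv : Measurable v) (hv1 : ∀ x, v x ≤ 1) (hv0 : ∀ x, v x ≠ 0) {f : Plane → ℝ≥0∞}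
    (hf : Measurable f) :
    ∑' n, ∫⁻ ω, f (X n ω) * iprod (fun i => if i = n then 1 else v (X i ω)) ∂μ =
      ENNReal.ofReal lam * expNeg (ENNReal.ofReal lam * ∫⁻ x, (1 - v x)) * ∫⁻ x, f x := by
  set L := expNeg (ENNReal.ofReal lam * ∫⁻ x, (1 - v x)) with hL
  have hw : Measurable fun ω => iprod fun i => v (X i ω) :=
    measurable_iprod fun i => hv.comp (hX.measurable i)
  have hν : weightedIntensity μ X (fun _ ω => iprod fun i => v (X i ω)) =
      (ENNReal.ofReal lam * L) • volume.withDensity v := by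
    refine measure_ext_of_volume_ne_top fun C hC hC' => ?_
    have h1 := hX.lintegral_count_mul_expNeg hlam (g := fun x => negLog (v x))
      (measurable_negLog.comp hv) hC hC'
    simp only [expNeg_tsum, expNeg_negLog (hv1 _)] at h1
    rw [weightedIntensity_apply hX.measurable (fun _ => hw) hC, Measure.smul_apply,
      withDensity_apply _ hC, smul_eq_mul, mul_right_comm, mul_comm, ← h1, ← lintegral_tsum]
    · refine lintegral_congr fun ω => ?_
      rw [ENNReal.tsum_mul_right]
      rfl
    · exact fun n => ((((measurable_one.indicator hC).comp (hX.measurable n))).mul hw).aemeasurable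
  have hfv : Measurable fun x => f x / v x := hf.div hv
  have h2 := lintegral_weightedIntensity (μ := μ) hX.measurable (fun _ => hw) hfv
  rw [hν, lintegral_smul_measure, lintegral_withDensity_fun hv hfv] at h2
  have h3 : ∀ x, v x * (f x / v x) = f x := fun x =>
    ENNReal.mul_div_cancel (hv0 x) (ne_top_of_le_ne_top ENNReal.one_ne_top (hv1 x))
  simp only [h3, smul_eq_mul] at h2
  rw [h2]
  refine tsum_congr fun n => lintegral_congr fun ω => ?_
  rw [iprod_pull (fun i => hv1 _) n, ← mul_assoc, ENNReal.div_mul_cancel (hv0 _)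
    (ne_top_of_le_ne_top ENNReal.one_ne_top (hv1 _))]

/-- The Mecke formula for multiplicative functionals of a Poisson point process. -/
theorem IsHPPP.mecke (hX : IsHPPP μ lam X) (hlam : 0 ≤ lam) {v : Plane → ℝ≥0∞}
    (hv : Measurable v) (hv1 : ∀ x, v x ≤ 1) {f : Plane → ℝ≥0∞} (hf : Measurable f) :
    ∑' n, ∫⁻ ω, f (X n ω) * iprod (fun i => if i = n then 1 else v (X i ω)) ∂μ =
      ENNReal.ofReal lam * expNeg (ENNReal.ofReal lam * ∫⁻ x, (1 - v x)) * ∫⁻ x, f x := by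
  have hmw : ∀ n, Measurable fun ω => iprod (fun i => if i = n then 1 else v (X i ω)) := by
    refine fun n => measurable_iprod fun i => ?_
    split_ifs
    · exact measurable_const
    · exact hv.comp (hX.measurable i)
  suffices hν : weightedIntensity μ X (fun n ω => iprod fun i => if i = n then 1 else v (X i ω)) =
      (ENNReal.ofReal lam * expNeg (ENNReal.ofReal lam * ∫⁻ x, (1 - v x))) • volume by
    rw [← lintegral_weightedIntensity hX.measurable hmw hf, hν, lintegral_smul_measure, smul_eq_mul]
  refine measure_ext_of_volume_ne_top fun C hC hC' => ?_
  rw [weightedIntensity_apply hX.measurable hmw hC, Measure.smul_apply, smul_eq_mul]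
  -- Zeros of `v` are removed by the decreasing approximation `max v (1/(m+1))`, to which the
  -- nonvanishing case applies.
  let r : ℕ → ℝ≥0∞ := fun m => ((m : ℝ≥0∞) + 1)⁻¹
  have hr1 : ∀ m, r m ≤ 1 := fun m => by simp [r]
  have hr0 : ∀ m, r m ≠ 0 := fun m => by simp [r]
  have hra : Antitone r := fun a b h => by
    simp only [r]
    gcongr
  have hrl : Tendsto r atTop (𝓝 0) := by
    have := (tendsto_add_atTop_iff_nat 1).2 ENNReal.tendsto_inv_nat_nhds_zero
    refine this.congr fun m => ?_
    simp [r]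
  let V : ℕ → Plane → ℝ≥0∞ := fun m x => max (v x) (r m)
  have hV1 : ∀ m x, V m x ≤ 1 := fun m x => max_le (hv1 x) (hr1 m)
  have hVa : ∀ x, Antitone fun m => V m x := fun x a b h => max_le_max le_rfl (hra h)
  have hVl : ∀ x, Tendsto (fun m => V m x) atTop (𝓝 (v x)) := fun x => by
    simpa using tendsto_const_nhds.max hrl
  have hVm : ∀ m, Measurable (V m) := fun m => hv.max measurable_const
  have hmV : ∀ m n, Measurable fun ω => iprod (fun i => if i = n then 1 else V m (X i ω)) := by
    refine fun m n => measurable_iprod fun i => ?_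
    split_ifs
    · exact measurable_const
    · exact (hVm m).comp (hX.measurable i)
  have hind : Measurable (C.indicator (1 : Plane → ℝ≥0∞)) := measurable_one.indicator hC
  have hind1 : ∀ x, C.indicator (1 : Plane → ℝ≥0∞) x ≤ 1 :=
    fun x => Set.indicator_le_self' (f := (1 : Plane → ℝ≥0∞)) (fun _ _ => zero_le) x
  let a : ℕ → ℕ → ℝ≥0∞ := fun m n =>
    ∫⁻ ω, C.indicator 1 (X n ω) * iprod (fun i => if i = n then 1 else V m (X i ω)) ∂μ
  have hmecke : ∀ m, ∑' n, a m n = ENNReal.ofReal lam *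
      expNeg (ENNReal.ofReal lam * ∫⁻ x, (1 - V m x)) * volume C := by
    intro m
    have := hX.mecke_of_ne_zero hlam (hVm m) (hV1 m)
      (fun x => (lt_of_lt_of_le (pos_iff_ne_zero.2 (hr0 m)) (le_max_right _ _)).ne') hind
    rwa [lintegral_indicator_one hC] at this
  have han : Antitone a := by
    intro m m' h n
    refine lintegral_mono fun ω => mul_le_mul_right (iprod_mono fun i => ?_) _
    split_ifs
    · exact le_rfl
    · exact hVa _ h
  have hlim : ∀ n, Tendsto (fun m => a m n) atTop (𝓝
      (∫⁻ ω, C.indicator 1 (X n ω) * iprod (fun i => if i = n then 1 else v (X i ω)) ∂μ)) := by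
    intro n
    refine tendsto_lintegral_of_dominated_convergence (fun _ => 1)
      (fun m => (hind.comp (hX.measurable n)).mul (hmV m n))
      (fun m => ae_of_all _ fun ω => mul_le_one' (hind1 _) (iprod_le_one _))
      (by simp) (ae_of_all _ fun ω => ?_)
    refine ENNReal.Tendsto.const_mul ?_ (Or.inr (ne_top_of_le_ne_top ENNReal.one_ne_top (hind1 _)))
    have hA : Antitone fun m i => if i = n then (1 : ℝ≥0∞) else V m (X i ω) := by
      intro m m' h i
      dsimp only
      split_ifs
      · exact le_rfl
      · exact hVa _ h
    have h1 : ∀ m i, (if i = n then (1 : ℝ≥0∞) else V m (X i ω)) ≤ 1 := by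
      intro m i
      split_ifs
      · exact le_rfl
      · exact hV1 _ _
    have h2 : (fun i => ⨅ m, if i = n then (1 : ℝ≥0∞) else V m (X i ω)) =
        fun i => if i = n then 1 else v (X i ω) := by
      funext i
      split_ifs
      · simp
      · exact tendsto_nhds_unique (tendsto_atTop_iInf (hVa _)) (hVl _)
    rw [← h2, iprod_antitone_iInf h1 hA]
    exact tendsto_atTop_iInf fun m m' h => iprod_mono (hA h)
  have hLlim : Tendsto (fun m => ∑' n, a m n) atTop (𝓝 (∑' n, ∫⁻ ω, C.indicator 1 (X n ω) *
      iprod (fun i => if i = n then 1 else v (X i ω)) ∂μ)) := by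
    -- The sum over `n` is an integral against counting measure, dominated by its value at `m = 0`,
    -- which is finite because `C` has finite volume.
    simp only [← lintegral_count]
    refine tendsto_lintegral_of_dominated_convergence (a 0) (fun m => measurable_of_countable _)
      (fun m => ae_of_all _ fun n => han (Nat.zero_le m) n) ?_ (ae_of_all _ hlim)
    rw [lintegral_count, hmecke]
    exact ENNReal.mul_ne_top (ENNReal.mul_ne_top ENNReal.ofReal_ne_top (expNeg_ne_top _)) hC'
  refine tendsto_nhds_unique hLlim ?_
  simp only [hmecke]
  refine ENNReal.Tendsto.mul_const (ENNReal.Tendsto.const_mul ((continuous_expNeg.tendsto _).comp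
    (ENNReal.Tendsto.const_mul ?_ (Or.inr ENNReal.ofReal_ne_top)))
    (Or.inr ENNReal.ofReal_ne_top)) (Or.inr hC')
  -- The integrals of `1 - V m` increase, so the limit is correct even when `∫ (1 - v) = ∞`.
  refine lintegral_tendsto_of_tendsto_of_monotone
    (fun m => (measurable_const.sub (hVm m)).aemeasurable)
    (ae_of_all _ fun x a b h => tsub_le_tsub_left (hVa x h) 1) (ae_of_all _ fun x => ?_)
  exact ENNReal.Tendsto.sub tendsto_const_nhds (hVl x) (Or.inl (by simp))

end Mecke


/-! ### The Mecke formula with factors that depend on the distinguished point. -/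

section MeckeDependent

open Filter Topology

/-- Disjointify the closed balls of radius `ε / 2` around a dense sequence. -/
theorem exists_partition_dist_le {ε : ℝ} (hε : 0 < ε) :
    ∃ D : ℕ → Set Plane, (∀ j, MeasurableSet (D j)) ∧ Pairwise (Function.onFun Disjoint D) ∧
      ⋃ j, D j = Set.univ ∧ ∀ j, ∀ x ∈ D j, ∀ y ∈ D j, dist x y ≤ ε := by
  let E : ℕ → Set Plane := fun j => Metric.closedBall (TopologicalSpace.denseSeq Plane j) (ε / 2)
  refine ⟨disjointed E, fun j => ?_, disjoint_disjointed E, ?_, fun j x hx y hy => ?_⟩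
  · exact MeasurableSet.disjointed (fun i => Metric.isClosed_closedBall.measurableSet) j
  · rw [iUnion_disjointed]
    refine Set.eq_univ_of_forall fun x => ?_
    obtain ⟨y, ⟨j, rfl⟩, hj⟩ := Metric.mem_closure_iff.1
      (TopologicalSpace.denseRange_denseSeq Plane x) (ε / 2) (half_pos hε)
    exact Set.mem_iUnion.2 ⟨j, Metric.mem_closedBall.2 hj.le⟩
  · have h1 := Metric.mem_closedBall.1 (disjointed_subset E j hx)
    have h2 := Metric.mem_closedBall.1 (disjointed_subset E j hy)
    linarith [dist_triangle_right x y (TopologicalSpace.denseSeq Plane j)]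

/-- A bound valid for every representative `q` of a cell can be averaged over `q`. This compares a
sum over cells with an integral without choosing representatives. -/
theorem le_setLIntegral_of_forall_le {S : Set Plane} (hS : MeasurableSet S)
    (hS' : volume S ≠ ∞) {φ : Plane → ℝ≥0∞} {a : ℝ≥0∞} (ha : S = ∅ → a = 0)
    (h : ∀ q ∈ S, a ≤ φ q * volume S) : a ≤ ∫⁻ q in S, φ q := by
  rcases S.eq_empty_or_nonempty with h0 | ⟨q, hq⟩
  · simp [ha h0]
  rcases eq_or_ne (volume S) 0 with h0 | h0
  · have := h q hq
    simp only [h0, mul_zero] at this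
    exact this.trans zero_le
  · calc a = ∫⁻ _ in S, a / volume S := by
          rw [setLIntegral_const, ENNReal.div_mul_cancel h0 hS']
      _ ≤ ∫⁻ q in S, φ q :=
          setLIntegral_mono' hS fun q hq => ENNReal.div_le_of_le_mul (h q hq)

theorem setLIntegral_le_of_forall_le {S : Set Plane} (hS : MeasurableSet S)
    (hS' : volume S ≠ ∞) {φ : Plane → ℝ≥0∞} {a : ℝ≥0∞}
    (h : ∀ q ∈ S, φ q * volume S ≤ a) : ∫⁻ q in S, φ q ≤ a := by
  rcases eq_or_ne (volume S) 0 with h0 | h0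
  · rw [setLIntegral_measure_zero _ _ h0]
    exact zero_le
  · calc ∫⁻ q in S, φ q ≤ ∫⁻ _ in S, a / volume S :=
          setLIntegral_mono' hS fun q hq =>
            (ENNReal.le_div_iff_mul_le (Or.inl h0) (Or.inl hS')).2 (h q hq)
      _ = a := by rw [setLIntegral_const, ENNReal.div_mul_cancel h0 hS']

variable {Ω : Type*} [MeasurableSpace Ω] {μ : Measure Ω} {lam : ℝ}
  {X : ℕ → Ω → Plane}

theorem measurable_iprod_palm (hX : ∀ n, Measurable (X n)) {v : Plane → Plane → ℝ≥0∞}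
    (hv : Measurable (Function.uncurry v)) (n : ℕ) :
    Measurable fun ω => iprod fun i => if i = n then 1 else v (X n ω) (X i ω) := by
  refine measurable_iprod fun i => ?_
  split_ifs
  · exact measurable_const
  · exact hv.comp ((hX n).prodMk (hX i))

/-- The intensity measure of the points `X n`, each weighted by `∏ i ≠ n, v (X n) (X i)`. -/
noncomputable def palmIntensity (μ : Measure Ω) (X : ℕ → Ω → Plane)
    (v : Plane → Plane → ℝ≥0∞) : Measure Plane :=
  weightedIntensity μ X fun n ω => iprod fun i => if i = n then 1 else v (X n ω) (X i ω)

theorem palmIntensity_apply (hX : ∀ n, Measurable (X n)) {v : Plane → Plane → ℝ≥0∞}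
    (hv : Measurable (Function.uncurry v)) {C : Set Plane} (hC : MeasurableSet C) :
    palmIntensity μ X v C = ∑' n, ∫⁻ ω, C.indicator 1 (X n ω) *
      iprod (fun i => if i = n then 1 else v (X n ω) (X i ω)) ∂μ :=
  weightedIntensity_apply hX (fun n => measurable_iprod_palm hX hv n) hC

theorem palmIntensity_mono_on (hX : ∀ n, Measurable (X n)) {v v' : Plane → Plane → ℝ≥0∞}
    (hv : Measurable (Function.uncurry v)) (hv' : Measurable (Function.uncurry v'))
    {C : Set Plane} (hC : MeasurableSet C) (h : ∀ y ∈ C, ∀ y', v y y' ≤ v' y y') :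
    palmIntensity μ X v C ≤ palmIntensity μ X v' C := by
  rw [palmIntensity_apply hX hv hC, palmIntensity_apply hX hv' hC]
  refine ENNReal.tsum_le_tsum fun n => lintegral_mono fun ω => ?_
  by_cases hω : X n ω ∈ C
  · refine mul_le_mul_right (iprod_mono fun i => ?_) _
    split_ifs
    · exact le_rfl
    · exact h _ hω _
  · simp [hω]

variable [IsProbabilityMeasure μ]

theorem IsHPPP.palmIntensity_const (hX : IsHPPP μ lam X) (hlam : 0 ≤ lam) {v : Plane → ℝ≥0∞}
    (hv : Measurable v) (hv1 : ∀ x, v x ≤ 1) {C : Set Plane} (hC : MeasurableSet C) :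
    palmIntensity μ X (fun _ => v) C =
      ENNReal.ofReal lam * expNeg (ENNReal.ofReal lam * ∫⁻ x, (1 - v x)) * volume C := by
  rw [palmIntensity_apply (v := fun _ => v) hX.measurable (hv.comp measurable_snd) hC,
    hX.mecke hlam hv hv1 (measurable_one.indicator hC), lintegral_indicator_one hC]

theorem measurable_lintegral_one_sub {v : Plane → Plane → ℝ≥0∞}
    (hv : Measurable (Function.uncurry v)) (c : ℝ≥0∞) :
    Measurable fun y => c * expNeg (c * ∫⁻ y', (1 - v y y')) := by
  have h : Measurable fun p : Plane × Plane => 1 - v p.1 p.2 := measurable_const.sub hv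
  exact (measurable_expNeg.comp (h.lintegral_prod_right'.const_mul _)).const_mul _

/-- On a cell of diameter at most `ε` the distinguished point may be frozen at any `q` of the cell,
at the price of passing from `v` to `w`. The formula with a fixed weight then applies, and the bound
is averaged over `q`. -/
theorem IsHPPP.palmIntensity_le (hX : IsHPPP μ lam X) (hlam : 0 ≤ lam)
    {v w : Plane → Plane → ℝ≥0∞} (hv : Measurable (Function.uncurry v))
    (hw : Measurable (Function.uncurry w)) (hw1 : ∀ y y', w y y' ≤ 1) {ε : ℝ} (hε : 0 < ε)
    (h : ∀ q y y', dist y q ≤ ε → v y y' ≤ w q y') {C : Set Plane} (hC : MeasurableSet C)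
    (hC' : volume C ≠ ∞) :
    palmIntensity μ X v C ≤ ∫⁻ y in C, ENNReal.ofReal lam *
      expNeg (ENNReal.ofReal lam * ∫⁻ y', (1 - w y y')) := by
  obtain ⟨D, hDm, hDd, hDu, hDε⟩ := exists_partition_dist_le hε
  have hCU : C = ⋃ j, C ∩ D j := by rw [← Set.inter_iUnion, hDu, Set.inter_univ]
  have hd : Pairwise (Function.onFun Disjoint fun j => C ∩ D j) := fun i j hij =>
    (hDd hij).mono Set.inter_subset_right Set.inter_subset_right
  have hm : ∀ j, MeasurableSet (C ∩ D j) := fun j => hC.inter (hDm j)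
  rw [hCU, measure_iUnion hd hm, lintegral_iUnion hm hd]
  refine ENNReal.tsum_le_tsum fun j => le_setLIntegral_of_forall_le (hm j)
    (ne_top_of_le_ne_top hC' (measure_mono Set.inter_subset_left)) (fun h0 => by simp [h0]) ?_
  intro q hq
  have hwq : Measurable (w q) := hw.comp measurable_prodMk_left
  rw [← hX.palmIntensity_const hlam hwq (hw1 q) (hm j)]
  exact palmIntensity_mono_on (v' := fun _ => w q) hX.measurable hv (hwq.comp measurable_snd) (hm j)
    fun y hy y' => h q y y' (hDε j y hy.2 q hq.2)

theorem IsHPPP.le_palmIntensity (hX : IsHPPP μ lam X) (hlam : 0 ≤ lam)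
    {v w : Plane → Plane → ℝ≥0∞} (hv : Measurable (Function.uncurry v))
    (hw : Measurable (Function.uncurry w)) (hw1 : ∀ y y', w y y' ≤ 1) {ε : ℝ} (hε : 0 < ε)
    (h : ∀ q y y', dist y q ≤ ε → w q y' ≤ v y y') {C : Set Plane} (hC : MeasurableSet C)
    (hC' : volume C ≠ ∞) :
    ∫⁻ y in C, ENNReal.ofReal lam * expNeg (ENNReal.ofReal lam * ∫⁻ y', (1 - w y y')) ≤
      palmIntensity μ X v C := by
  obtain ⟨D, hDm, hDd, hDu, hDε⟩ := exists_partition_dist_le hε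
  have hCU : C = ⋃ j, C ∩ D j := by rw [← Set.inter_iUnion, hDu, Set.inter_univ]
  have hd : Pairwise (Function.onFun Disjoint fun j => C ∩ D j) := fun i j hij =>
    (hDd hij).mono Set.inter_subset_right Set.inter_subset_right
  have hm : ∀ j, MeasurableSet (C ∩ D j) := fun j => hC.inter (hDm j)
  rw [hCU, measure_iUnion hd hm, lintegral_iUnion hm hd]
  refine ENNReal.tsum_le_tsum fun j => setLIntegral_le_of_forall_le (hm j)
    (ne_top_of_le_ne_top hC' (measure_mono Set.inter_subset_left)) ?_
  intro q hq
  have hwq : Measurable (w q) := hw.comp measurable_prodMk_left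
  rw [← hX.palmIntensity_const hlam hwq (hw1 q) (hm j)]
  exact palmIntensity_mono_on (v := fun _ => w q) hX.measurable (hwq.comp measurable_snd) hv (hm j)
    fun y hy y' => h q y y' (hDε j y hy.2 q hq.2)

/-- The Mecke formula for multiplicative functionals whose factors depend on the distinguished
point, in a way that can be controlled locally by the bounds `lo m` and `hi m`. -/
theorem IsHPPP.mecke_dependent (hX : IsHPPP μ lam X) (hlam : 0 ≤ lam)
    {v : Plane → Plane → ℝ≥0∞} {lo hi : ℕ → Plane → Plane → ℝ≥0∞} {ε : ℕ → ℝ}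
    (hv : Measurable (Function.uncurry v)) (hlo : ∀ m, Measurable (Function.uncurry (lo m)))
    (hhi : ∀ m, Measurable (Function.uncurry (hi m))) (hhi1 : ∀ m y y', hi m y y' ≤ 1)
    (hε : ∀ m, 0 < ε m) (hlov : ∀ m q y y', dist y q ≤ ε m → lo m q y' ≤ v y y')
    (hvhi : ∀ m q y y', dist y q ≤ ε m → v y y' ≤ hi m q y')
    (hmono : ∀ m y y', lo 0 y y' ≤ lo m y y')
    (hlolim : ∀ y, ∀ᵐ y', Tendsto (fun m => lo m y y') atTop (𝓝 (v y y')))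
    (hhilim : ∀ y, ∀ᵐ y', Tendsto (fun m => hi m y y') atTop (𝓝 (v y y')))
    (hfin : ∀ y, ∫⁻ y', (1 - lo 0 y y') ≠ ∞) {f : Plane → ℝ≥0∞} (hf : Measurable f) :
    ∑' n, ∫⁻ ω, f (X n ω) * iprod (fun i => if i = n then 1 else v (X n ω) (X i ω)) ∂μ =
      ∫⁻ y, f y * (ENNReal.ofReal lam *
        expNeg (ENNReal.ofReal lam * ∫⁻ y', (1 - v y y'))) := by
  have hvhi' : ∀ m y y', v y y' ≤ hi m y y' := fun m y y' =>
    hvhi m y y y' (by simpa using (hε m).le)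
  have hlov' : ∀ m y y', lo m y y' ≤ v y y' := fun m y y' =>
    hlov m y y y' (by simpa using (hε m).le)
  have hv1 : ∀ y y', v y y' ≤ 1 := fun y y' => (hvhi' 0 y y').trans (hhi1 0 y y')
  suffices hν : palmIntensity μ X v = volume.withDensity fun y => ENNReal.ofReal lam *
        expNeg (ENNReal.ofReal lam * ∫⁻ y', (1 - v y y')) by
    rw [← lintegral_weightedIntensity hX.measurable
      (fun n => measurable_iprod_palm hX.measurable hv n) hf]
    change ∫⁻ x, f x ∂(palmIntensity μ X v) = _
    rw [hν, lintegral_withDensity_fun (measurable_lintegral_one_sub hv _) hf]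
    exact lintegral_congr fun y => mul_comm _ _
  refine measure_ext_of_volume_ne_top fun C hC hC' => ?_
  rw [withDensity_apply _ hC]
  -- Both families of bounds have the same limit: the inner integrals converge with majorant `1 - lo
  -- 0`, the outer ones with the constant majorant `λ` on `C`.
  have key : ∀ w : ℕ → Plane → Plane → ℝ≥0∞, (∀ m, Measurable (Function.uncurry (w m))) →
      (∀ m y y', lo 0 y y' ≤ w m y y') →
      (∀ y, ∀ᵐ y', Tendsto (fun m => w m y y') atTop (𝓝 (v y y'))) →
      Tendsto (fun m => ∫⁻ y in C, ENNReal.ofReal lam *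
        expNeg (ENNReal.ofReal lam * ∫⁻ y', (1 - w m y y'))) atTop
        (𝓝 (∫⁻ y in C, ENNReal.ofReal lam *
          expNeg (ENNReal.ofReal lam * ∫⁻ y', (1 - v y y')))) := by
    intro w hwm hwlo hwlim
    refine tendsto_lintegral_of_dominated_convergence (fun _ => ENNReal.ofReal lam)
      (fun m => measurable_lintegral_one_sub (hwm m) _)
      (fun m => ae_of_all _ fun y => mul_le_of_le_one_right' (expNeg_le_one _)) ?_
      (ae_of_all _ fun y => ?_)
    · rw [setLIntegral_const]
      exact ENNReal.mul_ne_top ENNReal.ofReal_ne_top hC'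
    · refine ENNReal.Tendsto.const_mul ((continuous_expNeg.tendsto _).comp
        (ENNReal.Tendsto.const_mul ?_ (Or.inr ENNReal.ofReal_ne_top)))
        (Or.inr ENNReal.ofReal_ne_top)
      refine tendsto_lintegral_of_dominated_convergence (fun y' => 1 - lo 0 y y')
        (fun m => measurable_const.sub ((hwm m).comp measurable_prodMk_left))
        (fun m => ae_of_all _ fun y' => tsub_le_tsub_left (hwlo m y y') 1) (hfin y) ?_
      filter_upwards [hwlim y] with y' hy'
      exact ENNReal.Tendsto.sub tendsto_const_nhds hy' (Or.inl (by simp))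
  refine le_antisymm (ge_of_tendsto' (key hi hhi (fun m y y' => (hlov' 0 y y').trans
    (hvhi' m y y')) hhilim) fun m => ?_) (le_of_tendsto' (key lo hlo hmono hlolim) fun m => ?_)
  · exact hX.palmIntensity_le hlam hv (hhi m) (hhi1 m) (hε m) (hvhi m) hC hC'
  · exact hX.le_palmIntensity hlam hv (hlo m) (fun y y' => (hlov' m y y').trans (hv1 y y'))
      (hε m) (hlov m) hC hC'

end MeckeDependent


/-! ### Integrating out independent marks -/

section Marks

open Filter Topology

variable {Ω : Type*} [mΩ : MeasurableSpace Ω] {μ : Measure Ω} [IsProbabilityMeasure μ]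

theorem lintegral_indepFun {α β : Type*} [MeasurableSpace α] [MeasurableSpace β] {E : Ω → α}
    {ξ : Ω → β} (hE : Measurable E) (hξ : Measurable ξ) (h : IndepFun E ξ μ)
    {f : α → β → ℝ≥0∞} (hf : Measurable (Function.uncurry f)) :
    ∫⁻ ω, f (E ω) (ξ ω) ∂μ = ∫⁻ ω, ∫⁻ b, f (E ω) b ∂(μ.map ξ) ∂μ := by
  have hprod := (indepFun_iff_map_prod_eq_prod_map_map hE.aemeasurable hξ.aemeasurable).1 h
  have : IsProbabilityMeasure (μ.map ξ) := Measure.isProbabilityMeasure_map hξ.aemeasurable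
  calc ∫⁻ ω, f (E ω) (ξ ω) ∂μ
      = ∫⁻ p, Function.uncurry f p ∂(μ.map fun ω => (E ω, ξ ω)) :=
        (lintegral_map hf (hE.prodMk hξ)).symm
    _ = ∫⁻ a, ∫⁻ b, f a b ∂(μ.map ξ) ∂(μ.map E) := by
        rw [hprod, lintegral_prod _ hf.aemeasurable]
        rfl
    _ = _ := lintegral_map hf.lintegral_prod_right' hE

theorem lintegral_mul_of_indep {Ω : Type*} {𝓖 𝓗 : MeasurableSpace Ω} [mΩ : MeasurableSpace Ω]
    {μ : Measure Ω} [IsProbabilityMeasure μ] (h𝓖 : 𝓖 ≤ mΩ) (h𝓗 : 𝓗 ≤ mΩ)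
    (h : Indep 𝓖 𝓗 μ) {α β : Type*} [MeasurableSpace α] [MeasurableSpace β] {Z : Ω → ℝ≥0∞}
    (hZ : Measurable[𝓖] Z) {E : Ω → α} (hE : Measurable[𝓖] E) {ξ : Ω → β}
    (hξ : Measurable[𝓗] ξ) {f : α → β → ℝ≥0∞} (hf : Measurable (Function.uncurry f)) :
    ∫⁻ ω, Z ω * f (E ω) (ξ ω) ∂μ = ∫⁻ ω, Z ω * ∫⁻ b, f (E ω) b ∂(μ.map ξ) ∂μ := by
  have hZE : Measurable[𝓖] fun ω => (Z ω, E ω) := hZ.prodMk hE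
  have hind : IndepFun (fun ω => (Z ω, E ω)) ξ μ :=
    indep_of_indep_of_le_left (indep_of_indep_of_le_right h (measurable_iff_comap_le.1 hξ))
      (measurable_iff_comap_le.1 hZE)
  have hF : Measurable (Function.uncurry fun (p : ℝ≥0∞ × α) b => p.1 * f p.2 b) :=
    (measurable_fst.comp measurable_fst).mul
      (hf.comp ((measurable_snd.comp measurable_fst).prodMk measurable_snd))
  have key := lintegral_indepFun (hZE.mono h𝓖 le_rfl) (hξ.mono h𝓗 le_rfl) hind hF
  refine key.trans (lintegral_congr fun ω => ?_)
  exact lintegral_const_mul _ (hf.comp measurable_prodMk_left)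

variable {ι : Type*} {m : ι → MeasurableSpace Ω}

/-- The sigma-algebra generated by the sources in `S`. -/
@[reducible] def sigmaOf (m : ι → MeasurableSpace Ω) (S : Set ι) : MeasurableSpace Ω := ⨆ i ∈ S, m i

omit mΩ in
theorem sigmaOf_mono {S T : Set ι} (h : S ⊆ T) : sigmaOf m S ≤ sigmaOf m T :=
  biSup_mono h

omit mΩ in
theorem le_sigmaOf {S : Set ι} {i : ι} (h : i ∈ S) : m i ≤ sigmaOf m S :=
  le_iSup₂_of_le i h le_rfl

theorem sigmaOf_le (hle : ∀ i, m i ≤ mΩ) (S : Set ι) : sigmaOf m S ≤ mΩ :=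
  iSup₂_le fun i _ => hle i

/-- Induction on the number of factors: the last mark is independent of all the other terms, and its
mean is a function of the environment `E`. That mean is absorbed into `Z`, which is why `Z` stays
universally quantified. -/
theorem lintegral_prod_marks (hle : ∀ i, m i ≤ mΩ) (hm : iIndep m μ) {T : ℕ → Set ι}
    (hT : Pairwise (Function.onFun Disjoint T)) {α β : Type*} [MeasurableSpace α]
    [MeasurableSpace β] {E : Ω → α} (hE : Measurable[sigmaOf m (⋃ i, T i)ᶜ] E) {ξ : ℕ → Ω → β}
    (hξ : ∀ i, Measurable[sigmaOf m (T i)] (ξ i)) {f : ℕ → α → β → ℝ≥0∞}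
    (hf : ∀ i, Measurable (Function.uncurry (f i))) (N : ℕ) :
    ∀ {Z : Ω → ℝ≥0∞}, Measurable[sigmaOf m (⋃ i, T i)ᶜ] Z →
      ∫⁻ ω, Z ω * ∏ i ∈ Finset.range N, f i (E ω) (ξ i ω) ∂μ =
        ∫⁻ ω, Z ω * ∏ i ∈ Finset.range N, ∫⁻ b, f i (E ω) b ∂(μ.map (ξ i)) ∂μ := by
  induction N with
  | zero => intro Z _; simp
  | succ N ih =>
    intro Z hZ
    have hsub : (⋃ i, T i)ᶜ ⊆ (T N)ᶜ := Set.compl_subset_compl.2 (Set.subset_iUnion T N)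
    have hZE : Measurable[sigmaOf m (T N)ᶜ]
        fun ω => Z ω * ∏ i ∈ Finset.range N, f i (E ω) (ξ i ω) := by
      refine (hZ.mono (sigmaOf_mono hsub) le_rfl).mul
        (Finset.measurable_fun_prod _ fun i hi => (hf i).comp
          ((hE.mono (sigmaOf_mono hsub) le_rfl).prodMk ((hξ i).mono (sigmaOf_mono ?_) le_rfl)))
      exact (hT (Finset.mem_range.1 hi).ne).subset_compl_right
    have hstep := lintegral_mul_of_indep (sigmaOf_le hle _) (sigmaOf_le hle _)
      (indep_iSup_of_disjoint hle hm disjoint_compl_left) hZE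
      (hE.mono (sigmaOf_mono hsub) le_rfl) (hξ N) (hf N)
    have hξN : Measurable (ξ N) := (hξ N).mono (sigmaOf_le hle _) le_rfl
    have : IsProbabilityMeasure (μ.map (ξ N)) := Measure.isProbabilityMeasure_map hξN.aemeasurable
    have hZ' : Measurable[sigmaOf m (⋃ i, T i)ᶜ]
        fun ω => Z ω * ∫⁻ b, f N (E ω) b ∂(μ.map (ξ N)) :=
      hZ.mul ((hf N).lintegral_prod_right'.comp hE)
    have h2 := ih hZ'
    simp only [Finset.prod_range_succ]
    calc ∫⁻ ω, Z ω * ((∏ i ∈ Finset.range N, f i (E ω) (ξ i ω)) * f N (E ω) (ξ N ω)) ∂μ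
        = ∫⁻ ω, Z ω * (∏ i ∈ Finset.range N, f i (E ω) (ξ i ω)) * f N (E ω) (ξ N ω) ∂μ := by
          simp only [mul_assoc]
      _ = _ := hstep
      _ = ∫⁻ ω, Z ω * (∫⁻ b, f N (E ω) b ∂(μ.map (ξ N))) *
            ∏ i ∈ Finset.range N, f i (E ω) (ξ i ω) ∂μ := by
          simp only [mul_right_comm]
      _ = _ := h2
      _ = _ := by
          refine lintegral_congr fun ω => ?_
          ring

/-- Independent marks `ξ i`, on which the factors of an infinite product depend, may be
integrated out factor by factor. -/
theorem lintegral_iprod_marks (hle : ∀ i, m i ≤ mΩ) (hm : iIndep m μ) {T : ℕ → Set ι}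
    (hT : Pairwise (Function.onFun Disjoint T)) {α β : Type*} [MeasurableSpace α]
    [MeasurableSpace β] {E : Ω → α} (hE : Measurable[sigmaOf m (⋃ i, T i)ᶜ] E) {ξ : ℕ → Ω → β}
    (hξ : ∀ i, Measurable[sigmaOf m (T i)] (ξ i)) {f : ℕ → α → β → ℝ≥0∞}
    (hf : ∀ i, Measurable (Function.uncurry (f i))) (hf1 : ∀ i a b, f i a b ≤ 1)
    {Z : Ω → ℝ≥0∞} (hZ : Measurable[sigmaOf m (⋃ i, T i)ᶜ] Z) (hZ1 : ∀ ω, Z ω ≤ 1)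
    {φ : ℕ → Ω → ℝ≥0∞} (hφ : ∀ i, ∀ᵐ ω ∂μ, ∫⁻ b, f i (E ω) b ∂(μ.map (ξ i)) = φ i ω) :
    ∫⁻ ω, Z ω * iprod (fun i => f i (E ω) (ξ i ω)) ∂μ = ∫⁻ ω, Z ω * iprod (fun i => φ i ω) ∂μ := by
  have hE' : Measurable E := hE.mono (sigmaOf_le hle _) le_rfl
  have hZ' : Measurable Z := hZ.mono (sigmaOf_le hle _) le_rfl
  have hξ' : ∀ i, Measurable (ξ i) := fun i => (hξ i).mono (sigmaOf_le hle _) le_rfl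
  have hprob : ∀ i, IsProbabilityMeasure (μ.map (ξ i)) :=
    fun i => Measure.isProbabilityMeasure_map (hξ' i).aemeasurable
  -- Bounded convergence carries the identity for finite products to the infinite ones, on both
  -- sides.
  have hlim : ∀ g : ℕ → Ω → ℝ≥0∞, (∀ i, Measurable (g i)) → (∀ i ω, g i ω ≤ 1) →
      Tendsto (fun N => ∫⁻ ω, Z ω * ∏ i ∈ Finset.range N, g i ω ∂μ) atTop
        (𝓝 (∫⁻ ω, Z ω * iprod (fun i => g i ω) ∂μ)) := by
    intro g hg hg1
    refine tendsto_lintegral_of_dominated_convergence (fun _ => 1)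
      (fun N => hZ'.mul (Finset.measurable_fun_prod _ fun i _ => hg i))
      (fun N => ae_of_all _ fun ω => ?_) (by simp) (ae_of_all _ fun ω => ?_)
    · exact mul_le_one' (hZ1 ω) (Finset.prod_le_one' fun i _ => hg1 i ω)
    · exact ENNReal.Tendsto.const_mul (tendsto_prod_range fun i => hg1 i ω)
        (Or.inr (ne_top_of_le_ne_top ENNReal.one_ne_top (hZ1 ω)))
  have h1 := hlim (fun i ω => f i (E ω) (ξ i ω)) (fun i => (hf i).comp (hE'.prodMk (hξ' i)))
    (fun i ω => hf1 _ _ _)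
  have h2 := hlim (fun i ω => ∫⁻ b, f i (E ω) b ∂(μ.map (ξ i)))
    (fun i => (hf i).lintegral_prod_right'.comp hE') (fun i ω => by
      calc ∫⁻ b, f i (E ω) b ∂(μ.map (ξ i)) ≤ ∫⁻ _, 1 ∂(μ.map (ξ i)) :=
            lintegral_mono fun b => hf1 _ _ _
        _ = 1 := by simp)
  simp only [lintegral_prod_marks hle hm hT hE hξ hf _ hZ] at h1
  rw [tendsto_nhds_unique h1 h2]
  -- Almost sure agreement of the mean factors is enough; in the applications they are computed only
  -- where certain channel vectors do not vanish.
  refine lintegral_congr_ae ?_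
  filter_upwards [ae_all_iff.2 hφ] with ω hω
  simp only [hω]

end Marks


/-! ### Uniqueness of Laplace transforms, and Rayleigh fading -/

section Laplace

-- The transform at natural `k` fixes the integrals of all polynomials in `exp(-x)`. These form an
-- algebra of bounded continuous functions that separates the points of `[0, ∞]`, including `∞`, and
-- such an algebra determines a finite measure on a Polish space.
open BoundedContinuousFunction in
theorem ext_of_laplace {ν ν' : Measure ℝ≥0∞} [IsFiniteMeasure ν] [IsFiniteMeasure ν']
    (h : ∀ k : ℕ, ∫⁻ x, expNeg (k * x) ∂ν = ∫⁻ x, expNeg (k * x) ∂ν') : ν = ν' := by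
  have hc : Continuous fun x => (expNeg x).toReal :=
    ENNReal.continuousOn_toReal.comp_continuous continuous_expNeg fun x => expNeg_ne_top x
  let e : ℝ≥0∞ →ᵇ ℝ := BoundedContinuousFunction.ofNormedAddCommGroup
    (fun x => (expNeg x).toReal) hc 1 fun x => by
      rw [Real.norm_of_nonneg ENNReal.toReal_nonneg]
      exact ENNReal.toReal_le_of_le_ofReal zero_le_one (by simpa using expNeg_le_one x)
  have he : ∀ x, e x = (expNeg x).toReal := fun x => rfl
  let A : StarSubalgebra ℝ (ℝ≥0∞ →ᵇ ℝ) :=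
    { Algebra.adjoin ℝ {e} with
      star_mem' := fun {g} hg => by
        have : star g = g := by ext x; simp
        rw [this]
        exact hg }
  have hmono : ∀ (ρ : Measure ℝ≥0∞) (k : ℕ), ∫ x, e x ^ k ∂ρ = (∫⁻ x, expNeg (k * x) ∂ρ).toReal := by
    intro ρ k
    rw [← integral_toReal (by fun_prop) (ae_of_all _ fun x => (expNeg_ne_top _).lt_top)]
    refine integral_congr_ae (ae_of_all _ fun x => ?_)
    simp only [he, expNeg_nsmul, ENNReal.toReal_pow]
  refine ext_of_forall_mem_subalgebra_integral_eq_of_polish (A := A) ?_ ?_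
  · intro x y hxy
    refine ⟨e, ⟨BoundedContinuousFunction.toContinuousMapStarₐ ℝ e, ⟨e, ?_, rfl⟩, rfl⟩, ?_⟩
    · exact Algebra.subset_adjoin (Set.mem_singleton e)
    · intro h1
      exact hxy (expNeg_injective
        ((ENNReal.toReal_eq_toReal_iff' (expNeg_ne_top _) (expNeg_ne_top _)).1 h1))
  · intro g hg
    have hg' : g ∈ Algebra.adjoin ℝ {e} := hg
    rw [Algebra.adjoin_singleton_eq_range_aeval] at hg'
    clear hg
    obtain ⟨p, rfl⟩ := hg'
    change ∫ x, (Polynomial.aeval e p : ℝ≥0∞ →ᵇ ℝ) x ∂ν =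
      ∫ x, (Polynomial.aeval e p : ℝ≥0∞ →ᵇ ℝ) x ∂ν'
    induction p using Polynomial.induction_on' with
    | add p q hp hq =>
      simp only [map_add, BoundedContinuousFunction.add_apply]
      rw [integral_add (BoundedContinuousFunction.integrable _ _)
        (BoundedContinuousFunction.integrable _ _), integral_add
        (BoundedContinuousFunction.integrable _ _) (BoundedContinuousFunction.integrable _ _)]
      rw [hp, hq]
    | monomial n a =>
      have h1 : ∀ x, (Polynomial.aeval e (Polynomial.monomial n a) : ℝ≥0∞ →ᵇ ℝ) x = a * e x ^ n := by
        intro x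
        rw [Polynomial.aeval_monomial]
        simp
      simp only [h1]
      rw [integral_const_mul, integral_const_mul, hmono, hmono, h n]

end Laplace

/-! ### Complex Gaussian vectors: projections, squared norms, Erlang tails. -/

section Gaussian

theorem measurable_complexMk : Measurable fun p : ℝ × ℝ => (⟨p.1, p.2⟩ : ℂ) :=
  Complex.measurableEquivRealProd.symm.measurable

instance : IsProbabilityMeasure stdComplexGaussian :=
  Measure.isProbabilityMeasure_map measurable_complexMk.aemeasurable

theorem charFun_stdComplexGaussian (t : ℂ) :
    charFun stdComplexGaussian t = Complex.exp (-(‖t‖ ^ 2 / 4 : ℝ)) := by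
  rw [charFun_apply, stdComplexGaussian, integral_map measurable_complexMk.aemeasurable (by fun_prop)]
  have h : ∀ p : ℝ × ℝ, Complex.exp (inner ℝ (⟨p.1, p.2⟩ : ℂ) t * Complex.I) =
      Complex.exp (t.re * p.1 * Complex.I) * Complex.exp (t.im * p.2 * Complex.I) := by
    intro p
    rw [← Complex.exp_add, Complex.inner]
    congr 1
    simp
    ring
  simp only [h]
  rw [integral_prod_mul (fun x : ℝ => Complex.exp (t.re * x * Complex.I))
    (fun x : ℝ => Complex.exp (t.im * x * Complex.I)), ← charFun_apply_real, ← charFun_apply_real,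
    charFun_gaussianReal, charFun_gaussianReal, ← Complex.exp_add]
  congr 1
  rw [← Complex.normSq_eq_norm_sq, Complex.normSq_apply]
  push_cast
  ring

/-- Characteristic functions multiply, and the variances `‖c i‖²` add up to `1`. Hence a Rayleigh
channel seen along any unit vector is again Rayleigh. -/
theorem map_sum_mul_stdComplexGaussian {ι : Type*} [Fintype ι] {c : ι → ℂ}
    (hc : ∑ i, ‖c i‖ ^ 2 = 1) :
    (Measure.pi fun _ : ι => stdComplexGaussian).map (fun h => ∑ i, c i * h i) =
      stdComplexGaussian := by
  have hm : ∀ i, AEMeasurable (fun z : ℂ => c i * z) stdComplexGaussian := fun i => by fun_prop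
  have hp : ∀ i, IsProbabilityMeasure (stdComplexGaussian.map fun z => c i * z) :=
    fun i => Measure.isProbabilityMeasure_map (hm i)
  have h1 : (Measure.pi fun _ : ι => stdComplexGaussian).map (fun h => ∑ i, c i * h i) =
      (Measure.pi fun i => stdComplexGaussian.map fun z => c i * z).map (fun p => ∑ i, p i) := by
    rw [← Measure.pi_map_pi hm, Measure.map_map (by fun_prop) (by fun_prop)]
    rfl
  have : IsProbabilityMeasure ((Measure.pi fun _ : ι => stdComplexGaussian).map
      (fun h => ∑ i, c i * h i)) := Measure.isProbabilityMeasure_map (Measurable.aemeasurable (by fun_prop))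
  refine Measure.ext_of_charFun ?_
  rw [h1, charFun_map_sum_pi_eq_prod]
  funext t
  rw [Finset.prod_apply]
  have h2 : ∀ i, charFun (stdComplexGaussian.map fun z => c i * z) t =
      Complex.exp (-(‖c i‖ ^ 2 * ‖t‖ ^ 2 / 4 : ℝ)) := by
    intro i
    rw [charFun_apply, integral_map (hm i) (by fun_prop)]
    have h3 : ∀ z : ℂ, inner ℝ (c i * z) t = inner ℝ z (starRingEnd ℂ (c i) * t) := by
      intro z
      simp only [Complex.inner, map_mul]
      congr 1
      ring
    simp only [h3]
    rw [← charFun_apply, charFun_stdComplexGaussian]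
    simp [mul_pow]
  simp only [h2]
  rw [← Complex.exp_sum, charFun_stdComplexGaussian]
  congr 1
  rw [Finset.sum_neg_distrib, ← Complex.ofReal_sum, ← Finset.sum_div, ← Finset.sum_mul, hc, one_mul]

theorem lintegral_exp_neg_mul_sq_gaussianReal {t : ℝ} (ht : 0 ≤ t) :
    ∫⁻ x, ENNReal.ofReal (Real.exp (-(t * x ^ 2))) ∂(gaussianReal 0 (1 / 2)) =
      ENNReal.ofReal (√(1 / (1 + t))) := by
  have hm : Measurable fun x : ℝ => ENNReal.ofReal (Real.exp (-(t * x ^ 2))) := by fun_prop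
  rw [gaussianReal_of_var_ne_zero _ (by simp),
    lintegral_withDensity_fun (measurable_gaussianPDF _ _) hm]
  have h1 : ∀ x : ℝ, gaussianPDF 0 (1 / 2) x * ENNReal.ofReal (Real.exp (-(t * x ^ 2))) =
      ENNReal.ofReal ((√Real.pi)⁻¹ * Real.exp (-(1 + t) * x ^ 2)) := by
    intro x
    rw [gaussianPDF, ← ENNReal.ofReal_mul (gaussianPDFReal_nonneg _ _ _), gaussianPDFReal, mul_assoc,
      ← Real.exp_add]
    congr 3
    · congr 1
      push_cast
      ring
    · push_cast
      ring
  simp only [h1]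
  rw [← ofReal_integral_eq_lintegral_ofReal, integral_const_mul, integral_gaussian]
  · congr 1
    rw [← Real.sqrt_inv, ← Real.sqrt_mul (by positivity)]
    congr 1
    field_simp
  · exact (integrable_exp_neg_mul_sq (by linarith)).const_mul _
  · exact ae_of_all _ fun x => by positivity

/-- Real and imaginary part contribute `(1 + t)^(-1/2)` each; the result is the transform of the
unit exponential law. -/
theorem lintegral_expNeg_stdComplexGaussian {t : ℝ} (ht : 0 ≤ t) :
    ∫⁻ z, expNeg (ENNReal.ofReal (t * ‖z‖ ^ 2)) ∂stdComplexGaussian =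
      ENNReal.ofReal (1 / (1 + t)) := by
  have hm : Measurable fun z : ℂ => expNeg (ENNReal.ofReal (t * ‖z‖ ^ 2)) := by fun_prop
  rw [stdComplexGaussian, lintegral_map hm measurable_complexMk]
  have h1 : ∀ p : ℝ × ℝ, expNeg (ENNReal.ofReal (t * ‖(⟨p.1, p.2⟩ : ℂ)‖ ^ 2)) =
      ENNReal.ofReal (Real.exp (-(t * p.1 ^ 2))) * ENNReal.ofReal (Real.exp (-(t * p.2 ^ 2))) := by
    intro p
    rw [expNeg_ofReal (by positivity), ← ENNReal.ofReal_mul (by positivity), ← Real.exp_add,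
      ← Complex.normSq_eq_norm_sq, Complex.normSq_apply]
    congr 2
    ring
  simp only [h1]
  have hm2 : AEMeasurable (fun x : ℝ => ENNReal.ofReal (Real.exp (-(t * x ^ 2))))
    (gaussianReal 0 (1 / 2)) := by fun_prop
  rw [lintegral_prod_mul hm2 hm2, lintegral_exp_neg_mul_sq_gaussianReal ht,
    ← ENNReal.ofReal_mul (by positivity), Real.mul_self_sqrt (by positivity)]

theorem lintegral_expNeg_sum_mul {ι : Type*} [Fintype ι] {c : ι → ℂ}
    (hc : ∑ i, ‖c i‖ ^ 2 = 1) {t : ℝ} (ht : 0 ≤ t) :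
    ∫⁻ h, expNeg (ENNReal.ofReal (t * ‖∑ i, c i * h i‖ ^ 2))
        ∂(Measure.pi fun _ : ι => stdComplexGaussian) = ENNReal.ofReal (1 / (1 + t)) := by
  have hm : Measurable fun z : ℂ => expNeg (ENNReal.ofReal (t * ‖z‖ ^ 2)) := by fun_prop
  rw [← lintegral_expNeg_stdComplexGaussian ht]
  conv_rhs => rw [← map_sum_mul_stdComplexGaussian hc]
  rw [lintegral_map hm (by fun_prop)]

theorem vecNorm_sq {M : ℕ} (v : Fin M → ℂ) : vecNorm v ^ 2 = ∑ p, ‖v p‖ ^ 2 := by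
  rw [vecNorm, EuclideanSpace.norm_sq_eq]

@[fun_prop] theorem measurable_vecNorm {M : ℕ} : Measurable (vecNorm : (Fin M → ℂ) → ℝ) := by
  unfold vecNorm
  exact (PiLp.continuous_toLp 2 _).norm.measurable

theorem lintegral_expNeg_vecNorm_sq {M : ℕ} {t : ℝ} (ht : 0 ≤ t) :
    ∫⁻ h, expNeg (ENNReal.ofReal (t * vecNorm h ^ 2))
        ∂(Measure.pi fun _ : Fin M => stdComplexGaussian) = ENNReal.ofReal (1 / (1 + t)) ^ M := by
  have hm : Measurable fun z : ℂ => expNeg (ENNReal.ofReal (t * ‖z‖ ^ 2)) := by fun_prop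
  have h1 : ∀ h : Fin M → ℂ, expNeg (ENNReal.ofReal (t * vecNorm h ^ 2)) =
      ∏ p, expNeg (ENNReal.ofReal (t * ‖h p‖ ^ 2)) := by
    intro h
    rw [vecNorm_sq, Finset.mul_sum, ENNReal.ofReal_sum_of_nonneg (fun p _ => by positivity),
      expNeg_sum]
  simp only [h1]
  have hind := iIndepFun_pi (μ := fun _ : Fin M => stdComplexGaussian)
    (X := fun _ z => expNeg (ENNReal.ofReal (t * ‖z‖ ^ 2))) (fun _ => hm.aemeasurable)
  rw [lintegral_prod_eq_prod_lintegral_of_indepFun Finset.univ _ hind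
    (fun p => hm.comp (measurable_pi_apply p))]
  have h2 : ∀ p : Fin M, ∫⁻ h : Fin M → ℂ, expNeg (ENNReal.ofReal (t * ‖h p‖ ^ 2))
      ∂(Measure.pi fun _ : Fin M => stdComplexGaussian) = ENNReal.ofReal (1 / (1 + t)) := by
    intro p
    rw [← lintegral_expNeg_stdComplexGaussian ht,
      ← (measurePreserving_eval (fun _ : Fin M => stdComplexGaussian) p).lintegral_comp hm]
  simp [h2]

theorem lintegral_expNeg_gammaMeasure {M : ℕ} (hM : 1 ≤ M) {t : ℝ} (ht : 0 ≤ t) :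
    ∫⁻ x, expNeg (ENNReal.ofReal (t * x)) ∂(gammaMeasure M 1) =
      ENNReal.ofReal (1 / (1 + t)) ^ M := by
  have hM0 : (0 : ℝ) < M := by exact_mod_cast hM
  have hm : Measurable fun x : ℝ => expNeg (ENNReal.ofReal (t * x)) := by fun_prop
  have hg : ∀ r : ℝ, Measurable (gammaPDF M r) :=
    fun r => (measurable_gammaPDFReal M r).ennreal_ofReal
  rw [gammaMeasure, lintegral_withDensity_fun (hg 1) hm]
  have h1 : ∀ x : ℝ, gammaPDF M 1 x * expNeg (ENNReal.ofReal (t * x)) =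
      ENNReal.ofReal (1 / (1 + t)) ^ M * gammaPDF M (1 + t) x := by
    intro x
    rcases lt_or_ge x 0 with hx | hx
    · simp [gammaPDF_of_neg hx]
    · rw [gammaPDF_of_nonneg hx, gammaPDF_of_nonneg hx, expNeg_ofReal (by positivity),
        ← ENNReal.ofReal_pow (by positivity), ← ENNReal.ofReal_mul (by positivity),
        ← ENNReal.ofReal_mul (by positivity), Real.one_rpow, Real.rpow_natCast]
      congr 1
      have : Real.exp (-((1 + t) * x)) = Real.exp (-(1 * x)) * Real.exp (-(t * x)) := by
        rw [← Real.exp_add]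
        ring_nf
      rw [this, div_pow, one_pow]
      field_simp
  simp only [h1]
  rw [lintegral_const_mul _ (hg _), lintegral_gammaPDF_eq_one hM0 (by linarith), mul_one]

/-- The tail of the Erlang distribution with `M` stages of rate `1`. -/
noncomputable def erlangTail (M : ℕ) (t : ℝ) : ℝ :=
  ∑ m ∈ Finset.range M, t ^ m / (m.factorial : ℝ) * Real.exp (-t)

/-- The derivative telescopes: only the top power survives, and it is minus the Gamma density with
shape `M + 1`. -/
theorem hasDerivAt_erlangTail (M : ℕ) (t : ℝ) :
    HasDerivAt (erlangTail (M + 1)) (-(t ^ M / (M.factorial : ℝ) * Real.exp (-t))) t := by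
  have he : HasDerivAt (fun t : ℝ => Real.exp (-t)) (-Real.exp (-t)) t := by
    simpa using (hasDerivAt_id t).neg.exp
  induction M with
  | zero =>
    have : erlangTail (0 + 1) = fun t => Real.exp (-t) := by
      funext t
      simp [erlangTail]
    rw [this]
    simpa using he
  | succ M ih =>
    have h1 : erlangTail (M + 1 + 1) = fun t => erlangTail (M + 1) t +
        t ^ (M + 1) / ((M + 1).factorial : ℝ) * Real.exp (-t) := by
      funext t
      rw [erlangTail, Finset.sum_range_succ]
      rfl
    rw [h1]
    refine (ih.add (((hasDerivAt_pow (M + 1) t).div_const _).mul he)).congr_deriv ?_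
    have h2 : ((M + 1).factorial : ℝ) = (M + 1) * M.factorial := by
      rw [Nat.factorial_succ]
      push_cast
      ring
    have h3 : (M.factorial : ℝ) ≠ 0 := by positivity
    have h4 : (M + 1 : ℝ) ≠ 0 := by positivity
    rw [h2]
    push_cast
    field_simp
    ring

theorem tendsto_erlangTail (M : ℕ) :
    Filter.Tendsto (erlangTail M) Filter.atTop (nhds 0) := by
  have h : Filter.Tendsto (fun t : ℝ => ∑ m ∈ Finset.range M,
      t ^ m / (m.factorial : ℝ) * Real.exp (-t)) Filter.atTop
      (nhds (∑ m ∈ Finset.range M, 0 / (m.factorial : ℝ))) := by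
    refine tendsto_finsetSum _ fun m _ => ?_
    refine ((Real.tendsto_pow_mul_exp_neg_atTop_nhds_zero m).div_const _).congr fun t => ?_
    ring
  have h' : Filter.Tendsto (fun t : ℝ => ∑ m ∈ Finset.range M,
      t ^ m / (m.factorial : ℝ) * Real.exp (-t)) Filter.atTop (nhds 0) := by simpa using h
  exact h'

/-- Minus the Erlang tail is an antiderivative of the density, and the tail vanishes at infinity. -/
theorem gammaMeasure_Ioi {M : ℕ} (hM : 1 ≤ M) {t : ℝ} (ht : 0 ≤ t) :
    gammaMeasure M 1 (Set.Ioi t) = ENNReal.ofReal (erlangTail M t) := by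
  obtain ⟨K, rfl⟩ : ∃ K, M = K + 1 := ⟨M - 1, by omega⟩
  have hint := integrableOn_Ioi_deriv_of_nonpos' (a := t)
    (fun x _ => hasDerivAt_erlangTail K x)
    (fun x hx => neg_nonpos.2 (by
      have : 0 ≤ x := ht.trans (le_of_lt hx)
      positivity)) (tendsto_erlangTail (K + 1))
  have hval := integral_Ioi_of_hasDerivAt_of_nonpos' (a := t)
    (fun x _ => hasDerivAt_erlangTail K x)
    (fun x hx => neg_nonpos.2 (by
      have : 0 ≤ x := ht.trans (le_of_lt hx)
      positivity)) (tendsto_erlangTail (K + 1))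
  rw [gammaMeasure, withDensity_apply _ measurableSet_Ioi]
  have h1 : ∀ x ∈ Set.Ioi t, gammaPDF ((K + 1 : ℕ) : ℝ) 1 x =
      ENNReal.ofReal (x ^ K / (K.factorial : ℝ) * Real.exp (-x)) := by
    intro x hx
    rw [gammaPDF_of_nonneg (ht.trans (le_of_lt hx))]
    congr 1
    push_cast
    rw [Real.Gamma_nat_eq_factorial, add_sub_cancel_right, Real.rpow_natCast, Real.one_rpow,
      one_mul]
    ring
  rw [setLIntegral_congr_fun measurableSet_Ioi h1, ← ofReal_integral_eq_lintegral_ofReal]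
  · congr 1
    rw [integral_neg] at hval
    linarith
  · have h2 : IntegrableOn (fun x => x ^ K / (K.factorial : ℝ) * Real.exp (-x)) (Set.Ioi t) := by
      simpa using hint.neg
    exact h2
  · refine (ae_restrict_iff' measurableSet_Ioi).2 (ae_of_all _ fun x hx => ?_)
    have : 0 ≤ x := ht.trans (le_of_lt hx)
    positivity

/-- The squared norm has the Gamma law with parameters `M` and `1`, since both Laplace transforms
equal `(1 + t)^(-M)`. -/
theorem stdComplexGaussian_vecNorm_sq_gt {M : ℕ} (hM : 1 ≤ M) {t : ℝ} (ht : 0 ≤ t) :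
    (Measure.pi fun _ : Fin M => stdComplexGaussian) {h | t < vecNorm h ^ 2} =
      ENNReal.ofReal (erlangTail M t) := by
  have hM0 : (0 : ℝ) < M := by exact_mod_cast hM
  have := isProbabilityMeasure_gammaMeasure hM0 one_pos
  have hm1 : Measurable fun h : Fin M → ℂ => ENNReal.ofReal (vecNorm h ^ 2) := by fun_prop
  have hm2 : Measurable fun x : ℝ => ENNReal.ofReal x := by fun_prop
  have h1 : ((Measure.pi fun _ : Fin M => stdComplexGaussian).map
      fun h => ENNReal.ofReal (vecNorm h ^ 2)) = (gammaMeasure M 1).map ENNReal.ofReal := by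
    have := Measure.isProbabilityMeasure_map
      (μ := Measure.pi fun _ : Fin M => stdComplexGaussian) hm1.aemeasurable
    have := Measure.isProbabilityMeasure_map (μ := gammaMeasure M 1) hm2.aemeasurable
    refine ext_of_laplace fun k => ?_
    rw [lintegral_map (by fun_prop) hm1, lintegral_map (by fun_prop) hm2]
    have h2 : ∀ x : ℝ, (k : ℝ≥0∞) * ENNReal.ofReal x = ENNReal.ofReal (k * x) := fun x => by
      rw [ENNReal.ofReal_mul (by positivity), ENNReal.ofReal_natCast]
    simp only [h2]
    rw [lintegral_expNeg_vecNorm_sq (by positivity), lintegral_expNeg_gammaMeasure hM (by positivity)]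
  have h3 := congrArg (fun ν => ν (Set.Ioi (ENNReal.ofReal t))) h1
  simp only [Measure.map_apply hm1 measurableSet_Ioi, Measure.map_apply hm2 measurableSet_Ioi] at h3
  rw [← gammaMeasure_Ioi hM ht]
  convert h3 using 2
  · ext h
    simp [ENNReal.ofReal_lt_ofReal_iff_of_nonneg ht]
  · ext x
    simp [ENNReal.ofReal_lt_ofReal_iff_of_nonneg ht]

end Gaussian


/-! ### Integrals over the plane -/

section PlaneIntegrals

open Filter Topology

theorem finrank_plane : Module.finrank ℝ Plane = 2 := finrank_euclideanSpace_fin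

theorem volume_real_unit_ball : (volume : Measure Plane).real (Metric.ball 0 1) = Real.pi := by
  rw [measureReal_def, EuclideanSpace.volume_ball_fin_two]
  simp [Real.pi_pos.le]

theorem integral_plane_norm (f : ℝ → ℝ) :
    ∫ z : Plane, f ‖z‖ = 2 * Real.pi * ∫ r in Set.Ioi (0 : ℝ), r * f r := by
  rw [integral_fun_norm_addHaar volume f, finrank_plane, volume_real_unit_ball]
  simp [mul_assoc]

theorem integrable_plane_norm {f : ℝ → ℝ} :
    Integrable (fun z : Plane => f ‖z‖) ↔ IntegrableOn (fun r => r * f r) (Set.Ioi 0) := by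
  rw [integrable_fun_norm_addHaar volume, finrank_plane]
  simp

theorem lintegral_rpow_mul_exp_neg_mul_rpow {s p b : ℝ} (hs : -1 < s) (hp : 0 < p) (hb : 0 < b) :
    ∫⁻ x in Set.Ioi (0 : ℝ), ENNReal.ofReal (x ^ s * Real.exp (-b * x ^ p)) =
      ENNReal.ofReal (b ^ (-(s + 1) / p) * (1 / p) * Real.Gamma ((s + 1) / p)) := by
  rw [← integral_rpow_mul_exp_neg_mul_rpow hp hs hb, ofReal_integral_eq_lintegral_ofReal]
  · exact integrableOn_rpow_mul_exp_neg_mul_rpow hs hp hb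
  · refine (ae_restrict_iff' measurableSet_Ioi).2 (ae_of_all _ fun x hx => ?_)
    have : 0 ≤ x := le_of_lt hx
    positivity

theorem lintegral_exp_neg_mul_norm_rpow {α q : ℝ} (hα : 0 < α) (hq : 0 < q) :
    ∫⁻ z : Plane, ENNReal.ofReal (Real.exp (-q * ‖z‖ ^ α)) =
      ENNReal.ofReal (2 * Real.pi * (q ^ (-2 / α) * (1 / α) * Real.Gamma (2 / α))) := by
  have h2 : ((1 : ℝ) + 1) = 2 := by norm_num
  have hint := integrableOn_rpow_mul_exp_neg_mul_rpow (s := 1) (by norm_num) hα hq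
  have hval := integral_rpow_mul_exp_neg_mul_rpow hα (q := 1) (by norm_num) hq
  simp only [Real.rpow_one, h2] at hint hval
  rw [← ofReal_integral_eq_lintegral_ofReal, integral_plane_norm fun r => Real.exp (-q * r ^ α),
    hval]
  · exact (integrable_plane_norm (f := fun r => Real.exp (-q * r ^ α))).2 hint
  · exact ae_of_all _ fun z => (Real.exp_pos _).le

/-- Laplace transform at `t` of the power received from a Rayleigh faded interferer at
distance `d`. -/
noncomputable def fadeLaplace (α t d : ℝ) : ℝ≥0∞ := ENNReal.ofReal (1 / (1 + t * d ^ (-α)))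

theorem fadeLaplace_le_one {α t d : ℝ} (ht : 0 ≤ t) (hd : 0 ≤ d) : fadeLaplace α t d ≤ 1 := by
  rw [fadeLaplace, ← ENNReal.ofReal_one]
  refine ENNReal.ofReal_le_ofReal (div_le_one_of_le₀ ?_ (by positivity))
  have : 0 ≤ t * d ^ (-α) := by positivity
  linarith

theorem fadeLaplace_mono {α t d d' : ℝ} (hα : 0 ≤ α) (ht : 0 ≤ t) (hd : 0 < d) (h : d ≤ d') :
    fadeLaplace α t d ≤ fadeLaplace α t d' := by
  have hd' : 0 < d' := hd.trans_le h
  refine ENNReal.ofReal_le_ofReal (one_div_le_one_div_of_le (by positivity) ?_)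
  have := Real.rpow_le_rpow_of_nonpos hd h (neg_nonpos.2 hα)
  gcongr

@[fun_prop] theorem measurable_fadeLaplace {α t : ℝ} : Measurable (fadeLaplace α t) := by
  unfold fadeLaplace
  fun_prop

theorem continuousAt_fadeLaplace {α t d : ℝ} (ht : 0 ≤ t) (hd : 0 < d) :
    ContinuousAt (fadeLaplace α t) d := by
  refine (ENNReal.continuous_ofReal.continuousAt).comp ?_
  refine continuousAt_const.div ?_ (by positivity)
  exact continuousAt_const.add (continuousAt_const.mul
    (Real.continuousAt_rpow_const d (-α) (Or.inl hd.ne')))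

/-- The left side is `t / (d^α + t)`. Writing it as an integral of exponentials in `q` separates `d`
from `t`, so that the integral over the plane becomes explicit after Tonelli. -/
theorem one_sub_fadeLaplace {α t d : ℝ} (ht : 0 < t) (hd : 0 < d) :
    1 - fadeLaplace α t d =
      ∫⁻ q in Set.Ioi (0 : ℝ), ENNReal.ofReal (t * Real.exp (-(d ^ α + t) * q)) := by
  have hb : 0 < d ^ α + t := by positivity
  have h1 := lintegral_rpow_mul_exp_neg_mul_rpow (s := 0) (p := 1) (by norm_num) one_pos hb
  simp only [Real.rpow_zero, one_mul, Real.rpow_one] at h1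
  have h2 : ∀ q : ℝ, ENNReal.ofReal (t * Real.exp (-(d ^ α + t) * q)) =
      ENNReal.ofReal t * ENNReal.ofReal (Real.exp (-(d ^ α + t) * q)) := fun q =>
    ENNReal.ofReal_mul ht.le
  simp only [h2]
  rw [lintegral_const_mul _ (by fun_prop), h1, ← ENNReal.ofReal_mul ht.le, fadeLaplace,
    ← ENNReal.ofReal_one, ← ENNReal.ofReal_sub _ (by positivity)]
  congr 1
  have h3 : (0 : ℝ) < d ^ α := by positivity
  simp only [zero_add, div_one, Real.Gamma_one, mul_one, Real.rpow_neg hd.le, Real.rpow_neg_one]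
  field_simp
  ring

theorem norm_pos_ae : ∀ᵐ z : Plane, 0 < ‖z‖ := by
  have h : ∀ᵐ z : Plane, z ∉ ({0} : Set Plane) := measure_eq_zero_iff_ae_notMem.1 (measure_singleton 0)
  filter_upwards [h] with z hz
  exact norm_pos_iff.2 hz

/-- After Tonelli the plane integral of `exp(-q ‖z‖^α)` gives `Γ(2/α) q^(-2/α)`, and the integral
over `q` then gives `Γ(1 - 2/α)`, convergent because `α > 2`. The value does not depend on `y`,
which later makes the interference law independent of where the receiver is. -/
theorem lintegral_one_sub_fadeLaplace {α t : ℝ} (hα : 2 < α) (ht : 0 ≤ t) (y : Plane) :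
    ∫⁻ y', (1 - fadeLaplace α t (dist y' y)) =
      ENNReal.ofReal (Real.pi * Real.Gamma (1 + 2 / α) * Real.Gamma (1 - 2 / α) * t ^ (2 / α)) := by
  have hα0 : 0 < α := by linarith
  rcases ht.eq_or_lt with rfl | ht
  · simp [fadeLaplace, Real.zero_rpow (div_pos two_pos hα0).ne']
  simp only [dist_eq_norm]
  rw [lintegral_sub_right_eq_self (fun z : Plane => 1 - fadeLaplace α t ‖z‖) y]
  have h1 : ∫⁻ z : Plane, (1 - fadeLaplace α t ‖z‖) = ∫⁻ z : Plane, ∫⁻ q in Set.Ioi (0 : ℝ),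
      ENNReal.ofReal (t * Real.exp (-(‖z‖ ^ α + t) * q)) := by
    refine lintegral_congr_ae ?_
    filter_upwards [norm_pos_ae] with z hz
    exact one_sub_fadeLaplace ht hz
  rw [h1, lintegral_lintegral_swap (Measurable.aemeasurable (by fun_prop))]
  have h2 : ∀ q ∈ Set.Ioi (0 : ℝ),
      ∫⁻ z : Plane, ENNReal.ofReal (t * Real.exp (-(‖z‖ ^ α + t) * q)) =
        ENNReal.ofReal (t * (2 * Real.pi * ((1 / α) * Real.Gamma (2 / α)))) *
          ENNReal.ofReal (q ^ (-(2 / α)) * Real.exp (-t * q ^ (1 : ℝ))) := by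
    intro q hq
    have hq0 : 0 < q := hq
    have h3 : ∀ z : Plane, ENNReal.ofReal (t * Real.exp (-(‖z‖ ^ α + t) * q)) =
        ENNReal.ofReal (t * Real.exp (-t * q)) * ENNReal.ofReal (Real.exp (-q * ‖z‖ ^ α)) := by
      intro z
      rw [← ENNReal.ofReal_mul (by positivity), mul_assoc, ← Real.exp_add]
      congr 3
      ring
    simp only [h3]
    have hG : 0 < Real.Gamma (2 / α) := Real.Gamma_pos_of_pos (by positivity)
    rw [lintegral_const_mul _ (by fun_prop), lintegral_exp_neg_mul_norm_rpow hα0 hq0,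
      ← ENNReal.ofReal_mul (by positivity), ← ENNReal.ofReal_mul (by positivity), Real.rpow_one,
      neg_div]
    congr 1
    ring
  have h2a : 2 / α < 1 := (div_lt_one hα0).2 hα
  rw [setLIntegral_congr_fun measurableSet_Ioi h2, lintegral_const_mul _ (by fun_prop),
    lintegral_rpow_mul_exp_neg_mul_rpow (by linarith) one_pos ht]
  have hG : 0 < Real.Gamma (2 / α) := Real.Gamma_pos_of_pos (by positivity)
  rw [← ENNReal.ofReal_mul (by positivity)]
  congr 1
  have h4 : t ^ (-(-(2 / α) + 1) / 1) = t ^ (2 / α) / t := by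
    rw [div_one, neg_add, neg_neg, ← sub_eq_add_neg, Real.rpow_sub ht, Real.rpow_one]
  have h5 : Real.Gamma (1 + 2 / α) = 2 / α * Real.Gamma (2 / α) := by
    rw [add_comm, Real.Gamma_add_one (by positivity)]
  have h6 : (-(2 / α) + 1) / 1 = 1 - 2 / α := by ring
  rw [h4, h5, h6]
  field_simp

end PlaneIntegrals

/-! ### The factor of an access point: interference or exclusion from the service disc. -/

section Association

open Filter Topology

/-- The factor contributed by an access point at `y'` when the sensor at `x` is served by an
access point at `y`: it either is active (with probability `ρ`) and interferes, or is not active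
and then must lie farther from `x` than `y`. -/
noncomputable def apFactor (ρ α t : ℝ) (x y y' : Plane) : ℝ≥0∞ :=
  ENNReal.ofReal ρ * fadeLaplace α t (dist y' y) +
    ENNReal.ofReal (1 - ρ) * (Metric.closedBall x (dist x y))ᶜ.indicator 1 y'

/-- An upper bound of `apFactor ρ α t x y y'` for `y` in the `ε`-neighbourhood of `q`. -/
noncomputable def apFactorHi (ρ α t : ℝ) (x : Plane) (ε : ℝ) (q y' : Plane) : ℝ≥0∞ :=
  if dist y' q ≤ ε then 1 else
    ENNReal.ofReal ρ * fadeLaplace α t (dist y' q + ε) +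
      ENNReal.ofReal (1 - ρ) * (if dist x q - ε < dist x y' then 1 else 0)

/-- A lower bound of `apFactor ρ α t x y y'` for `y` in the `ε`-neighbourhood of `q`. -/
noncomputable def apFactorLo (ρ α t : ℝ) (x : Plane) (ε : ℝ) (q y' : Plane) : ℝ≥0∞ :=
  if dist y' q ≤ ε then 0 else
    ENNReal.ofReal ρ * fadeLaplace α t (dist y' q - ε) +
      ENNReal.ofReal (1 - ρ) * (if dist x q + ε < dist x y' then 1 else 0)

variable {ρ α t : ℝ} {x : Plane}

theorem apFactor_eq (y y' : Plane) : apFactor ρ α t x y y' =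
    ENNReal.ofReal ρ * fadeLaplace α t (dist y' y) +
      ENNReal.ofReal (1 - ρ) * (if dist x y < dist x y' then 1 else 0) := by
  rw [apFactor]
  congr 2
  by_cases h : dist x y < dist x y'
  · simp [h, dist_comm y' x]
  · rw [if_neg h, Set.indicator_of_notMem]
    simpa [dist_comm y' x] using h

theorem convex_combination_le_one (hρ0 : 0 ≤ ρ) (hρ1 : ρ ≤ 1) {a b : ℝ≥0∞} (ha : a ≤ 1)
    (hb : b ≤ 1) : ENNReal.ofReal ρ * a + ENNReal.ofReal (1 - ρ) * b ≤ 1 := by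
  calc ENNReal.ofReal ρ * a + ENNReal.ofReal (1 - ρ) * b
      ≤ ENNReal.ofReal ρ * 1 + ENNReal.ofReal (1 - ρ) * 1 := by gcongr
    _ = 1 := by
      rw [mul_one, mul_one, ← ENNReal.ofReal_add hρ0 (by linarith)]
      simp

theorem one_sub_convex_combination (hρ0 : 0 ≤ ρ) (hρ1 : ρ ≤ 1) {a b : ℝ≥0∞} (ha : a ≤ 1)
    (hb : b ≤ 1) : 1 - (ENNReal.ofReal ρ * a + ENNReal.ofReal (1 - ρ) * b) =
      ENNReal.ofReal ρ * (1 - a) + ENNReal.ofReal (1 - ρ) * (1 - b) := by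
  have h1 : ENNReal.ofReal ρ + ENNReal.ofReal (1 - ρ) = 1 := by
    rw [← ENNReal.ofReal_add hρ0 (by linarith)]
    simp
  have hne : ENNReal.ofReal ρ * a + ENNReal.ofReal (1 - ρ) * b ≠ ∞ :=
    ne_top_of_le_ne_top ENNReal.one_ne_top (convex_combination_le_one hρ0 hρ1 ha hb)
  refine ENNReal.sub_eq_of_eq_add hne ?_
  calc (1 : ℝ≥0∞) = ENNReal.ofReal ρ * ((1 - a) + a) + ENNReal.ofReal (1 - ρ) * ((1 - b) + b) := by
        rw [tsub_add_cancel_of_le ha, tsub_add_cancel_of_le hb, mul_one, mul_one, h1]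
    _ = _ := by ring

theorem measurable_apFactor : Measurable (Function.uncurry (apFactor ρ α t x)) := by
  have h : Function.uncurry (apFactor ρ α t x) = fun p : Plane × Plane =>
      ENNReal.ofReal ρ * fadeLaplace α t (dist p.2 p.1) +
        ENNReal.ofReal (1 - ρ) * (if dist x p.1 < dist x p.2 then 1 else 0) := by
    funext p
    exact apFactor_eq _ _
  rw [h]
  have hs : MeasurableSet {p : Plane × Plane | dist x p.1 < dist x p.2} :=
    measurableSet_lt (by fun_prop) (by fun_prop)
  have hi : Measurable fun p : Plane × Plane => if dist x p.1 < dist x p.2 then (1 : ℝ≥0∞) else 0 :=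
    Measurable.ite hs measurable_const measurable_const
  fun_prop

theorem measurable_apFactorHi (ε : ℝ) :
    Measurable (Function.uncurry (apFactorHi ρ α t x ε)) := by
  have hs : MeasurableSet {p : Plane × Plane | dist x p.1 - ε < dist x p.2} :=
    measurableSet_lt (by fun_prop) (by fun_prop)
  have hi : Measurable fun p : Plane × Plane =>
      if dist x p.1 - ε < dist x p.2 then (1 : ℝ≥0∞) else 0 :=
    Measurable.ite hs measurable_const measurable_const
  have hs' : MeasurableSet {p : Plane × Plane | dist p.2 p.1 ≤ ε} :=
    measurableSet_le (by fun_prop) (by fun_prop)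
  exact Measurable.ite hs' measurable_const (by fun_prop)

theorem measurable_apFactorLo (ε : ℝ) :
    Measurable (Function.uncurry (apFactorLo ρ α t x ε)) := by
  have hs : MeasurableSet {p : Plane × Plane | dist x p.1 + ε < dist x p.2} :=
    measurableSet_lt (by fun_prop) (by fun_prop)
  have hi : Measurable fun p : Plane × Plane =>
      if dist x p.1 + ε < dist x p.2 then (1 : ℝ≥0∞) else 0 :=
    Measurable.ite hs measurable_const measurable_const
  have hs' : MeasurableSet {p : Plane × Plane | dist p.2 p.1 ≤ ε} :=
    measurableSet_le (by fun_prop) (by fun_prop)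
  exact Measurable.ite hs' measurable_const (by fun_prop)

theorem apFactor_le_one (hρ0 : 0 ≤ ρ) (hρ1 : ρ ≤ 1) (ht : 0 ≤ t) (y y' : Plane) :
    apFactor ρ α t x y y' ≤ 1 := by
  rw [apFactor_eq]
  refine convex_combination_le_one hρ0 hρ1 (fadeLaplace_le_one ht dist_nonneg) ?_
  split_ifs <;> simp

theorem apFactorHi_le_one (hρ0 : 0 ≤ ρ) (hρ1 : ρ ≤ 1) (ht : 0 ≤ t) {ε : ℝ} (hε : 0 ≤ ε)
    (q y' : Plane) : apFactorHi ρ α t x ε q y' ≤ 1 := by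
  rw [apFactorHi]
  split_ifs with h1 h2
  · exact le_rfl
  · exact convex_combination_le_one hρ0 hρ1 (fadeLaplace_le_one ht (by positivity)) le_rfl
  · exact convex_combination_le_one hρ0 hρ1 (fadeLaplace_le_one ht (by positivity)) zero_le

theorem apFactor_le_apFactorHi (hρ0 : 0 ≤ ρ) (hρ1 : ρ ≤ 1) (hα : 0 ≤ α) (ht : 0 ≤ t) {ε : ℝ}
    {q y : Plane} (h : dist y q ≤ ε) (y' : Plane) :
    apFactor ρ α t x y y' ≤ apFactorHi ρ α t x ε q y' := by
  rw [apFactorHi]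
  split_ifs with h1 h2
  · exact apFactor_le_one hρ0 hρ1 ht _ _
  all_goals
    have hd : 0 < dist y' y := by
      linarith [dist_triangle y' y q]
    rw [apFactor_eq]
    refine add_le_add (mul_le_mul_right (fadeLaplace_mono hα ht hd ?_) _) (mul_le_mul_right ?_ _)
    · linarith [dist_triangle y' q y, dist_comm y q]
  · split_ifs <;> simp
  · rw [if_neg]
    linarith [dist_triangle x y q]

theorem apFactorLo_le_apFactor (hα : 0 ≤ α) (ht : 0 ≤ t) {ε : ℝ}
    {q y : Plane} (h : dist y q ≤ ε) (y' : Plane) :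
    apFactorLo ρ α t x ε q y' ≤ apFactor ρ α t x y y' := by
  rw [apFactorLo]
  split_ifs with h1 h2
  · exact zero_le
  all_goals
    rw [apFactor_eq]
    refine add_le_add (mul_le_mul_right (fadeLaplace_mono hα ht (by linarith) ?_) _)
      (mul_le_mul_right ?_ _)
    · linarith [dist_triangle y' y q]
  · rw [if_pos]
    linarith [dist_triangle x q y, dist_comm y q]
  · exact zero_le

theorem apFactorLo_anti (hα : 0 ≤ α) (ht : 0 ≤ t) {ε ε' : ℝ} (h : ε' ≤ ε) (q y' : Plane) :
    apFactorLo ρ α t x ε q y' ≤ apFactorLo ρ α t x ε' q y' := by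
  rw [apFactorLo]
  split_ifs with h1 h2
  · exact zero_le
  all_goals
    rw [apFactorLo, if_neg (by linarith)]
    refine add_le_add (mul_le_mul_right (fadeLaplace_mono hα ht (by linarith) (by linarith)) _)
      (mul_le_mul_right ?_ _)
  · rw [if_pos (by linarith)]
  · exact zero_le

/-- The excluded points, `y` itself and the circle through `y` around `x`, are those where
continuity of the factor in `y` may fail; both sets are null. -/
theorem ae_dist_ne (x y : Plane) : ∀ᵐ y' : Plane, 0 < dist y' y ∧ dist x y' ≠ dist x y := by
  have h1 : ∀ᵐ y' : Plane, y' ∉ ({y} : Set Plane) :=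
    measure_eq_zero_iff_ae_notMem.1 (measure_singleton y)
  have h2 : ∀ᵐ y' : Plane, y' ∉ Metric.sphere x (dist x y) :=
    measure_eq_zero_iff_ae_notMem.1 (Measure.addHaar_sphere volume x _)
  filter_upwards [h1, h2] with y' h1 h2
  refine ⟨dist_pos.2 h1, fun h => h2 ?_⟩
  rw [Metric.mem_sphere, dist_comm, h]

theorem tendsto_apFactorHi (ht : 0 ≤ t) {ε : ℕ → ℝ} (hε : Tendsto ε atTop (𝓝 0)) {y y' : Plane}
    (h1 : 0 < dist y' y) (h2 : dist x y' ≠ dist x y) :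
    Tendsto (fun m => apFactorHi ρ α t x (ε m) y y') atTop (𝓝 (apFactor ρ α t x y y')) := by
  have hE1 : ∀ᶠ m in atTop, ε m < dist y' y := hε.eventually_lt_const h1
  have hE2 : ∀ᶠ m in atTop, |ε m| < |dist x y' - dist x y| := by
    have h3 : Tendsto (fun m => |ε m|) atTop (𝓝 0) := by simpa using hε.abs
    exact h3.eventually_lt_const (abs_pos.2 (sub_ne_zero.2 h2))
  have hlim : Tendsto (fun m => ENNReal.ofReal ρ * fadeLaplace α t (dist y' y + ε m) +
      ENNReal.ofReal (1 - ρ) * (if dist x y < dist x y' then 1 else 0)) atTop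
      (𝓝 (apFactor ρ α t x y y')) := by
    rw [apFactor_eq]
    refine Tendsto.add (ENNReal.Tendsto.const_mul ?_ (Or.inr ENNReal.ofReal_ne_top))
      tendsto_const_nhds
    refine (continuousAt_fadeLaplace ht h1).tendsto.comp ?_
    simpa using hε.const_add (dist y' y)
  refine hlim.congr' ?_
  filter_upwards [hE1, hE2] with m hm1 hm2
  rw [apFactorHi, if_neg (not_le.2 hm1)]
  congr 2
  rcases lt_or_gt_of_ne h2 with h3 | h3
  · rw [abs_of_neg (sub_neg.2 h3)] at hm2
    rw [if_neg (by linarith), if_neg (by linarith [le_abs_self (ε m)])]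
  · rw [abs_of_pos (sub_pos.2 h3)] at hm2
    rw [if_pos (by linarith), if_pos (by linarith [neg_abs_le (ε m)])]

theorem tendsto_apFactorLo (ht : 0 ≤ t) {ε : ℕ → ℝ} (hε : Tendsto ε atTop (𝓝 0)) {y y' : Plane}
    (h1 : 0 < dist y' y) (h2 : dist x y' ≠ dist x y) :
    Tendsto (fun m => apFactorLo ρ α t x (ε m) y y') atTop (𝓝 (apFactor ρ α t x y y')) := by
  have hE1 : ∀ᶠ m in atTop, ε m < dist y' y := hε.eventually_lt_const h1
  have hE2 : ∀ᶠ m in atTop, |ε m| < |dist x y' - dist x y| := by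
    have h3 : Tendsto (fun m => |ε m|) atTop (𝓝 0) := by simpa using hε.abs
    exact h3.eventually_lt_const (abs_pos.2 (sub_ne_zero.2 h2))
  have hlim : Tendsto (fun m => ENNReal.ofReal ρ * fadeLaplace α t (dist y' y - ε m) +
      ENNReal.ofReal (1 - ρ) * (if dist x y < dist x y' then 1 else 0)) atTop
      (𝓝 (apFactor ρ α t x y y')) := by
    rw [apFactor_eq]
    refine Tendsto.add (ENNReal.Tendsto.const_mul ?_ (Or.inr ENNReal.ofReal_ne_top))
      tendsto_const_nhds
    refine (continuousAt_fadeLaplace ht h1).tendsto.comp ?_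
    simpa using hε.const_sub (dist y' y)
  refine hlim.congr' ?_
  filter_upwards [hE1, hE2] with m hm1 hm2
  rw [apFactorLo, if_neg (not_le.2 hm1)]
  congr 2
  rcases lt_or_gt_of_ne h2 with h3 | h3
  · rw [abs_of_neg (sub_neg.2 h3)] at hm2
    rw [if_neg (by linarith), if_neg (by linarith [neg_abs_le (ε m)])]
  · rw [abs_of_pos (sub_pos.2 h3)] at hm2
    rw [if_pos (by linarith), if_pos (by linarith [le_abs_self (ε m)])]

/-- The complement to `1` of a convex combination is the combination of the complements. Active
points give the fading integral, which ignores `x`; idle points give the area of the disc through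
`y` around `x`. The two add in the exponent, so interference and service distance separate. -/
theorem lintegral_one_sub_apFactor (hρ0 : 0 ≤ ρ) (hρ1 : ρ ≤ 1) (hα : 2 < α) (ht : 0 ≤ t)
    (y : Plane) : ∫⁻ y', (1 - apFactor ρ α t x y y') =
      ENNReal.ofReal (ρ * (Real.pi * Real.Gamma (1 + 2 / α) * Real.Gamma (1 - 2 / α) *
        t ^ (2 / α)) + (1 - ρ) * (Real.pi * dist x y ^ 2)) := by
  have h1 : ∀ y', 1 - apFactor ρ α t x y y' =
      ENNReal.ofReal ρ * (1 - fadeLaplace α t (dist y' y)) +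
        ENNReal.ofReal (1 - ρ) * (Metric.closedBall x (dist x y)).indicator 1 y' := by
    intro y'
    rw [apFactor, one_sub_convex_combination hρ0 hρ1 (fadeLaplace_le_one ht dist_nonneg)]
    · congr 2
      by_cases h : y' ∈ Metric.closedBall x (dist x y)
      · rw [Set.indicator_of_mem h, Set.indicator_of_notMem (by simpa using h)]
        simp
      · rw [Set.indicator_of_notMem h, Set.indicator_of_mem h]
        simp
    · exact Set.indicator_le_self' (f := (1 : Plane → ℝ≥0∞)) (fun _ _ => zero_le) y'
  have hα0 : 0 < α := by linarith
  have h2a : 2 / α < 1 := (div_lt_one hα0).2 hα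
  have hG1 : 0 < Real.Gamma (1 + 2 / α) := Real.Gamma_pos_of_pos (by positivity)
  have hG2 : 0 < Real.Gamma (1 - 2 / α) := Real.Gamma_pos_of_pos (by linarith)
  simp only [h1]
  rw [lintegral_add_left (by fun_prop), lintegral_const_mul _ (by fun_prop),
    lintegral_const_mul _ (measurable_one.indicator Metric.isClosed_closedBall.measurableSet),
    lintegral_one_sub_fadeLaplace hα ht,
    lintegral_indicator_one Metric.isClosed_closedBall.measurableSet,
    EuclideanSpace.volume_closedBall_fin_two, ← ENNReal.ofReal_pow dist_nonneg,
    ← ENNReal.ofReal_mul (by positivity), ← ENNReal.ofReal_mul (by positivity),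
    ← ENNReal.ofReal_mul (by linarith), ← ENNReal.ofReal_add (by positivity)
      (mul_nonneg (by linarith) (by positivity)), mul_comm (dist x y ^ 2)]

/-- This provides the integrable majorant for `mecke_dependent`. Outside two discs the lower bound
dominates the fading factor at half the distance, and halving the distance only multiplies `t` by
`2^α`. -/
theorem lintegral_one_sub_apFactorLo_ne_top (hρ0 : 0 ≤ ρ) (hρ1 : ρ ≤ 1) (hα : 2 < α) (ht : 0 ≤ t)
    (y : Plane) : ∫⁻ y', (1 - apFactorLo ρ α t x 1 y y') ≠ ∞ := by
  have hα0 : 0 < α := by linarith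
  have hbound : ∀ y', 1 - apFactorLo ρ α t x 1 y y' ≤
      (Metric.closedBall y 2).indicator 1 y' + (1 - fadeLaplace α (t * 2 ^ α) (dist y' y)) +
        (Metric.closedBall x (dist x y + 1)).indicator 1 y' := by
    intro y'
    by_cases h1 : dist y' y ≤ 2
    · rw [Set.indicator_of_mem (Metric.mem_closedBall.2 h1)]
      exact tsub_le_self.trans ((le_add_right le_rfl).trans (le_add_right le_rfl))
    by_cases h2 : dist x y' ≤ dist x y + 1
    · rw [Set.indicator_of_mem (s := Metric.closedBall x (dist x y + 1))
        (by rwa [Metric.mem_closedBall, dist_comm])]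
      exact tsub_le_self.trans (le_add_left le_rfl)
    refine le_trans ?_ (le_add_right (le_add_left le_rfl))
    refine tsub_le_tsub_left ?_ 1
    have h3 : fadeLaplace α (t * 2 ^ α) (dist y' y) = fadeLaplace α t (dist y' y / 2) := by
      rw [fadeLaplace, fadeLaplace, Real.div_rpow dist_nonneg zero_le_two,
        Real.rpow_neg zero_le_two]
      congr 2
      field_simp
    rw [apFactorLo, if_neg (by linarith), if_pos (by linarith), mul_one, h3]
    have h4 := fadeLaplace_mono (t := t) hα0.le ht (d := dist y' y / 2) (d' := dist y' y - 1)
      (by linarith) (by linarith)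
    have h5 := fadeLaplace_le_one (α := α) ht (d := dist y' y / 2) (by positivity)
    set a := fadeLaplace α t (dist y' y / 2)
    calc a = (ENNReal.ofReal ρ + ENNReal.ofReal (1 - ρ)) * a := by
          rw [← ENNReal.ofReal_add hρ0 (by linarith)]
          simp
      _ = ENNReal.ofReal ρ * a + ENNReal.ofReal (1 - ρ) * a := add_mul _ _ _
      _ ≤ ENNReal.ofReal ρ * fadeLaplace α t (dist y' y - 1) + ENNReal.ofReal (1 - ρ) * 1 := by
          gcongr
      _ = _ := by rw [mul_one]
  refine ne_top_of_le_ne_top ?_ (lintegral_mono hbound)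
  have hm1 : Measurable ((Metric.closedBall y 2).indicator (1 : Plane → ℝ≥0∞)) :=
    measurable_one.indicator Metric.isClosed_closedBall.measurableSet
  rw [lintegral_add_left (by fun_prop), lintegral_add_left hm1,
    lintegral_indicator_one Metric.isClosed_closedBall.measurableSet,
    lintegral_indicator_one Metric.isClosed_closedBall.measurableSet,
    lintegral_one_sub_fadeLaplace hα (by positivity)]
  exact ENNReal.add_ne_top.2 ⟨ENNReal.add_ne_top.2 ⟨measure_closedBall_lt_top.ne,
    ENNReal.ofReal_ne_top⟩, measure_closedBall_lt_top.ne⟩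

variable {Ω : Type*} [MeasurableSpace Ω] {μ : Measure Ω} [IsProbabilityMeasure μ] {lam : ℝ}
  {X : ℕ → Ω → Plane}

theorem IsHPPP.mecke_apFactor (hX : IsHPPP μ lam X) (hlam : 0 ≤ lam) (hρ0 : 0 ≤ ρ) (hρ1 : ρ ≤ 1)
    (hα : 2 < α) (ht : 0 ≤ t) {f : Plane → ℝ≥0∞} (hf : Measurable f) :
    ∑' n, ∫⁻ ω, f (X n ω) * iprod (fun i => if i = n then 1 else
        apFactor ρ α t x (X n ω) (X i ω)) ∂μ =
      ∫⁻ y, f y * ENNReal.ofReal (lam * Real.exp (-(lam * (ρ * (Real.pi * Real.Gamma (1 + 2 / α) *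
        Real.Gamma (1 - 2 / α) * t ^ (2 / α)) + (1 - ρ) * (Real.pi * dist x y ^ 2))))) := by
  have hα0 : 0 < α := by linarith
  have h2a : 2 / α < 1 := (div_lt_one hα0).2 hα
  have hG1 : 0 < Real.Gamma (1 + 2 / α) := Real.Gamma_pos_of_pos (by positivity)
  have hG2 : 0 < Real.Gamma (1 - 2 / α) := Real.Gamma_pos_of_pos (by linarith)
  have hρ' : 0 ≤ 1 - ρ := by linarith
  -- The value `ε 0 = 1` is the radius for which the majorant was shown to be integrable.
  let ε : ℕ → ℝ := fun m => 1 / ((m : ℝ) + 1)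
  have hε : ∀ m, 0 < ε m := fun m => by positivity
  have hε0 : ε 0 = 1 := by simp [ε]
  have hε1 : ∀ m, ε m ≤ 1 := fun m => by
    refine div_le_one_of_le₀ ?_ (by positivity)
    linarith [(Nat.cast_nonneg m : (0 : ℝ) ≤ m)]
  have hεl : Tendsto ε atTop (𝓝 0) := tendsto_one_div_add_atTop_nhds_zero_nat
  have key := hX.mecke_dependent hlam (v := apFactor ρ α t x)
    (lo := fun m => apFactorLo ρ α t x (ε m)) (hi := fun m => apFactorHi ρ α t x (ε m)) (ε := ε)
    measurable_apFactor (fun m => measurable_apFactorLo _) (fun m => measurable_apFactorHi _)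
    (fun m => apFactorHi_le_one hρ0 hρ1 ht (hε m).le) hε
    (fun m q y y' h => apFactorLo_le_apFactor hα0.le ht h y')
    (fun m q y y' h => apFactor_le_apFactorHi hρ0 hρ1 hα0.le ht h y')
    (fun m y y' => apFactorLo_anti hα0.le ht (by rw [hε0]; exact hε1 m) y y')
    (fun y => (ae_dist_ne x y).mono fun y' h => tendsto_apFactorLo ht hεl h.1 h.2)
    (fun y => (ae_dist_ne x y).mono fun y' h => tendsto_apFactorHi ht hεl h.1 h.2)
    (fun y => by
      rw [hε0]
      exact lintegral_one_sub_apFactorLo_ne_top hρ0 hρ1 hα ht y) hf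
  rw [key]
  refine lintegral_congr fun y => ?_
  rw [lintegral_one_sub_apFactor hρ0 hρ1 hα ht, ← ENNReal.ofReal_mul hlam,
    expNeg_ofReal (by positivity), ← ENNReal.ofReal_mul hlam]

end Association


/-! ### Derivatives of `exp ∘ φ` in terms of multi-indices -/

section FaaDiBruno

/-- The tuples `(k₁, …, k_N)` of natural numbers with `∑ l * kₗ = m`. -/
def weightedTuples (N m : ℕ) : Finset (Fin N → ℕ) :=
  {k ∈ Fintype.piFinset fun _ : Fin N => Finset.range (m + 1) |
    ∑ l : Fin N, (l.val + 1) * k l = m}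

theorem mem_weightedTuples {N m : ℕ} {k : Fin N → ℕ} :
    k ∈ weightedTuples N m ↔ ∑ l : Fin N, (l.val + 1) * k l = m := by
  simp only [weightedTuples, Finset.mem_filter, Fintype.mem_piFinset, Finset.mem_range,
    and_iff_right_iff_imp]
  intro h l
  have h1 : (l.val + 1) * k l ≤ ∑ l : Fin N, (l.val + 1) * k l :=
    Finset.single_le_sum (f := fun l : Fin N => (l.val + 1) * k l)
      (fun _ _ => Nat.zero_le _) (Finset.mem_univ l)
  nlinarith

/-- The monomial `∏ l, x (l + 1) ^ k l / (k l)!`. -/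
noncomputable def dividedMonomial (x : ℕ → ℝ) {N : ℕ} (k : Fin N → ℕ) : ℝ :=
  ∏ l : Fin N, x (l.val + 1) ^ k l / ((k l).factorial : ℝ)

/-- The coefficient of `z ^ m` in `exp (∑ l ≤ N, x l * z ^ l)`. -/
noncomputable def expCoeff (x : ℕ → ℝ) (N m : ℕ) : ℝ :=
  ∑ k ∈ weightedTuples N m, dividedMonomial x k

theorem sum_weight_update {N : ℕ} (k : Fin N → ℕ) (l : Fin N) :
    ∑ i : Fin N, (i.val + 1) * Function.update k l (k l + 1) i =
      (∑ i : Fin N, (i.val + 1) * k i) + (l.val + 1) := by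
  rw [← Finset.add_sum_erase _ _ (Finset.mem_univ l),
    ← Finset.add_sum_erase (a := l) _ (fun i : Fin N => (i.val + 1) * k i) (Finset.mem_univ l)]
  have h : ∑ i ∈ Finset.univ.erase l, (i.val + 1) * Function.update k l (k l + 1) i =
      ∑ i ∈ Finset.univ.erase l, (i.val + 1) * k i :=
    Finset.sum_congr rfl fun i hi => by
      rw [Function.update_of_ne (Finset.ne_of_mem_erase hi)]
  rw [h, Function.update_self]
  ring

theorem dividedMonomial_update (x : ℕ → ℝ) {N : ℕ} (k : Fin N → ℕ) (l : Fin N) :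
    ((k l + 1 : ℕ) : ℝ) * dividedMonomial x (Function.update k l (k l + 1)) =
      x (l.val + 1) * dividedMonomial x k := by
  rw [dividedMonomial, dividedMonomial, ← Finset.mul_prod_erase _ _ (Finset.mem_univ l),
    ← Finset.mul_prod_erase (a := l) _ (fun i : Fin N => x (i.val + 1) ^ k i / ((k i).factorial : ℝ))
      (Finset.mem_univ l)]
  have h : ∏ i ∈ Finset.univ.erase l, x (i.val + 1) ^ Function.update k l (k l + 1) i /
        ((Function.update k l (k l + 1) i).factorial : ℝ) =
      ∏ i ∈ Finset.univ.erase l, x (i.val + 1) ^ k i / ((k i).factorial : ℝ) :=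
    Finset.prod_congr rfl fun i hi => by
      rw [Function.update_of_ne (Finset.ne_of_mem_erase hi)]
  rw [h, Function.update_self, Nat.factorial_succ]
  have h1 : ((k l).factorial : ℝ) ≠ 0 := by positivity
  have h2 : ((k l + 1 : ℕ) : ℝ) ≠ 0 := by positivity
  push_cast at h2 ⊢
  field_simp
  ring

/-- Raising the entry at `l` by one is a bijection from the tuples of weight `m - (l + 1)` onto
those of weight `m` whose entry at `l` is not zero. The factor `k l` cancels against the factorial
and leaves one factor `x (l + 1)`. -/
theorem sum_mul_dividedMonomial (x : ℕ → ℝ) {N m : ℕ} (l : Fin N) :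
    ∑ k ∈ weightedTuples N m, (k l : ℝ) * dividedMonomial x k =
      if l.val + 1 ≤ m then x (l.val + 1) * expCoeff x N (m - (l.val + 1)) else 0 := by
  split_ifs with hl
  · have h0 : ∑ k ∈ weightedTuples N m, (k l : ℝ) * dividedMonomial x k =
        ∑ k ∈ weightedTuples N m with k l ≠ 0, (k l : ℝ) * dividedMonomial x k := by
      rw [Finset.sum_filter_of_ne]
      intro k _ hk h
      exact hk (by simp [h])
    rw [h0, expCoeff, Finset.mul_sum]
    symm
    refine Finset.sum_bij' (fun k _ => Function.update k l (k l + 1))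
      (fun k _ => Function.update k l (k l - 1)) ?_ ?_ ?_ ?_ ?_
    · intro k hk
      rw [mem_weightedTuples] at hk
      rw [Finset.mem_filter, mem_weightedTuples, sum_weight_update, hk, Function.update_self]
      exact ⟨by omega, by omega⟩
    · intro k hk
      rw [Finset.mem_filter, mem_weightedTuples] at hk
      rw [mem_weightedTuples]
      have h1 := sum_weight_update (Function.update k l (k l - 1)) l
      rw [Function.update_self, Function.update_idem, Nat.sub_add_cancel (by omega),
        Function.update_eq_self, hk.1] at h1
      omega
    · intro k _
      simp
    · intro k hk
      rw [Finset.mem_filter] at hk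
      rw [Function.update_self, Function.update_idem, Nat.sub_add_cancel (by omega),
        Function.update_eq_self]
    · intro k _
      rw [Function.update_self, dividedMonomial_update]
  · refine Finset.sum_eq_zero fun k hk => ?_
    rw [mem_weightedTuples] at hk
    have h1 : (l.val + 1) * k l ≤ ∑ l : Fin N, (l.val + 1) * k l :=
      Finset.single_le_sum (f := fun l : Fin N => (l.val + 1) * k l)
        (fun _ _ => Nat.zero_le _) (Finset.mem_univ l)
    have h2 : k l = 0 := by
      by_contra h
      have : 1 ≤ k l := Nat.one_le_iff_ne_zero.2 h
      nlinarith
    simp [h2]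

/-- The identity `(exp X)' = X' exp X` on coefficients, obtained by writing `m` as the weight `∑ l
k_l` of each tuple. The length `N` is kept apart from `m` so that lower coefficients use tuples of
the same length. -/
theorem mul_expCoeff (x : ℕ → ℝ) {N m : ℕ} (hm : m ≤ N) :
    (m : ℝ) * expCoeff x N m =
      ∑ l ∈ Finset.range m, ((l : ℝ) + 1) * x (l + 1) * expCoeff x N (m - (l + 1)) := by
  have h1 : (m : ℝ) * expCoeff x N m =
      ∑ l : Fin N, ((l.val : ℝ) + 1) * ∑ k ∈ weightedTuples N m, (k l : ℝ) * dividedMonomial x k := by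
    simp only [Finset.mul_sum]
    rw [Finset.sum_comm, expCoeff, Finset.mul_sum]
    refine Finset.sum_congr rfl fun k hk => ?_
    simp only [← mul_assoc]
    rw [← Finset.sum_mul]
    congr 1
    rw [mem_weightedTuples] at hk
    conv_lhs => rw [← hk]
    push_cast
    rfl
  rw [h1]
  simp only [sum_mul_dividedMonomial]
  rw [Fin.sum_univ_eq_sum_range (fun l => ((l : ℝ) + 1) *
    if l + 1 ≤ m then x (l + 1) * expCoeff x N (m - (l + 1)) else 0) N]
  rw [← Finset.sum_subset (Finset.range_subset_range.2 hm)]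
  · refine Finset.sum_congr rfl fun l hl => ?_
    rw [if_pos (show l + 1 ≤ m from Finset.mem_range.1 hl), mul_assoc]
  · intro l _ hl
    rw [if_neg (by simpa using hl), mul_zero]

theorem expCoeff_zero (x : ℕ → ℝ) (N : ℕ) : expCoeff x N 0 = 1 := by
  have h : weightedTuples N 0 = {0} := by
    ext k
    rw [mem_weightedTuples, Finset.mem_singleton, Finset.sum_eq_zero_iff]
    constructor
    · intro h
      funext l
      simpa using h l (Finset.mem_univ l)
    · rintro rfl l _
      simp
  rw [expCoeff, h, Finset.sum_singleton, dividedMonomial]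
  simp

/-- A sequence that satisfies the recurrence of the coefficients of the exponential of a power
series is given by these coefficients. -/
theorem eq_expCoeff_of_recurrence {x b : ℕ → ℝ} (h0 : b 0 = 1)
    (h : ∀ m : ℕ, ((m : ℝ) + 1) * b (m + 1) =
      ∑ l ∈ Finset.range (m + 1), ((l : ℝ) + 1) * x (l + 1) * b (m - l)) (m : ℕ) :
    ∀ N, m ≤ N → b m = expCoeff x N m := by
  induction m using Nat.strong_induction_on with
  | _ m ih =>
    intro N hN
    cases m with
    | zero => rw [h0, expCoeff_zero]
    | succ m =>
      have h1 := mul_expCoeff x hN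
      have h2 : ((m : ℝ) + 1) ≠ 0 := by positivity
      refine mul_left_cancel₀ h2 ?_
      rw [h, ← Nat.cast_succ, h1]
      refine Finset.sum_congr rfl fun l hl => ?_
      rw [Nat.add_sub_add_right, ih (m - l) (by omega) N (by omega)]

theorem multiIndices_eq_weightedTuples (m : ℕ) : multiIndices m = weightedTuples m m := rfl

/-- Faà di Bruno's formula for the exponential. With `f = exp ∘ φ`, Leibniz's rule applied to `f' =
φ' f` says that the ratios `f^(m) / (m! f)` satisfy the recurrence that characterises `expCoeff`. -/
theorem iteratedDeriv_exp_comp {φ : ℝ → ℝ} {s : ℝ} (hφ : ∀ n : ℕ, ContDiffAt ℝ n φ s) (m : ℕ) :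
    iteratedDeriv m (fun t => Real.exp (φ t)) s = m.factorial * Real.exp (φ s) *
      ∑ k ∈ multiIndices m, dividedMonomial (fun l => iteratedDeriv l φ s / (l.factorial : ℝ)) k := by
  set x : ℕ → ℝ := fun l => iteratedDeriv l φ s / (l.factorial : ℝ) with hx
  set f : ℝ → ℝ := fun t => Real.exp (φ t) with hf
  have hfs : f s ≠ 0 := (Real.exp_pos _).ne'
  have hfC : ∀ n : ℕ, ContDiffAt ℝ n f s := fun n => (hφ n).exp
  have hderiv : deriv f =ᶠ[nhds s] fun t => deriv φ t * f t := by
    filter_upwards [((hφ 1).eventually (by simp))] with t ht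
    have := (ht.differentiableAt (by simp)).hasDerivAt.exp.deriv
    rw [hf, this, mul_comm]
  have hdφ : ∀ n : ℕ, ContDiffAt ℝ n (deriv φ) s := fun n =>
    (hφ (n + 1)).derivWithin (by norm_cast)
  have hrec : ∀ m : ℕ, iteratedDeriv (m + 1) f s = ∑ j ∈ Finset.range (m + 1),
      (m.choose j : ℝ) * iteratedDeriv (j + 1) φ s * iteratedDeriv (m - j) f s := by
    intro m
    rw [iteratedDeriv_succ', hderiv.iteratedDeriv_eq, iteratedDeriv_fun_mul (hdφ m) (hfC m)]
    simp only [iteratedDeriv_succ']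
  have key := eq_expCoeff_of_recurrence (x := x)
    (b := fun m => iteratedDeriv m f s / (m.factorial * f s)) ?_ ?_ m m le_rfl
  · rw [multiIndices_eq_weightedTuples]
    have h1 : iteratedDeriv m f s = m.factorial * f s * expCoeff x m m := by
      rw [← key]
      field_simp
    exact h1
  · simp [iteratedDeriv_zero, hfs]
  · intro m
    rw [hrec, Finset.sum_div, Finset.mul_sum]
    refine Finset.sum_congr rfl fun j hj => ?_
    have hjm : j ≤ m := Nat.lt_succ_iff.1 (Finset.mem_range.1 hj)
    simp only [hx]
    rw [Nat.cast_choose ℝ hjm, Nat.factorial_succ, Nat.factorial_succ]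
    push_cast
    field_simp

end FaaDiBruno


/-! ### The closed form -/

section LaplaceExponent

open Filter Topology

/-- Logarithm of the Laplace transform of interference plus noise. -/
noncomputable def laplaceExponent (Λ β c s : ℝ) : ℝ := -Λ * s ^ β - c * s

theorem contDiffAt_laplaceExponent {Λ β c s : ℝ} (hs : 0 < s) (n : ℕ) :
    ContDiffAt ℝ n (laplaceExponent Λ β c) s := by
  unfold laplaceExponent
  exact (contDiffAt_const.mul (Real.contDiffAt_rpow_const_of_ne hs.ne')).sub
    (contDiffAt_const.mul contDiffAt_id)

theorem iteratedDeriv_laplaceExponent {Λ β c : ℝ} (l : ℕ) : ∀ {s : ℝ}, 0 < s →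
    iteratedDeriv l (laplaceExponent Λ β c) s =
      -Λ * (∏ j ∈ Finset.range l, (β - (j : ℝ))) * s ^ (β - l) -
        c * (if l = 0 then s else if l = 1 then 1 else 0) := by
  induction l with
  | zero =>
    intro s hs
    simp [laplaceExponent]
  | succ l ih =>
    intro s hs
    have hev : iteratedDeriv l (laplaceExponent Λ β c) =ᶠ[𝓝 s] fun s =>
        -Λ * (∏ j ∈ Finset.range l, (β - (j : ℝ))) * s ^ (β - l) -
          c * (if l = 0 then s else if l = 1 then 1 else 0) := by
      filter_upwards [lt_mem_nhds hs] with u hu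
      exact ih hu
    rw [iteratedDeriv_succ, hev.deriv_eq]
    have h1 : HasDerivAt (fun s : ℝ => s ^ (β - l)) ((β - l) * s ^ (β - l - 1)) s :=
      Real.hasDerivAt_rpow_const (Or.inl hs.ne')
    have h2 : HasDerivAt (fun s : ℝ => if l = 0 then s else if l = 1 then (1 : ℝ) else 0)
        (if l + 1 = 0 then s else if l + 1 = 1 then 1 else 0) s := by
      rcases l with _ | _ | l
      · simpa using hasDerivAt_id' s
      · simpa using hasDerivAt_const s (1 : ℝ)
      · simpa using hasDerivAt_const s (0 : ℝ)
    refine (((h1.const_mul _).sub (h2.const_mul c)).deriv).trans ?_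
    rw [Finset.prod_range_succ]
    push_cast
    rw [sub_sub β]
    ring

end LaplaceExponent

/-! ### Moments of the interference from its Laplace transform. -/

section Moments

open Filter Topology

variable {ν : Measure ℝ≥0∞} [IsProbabilityMeasure ν] {Λ β : ℝ}

/-- For `s > 0` the integrand vanishes at `∞`, so the transform is at most the mass of the finite
values, and it tends to `1` as `s → 0`. -/
theorem ae_ne_top_of_laplace (hβ : 0 < β)
    (hν : ∀ s : ℝ, 0 ≤ s → ∫⁻ x, expNeg (ENNReal.ofReal s * x) ∂ν =
      ENNReal.ofReal (Real.exp (-Λ * s ^ β))) : ∀ᵐ x ∂ν, x ≠ ∞ := by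
  have hm : MeasurableSet ({∞}ᶜ : Set ℝ≥0∞) := (measurableSet_singleton _).compl
  have hle : ∀ s : ℝ, 0 < s → ENNReal.ofReal (Real.exp (-Λ * s ^ β)) ≤ ν {∞}ᶜ := by
    intro s hs
    rw [← hν s hs.le, ← lintegral_indicator_one hm]
    refine lintegral_mono fun x => ?_
    by_cases hx : x = ∞
    · simp [hx, ENNReal.mul_top (ENNReal.ofReal_pos.2 hs).ne']
    · rw [Set.indicator_of_mem (by simpa using hx)]
      exact expNeg_le_one _
  have hlim : Tendsto (fun s : ℝ => ENNReal.ofReal (Real.exp (-Λ * s ^ β))) (𝓝[>] 0) (𝓝 1) := by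
    have h1 : Tendsto (fun s : ℝ => ENNReal.ofReal (Real.exp (-Λ * s ^ β))) (𝓝 0)
        (𝓝 (ENNReal.ofReal (Real.exp (-Λ * 0 ^ β)))) := by
      refine (ENNReal.continuous_ofReal.tendsto _).comp ((Real.continuous_exp.tendsto _).comp ?_)
      exact ((Real.continuousAt_rpow_const 0 β (Or.inr hβ.le)).tendsto).const_mul _
    rw [Real.zero_rpow hβ.ne', mul_zero, Real.exp_zero, ENNReal.ofReal_one] at h1
    exact h1.mono_left nhdsWithin_le_nhds
  have h1 : 1 ≤ ν {∞}ᶜ := le_of_tendsto hlim (eventually_nhdsWithin_of_forall hle)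
  exact (prob_compl_eq_zero_iff hm).2 (le_antisymm prob_le_one h1)

-- The mass at `0` is at most the transform at every `s`, which tends to `0` as `s → ∞`. Without
-- noise this is what excludes a division by zero in the SINR.
omit [IsProbabilityMeasure ν] in
theorem ae_ne_zero_of_laplace (hΛ : 0 < Λ) (hβ : 0 < β)
    (hν : ∀ s : ℝ, 0 ≤ s → ∫⁻ x, expNeg (ENNReal.ofReal s * x) ∂ν =
      ENNReal.ofReal (Real.exp (-Λ * s ^ β))) : ∀ᵐ x ∂ν, x ≠ 0 := by
  have hm : MeasurableSet ({0} : Set ℝ≥0∞) := measurableSet_singleton _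
  have hle : ∀ s : ℝ, 0 ≤ s → ν {0} ≤ ENNReal.ofReal (Real.exp (-Λ * s ^ β)) := by
    intro s hs
    rw [← hν s hs, ← lintegral_indicator_one hm]
    refine lintegral_mono fun x => ?_
    by_cases hx : x = 0
    · simp [hx]
    · rw [Set.indicator_of_notMem (by simpa using hx)]
      exact zero_le
  have hlim : Tendsto (fun s : ℝ => ENNReal.ofReal (Real.exp (-Λ * s ^ β))) atTop (𝓝 0) := by
    rw [← ENNReal.ofReal_zero]
    refine (ENNReal.continuous_ofReal.tendsto _).comp (Real.tendsto_exp_atBot.comp ?_)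
    exact (tendsto_rpow_atTop hβ).const_mul_atTop_of_neg (neg_neg_of_pos hΛ)
  have h1 : ν {0} ≤ 0 := ge_of_tendsto hlim ((eventually_ge_atTop 0).mono hle)
  exact measure_eq_zero_iff_ae_notMem.1 (le_antisymm h1 zero_le)

theorem mgf_interference (hβ : 0 < β)
    (hν : ∀ s : ℝ, 0 ≤ s → ∫⁻ x, expNeg (ENNReal.ofReal s * x) ∂ν =
      ENNReal.ofReal (Real.exp (-Λ * s ^ β))) {c s : ℝ} (hs : 0 ≤ s) :
    mgf (fun x : ℝ≥0∞ => -(x.toReal + c)) ν s = Real.exp (laplaceExponent Λ β c s) := by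
  have h1 : ∀ᵐ x ∂ν, Real.exp (s * -(x.toReal + c)) =
      Real.exp (-(c * s)) * (expNeg (ENNReal.ofReal s * x)).toReal := by
    filter_upwards [ae_ne_top_of_laplace hβ hν] with x hx
    rw [expNeg_of_ne_top (ENNReal.mul_ne_top ENNReal.ofReal_ne_top hx),
      ENNReal.toReal_ofReal (Real.exp_pos _).le, ENNReal.toReal_mul, ENNReal.toReal_ofReal hs,
      ← Real.exp_add]
    congr 1
    ring
  rw [mgf, integral_congr_ae h1, integral_const_mul, integral_toReal (by fun_prop)
    (ae_of_all _ fun x => (expNeg_ne_top _).lt_top), hν s hs,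
    ENNReal.toReal_ofReal (Real.exp_pos _).le, ← Real.exp_add, laplaceExponent]
  congr 1
  ring

/-- The variable is nonpositive, so its exponential moments of positive order are bounded by `1`,
and the moment generating function may be differentiated under the integral at every `s > 0`. -/
theorem mem_interior_integrableExpSet {c s : ℝ} (hc : 0 ≤ c) (hs : 0 < s) :
    s ∈ interior (integrableExpSet (fun x : ℝ≥0∞ => -(x.toReal + c)) ν) := by
  refine mem_interior_iff_mem_nhds.2 (Filter.mem_of_superset (Ioi_mem_nhds hs) fun u hu => ?_)
  have hu0 : 0 < u := hu
  refine Integrable.of_bound (Measurable.aestronglyMeasurable (by fun_prop)) 1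
    (ae_of_all _ fun x => ?_)
  rw [Real.norm_of_nonneg (Real.exp_pos _).le, Real.exp_le_one_iff]
  have : 0 ≤ x.toReal := ENNReal.toReal_nonneg
  nlinarith

/-- The mean of the Erlang tail at `s` times interference plus noise. -/
noncomputable def meanErlangTail (Λ β c : ℝ) (M : ℕ) (s : ℝ) : ℝ :=
  ∑ m ∈ Finset.range M, (-s) ^ m * (Real.exp (laplaceExponent Λ β c s) *
    ∑ k ∈ multiIndices m, dividedMonomial
      (fun l => iteratedDeriv l (laplaceExponent Λ β c) s / (l.factorial : ℝ)) k)

/-- With `X = -(I + c)`, the terms of the Erlang tail at `-s X` are multiples of `X^m exp(s X)`.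
Their means are derivatives of the moment generating function, which equals `exp ∘ laplaceExponent`
near `s`, so Faà di Bruno's formula applies. Nonnegativity is inherited from the integrand and is
needed to leave `[0, ∞]`. -/
theorem lintegral_erlangTail (hβ : 0 < β)
    (hν : ∀ s : ℝ, 0 ≤ s → ∫⁻ x, expNeg (ENNReal.ofReal s * x) ∂ν =
      ENNReal.ofReal (Real.exp (-Λ * s ^ β))) {c s : ℝ} (hc : 0 ≤ c) (hs : 0 < s) (M : ℕ) :
    0 ≤ meanErlangTail Λ β c M s ∧
    ∫⁻ x, ENNReal.ofReal (erlangTail M (s * (x.toReal + c))) ∂ν =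
      ENNReal.ofReal (meanErlangTail Λ β c M s) := by
  set X : ℝ≥0∞ → ℝ := fun x => -(x.toReal + c) with hX
  have hmem : s ∈ interior (integrableExpSet X ν) := mem_interior_integrableExpSet hc hs
  have hint : ∀ m : ℕ, Integrable (fun x => X x ^ m * Real.exp (s * X x)) ν := fun m =>
    integrable_pow_mul_exp_of_mem_interior_integrableExpSet hmem m
  have hval : ∀ m : ℕ, ∫ x, X x ^ m * Real.exp (s * X x) ∂ν =
      m.factorial * Real.exp (laplaceExponent Λ β c s) * ∑ k ∈ multiIndices m, dividedMonomial
        (fun l => iteratedDeriv l (laplaceExponent Λ β c) s / (l.factorial : ℝ)) k := by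
    intro m
    rw [← iteratedDeriv_exp_comp (contDiffAt_laplaceExponent hs) m, ← iteratedDeriv_mgf hmem m]
    refine EventuallyEq.iteratedDeriv_eq m ?_
    filter_upwards [lt_mem_nhds hs] with u hu
    exact mgf_interference hβ hν (le_of_lt hu)
  have hpt : ∀ x : ℝ≥0∞, erlangTail M (s * (x.toReal + c)) =
      ∑ m ∈ Finset.range M, (-s) ^ m / (m.factorial : ℝ) * (X x ^ m * Real.exp (s * X x)) := by
    intro x
    refine Finset.sum_congr rfl fun m _ => ?_
    have h1 : s * (x.toReal + c) = -s * X x := by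
      rw [hX]
      ring
    rw [h1, mul_pow]
    have h2 : -(-s * X x) = s * X x := by ring
    rw [h2]
    ring
  have htot : ∫ x, erlangTail M (s * (x.toReal + c)) ∂ν = meanErlangTail Λ β c M s := by
    simp only [hpt]
    rw [integral_finsetSum _ fun m _ => (hint m).const_mul _]
    refine Finset.sum_congr rfl fun m _ => ?_
    rw [integral_const_mul, hval]
    have : (m.factorial : ℝ) ≠ 0 := by positivity
    field_simp
  have hnn : ∀ x : ℝ≥0∞, 0 ≤ erlangTail M (s * (x.toReal + c)) := by
    intro x
    have : 0 ≤ s * (x.toReal + c) := by positivity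
    exact Finset.sum_nonneg fun m _ => by positivity
  refine ⟨htot ▸ integral_nonneg hnn, ?_⟩
  rw [← htot, ofReal_integral_eq_lintegral_ofReal _ (ae_of_all _ hnn)]
  simp only [hpt]
  exact integrable_finsetSum _ fun m _ => (hint m).const_mul _

end Moments

/-! ### The integrands of the closed form: identification and integrability. -/

section ClosedForm

open Filter Topology Asymptotics

variable {P : Params}

/-- A bracket is a derivative of the Laplace exponent at `s = γ r^α`, up to a power of `γ`. That
power joins the factor `r^(α m)` to form `s^m`, because the tuples have weight `m`. -/
theorem bracket_succ (P : Params) {γ r : ℝ} (hγ : 0 < γ) (hr : 0 < r) (hα : 0 < P.alpha) (l : ℕ) :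
    P.bracket γ r (l + 1) = γ ^ (l + 1) * iteratedDeriv (l + 1)
      (laplaceExponent P.Lam1 (2 / P.alpha) (P.noise / P.powS)) (γ * r ^ P.alpha) := by
  have hs : 0 < γ * r ^ P.alpha := by positivity
  have hpow : γ ^ (l + 1) * (γ * r ^ P.alpha) ^ (2 / P.alpha - ((l + 1 : ℕ) : ℝ)) =
      γ ^ (2 / P.alpha) * r ^ (2 - ((l + 1 : ℕ) : ℝ) * P.alpha) := by
    rw [Real.mul_rpow hγ.le (by positivity), ← Real.rpow_mul hr.le, Real.rpow_sub hγ,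
      Real.rpow_natCast, ← mul_assoc, mul_div_cancel₀ _ (by positivity)]
    congr 2
    field_simp
  rw [iteratedDeriv_laplaceExponent _ hs, Params.bracket]
  rcases l with _ | l
  · simp only [zero_add, pow_one, Nat.cast_one, one_mul, if_true, one_ne_zero, if_false,
      Finset.prod_range_one, Nat.cast_zero, sub_zero, mul_one] at hpow ⊢
    rw [mul_sub, mul_left_comm, hpow]
    ring
  · rw [if_neg (by omega), if_neg (by omega), if_neg (by omega), mul_zero, sub_zero,
      mul_left_comm, hpow]
    ring

theorem mainIntegrand_eq (P : Params) {γ r : ℝ} (hγ : 0 < γ) (hr : 0 < r) (hα : 0 < P.alpha) :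
    P.mainIntegrand γ r = r * Real.exp (-(Real.pi * (P.lamAp * (1 - P.rhoAp)) * r ^ 2)) *
      Real.exp (laplaceExponent P.Lam1 (2 / P.alpha) (P.noise / P.powS) (γ * r ^ P.alpha)) := by
  have hpow : (γ * r ^ P.alpha) ^ (2 / P.alpha) = γ ^ (2 / P.alpha) * r ^ 2 := by
    rw [Real.mul_rpow hγ.le (by positivity), ← Real.rpow_mul hr.le,
      mul_div_cancel₀ _ hα.ne', Real.rpow_two]
  rw [Params.mainIntegrand, mul_assoc r (Real.exp _), ← Real.exp_add, laplaceExponent, hpow]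
  congr 2
  ring

theorem corrIntegrand_eq (P : Params) {γ r : ℝ} (hγ : 0 < γ) (hr : 0 < r) (hα : 0 < P.alpha) {m : ℕ}
    {k : Fin m → ℕ} (hk : k ∈ multiIndices m) :
    (1 / ∏ l : Fin m, ((k l).factorial : ℝ) * ((l.val + 1).factorial : ℝ) ^ k l) *
      P.corrIntegrand γ k r = (γ * r ^ P.alpha) ^ m * (P.mainIntegrand γ r * dividedMonomial
        (fun l => iteratedDeriv l (laplaceExponent P.Lam1 (2 / P.alpha) (P.noise / P.powS))
          (γ * r ^ P.alpha) / (l.factorial : ℝ)) k) := by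
  have hγm : γ ^ m = ∏ l : Fin m, (γ ^ (l.val + 1)) ^ k l := by
    simp only [← pow_mul]
    rw [Finset.prod_pow_eq_pow_sum]
    congr 1
    exact (mem_multiIndices.1 hk).symm
  rw [Params.corrIntegrand, dividedMonomial, mul_pow, hγm]
  simp only [bracket_succ P hγ hr hα, mul_pow, div_pow]
  rw [Finset.prod_mul_distrib, Finset.prod_mul_distrib, Finset.prod_div_distrib,
    Finset.prod_div_distrib]
  have h1 : (∏ l : Fin m, ((k l).factorial : ℝ)) ≠ 0 :=
    Finset.prod_ne_zero_iff.2 fun l _ => by positivity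
  have h2 : (∏ l : Fin m, ((l.val + 1).factorial : ℝ) ^ k l) ≠ 0 :=
    Finset.prod_ne_zero_iff.2 fun l _ => by positivity
  field_simp

theorem isBigO_rpow_exp (a : ℝ) : (fun r : ℝ => r ^ a) =O[atTop] fun r => Real.exp r := by
  simpa using (isLittleO_rpow_exp_pos_mul_atTop a one_pos).isBigO

/-- Each factor `A r² + A' r^α` is `O(exp r)`, so the product is `O(exp(K r))` with `K = ∑ k l`, and
the Gaussian factor beats this. -/
theorem integrableOn_mul_gaussian_mul_prod {α b : ℝ} (hα : 0 < α) (hb : 0 < b) {E : ℝ → ℝ}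
    (hE : Continuous E) (hE0 : ∀ r, 0 ≤ r → 0 ≤ E r) (hE1 : ∀ r, 0 ≤ r → E r ≤ 1) {m : ℕ}
    (A A' : Fin m → ℝ) (k : Fin m → ℕ) :
    IntegrableOn (fun r => r * (E r * Real.exp (-b * r ^ 2)) *
      ∏ l, (A l * r ^ 2 + A' l * r ^ α) ^ k l) (Set.Ioi 0) := by
  have hrα : Continuous fun r : ℝ => r ^ α :=
    Real.continuous_rpow_const hα.le
  refine integrable_of_isBigO_exp_neg one_pos (Continuous.continuousOn ?_) ?_
  · exact (continuous_id.mul (hE.mul (by fun_prop))).mul (continuous_finsetProd _ fun l _ =>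
      ((continuous_const.mul (by fun_prop)).add (continuous_const.mul hrα)).pow _)
  · set K := ∑ l, k l with hK
    have h1 : (fun r : ℝ => ∏ l, (A l * r ^ 2 + A' l * r ^ α) ^ k l) =O[atTop]
        fun r => Real.exp r ^ K := by
      have : ∀ r : ℝ, Real.exp r ^ K = ∏ l : Fin m, Real.exp r ^ k l := fun r => by
        rw [Finset.prod_pow_eq_pow_sum]
      simp only [this]
      refine IsBigO.finsetProd fun l _ => IsBigO.pow ?_ _
      refine IsBigO.add (IsBigO.const_mul_left ?_ _) ((isBigO_rpow_exp α).const_mul_left _)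
      simpa only [Real.rpow_two] using isBigO_rpow_exp 2
    have h2 : (fun r : ℝ => r) =O[atTop] fun r => Real.exp r := by
      simpa only [Real.rpow_one] using isBigO_rpow_exp 1
    have h3 : E =O[atTop] fun _ => (1 : ℝ) := by
      refine IsBigO.of_bound 1 ?_
      filter_upwards [eventually_ge_atTop 0] with r hr
      rw [Real.norm_of_nonneg (hE0 r hr)]
      simpa using hE1 r hr
    -- The rate `K + 2` pays for `K` from the product and `1` from the factor `r`, and leaves
    -- `exp(-r)`.
    have h4 : (fun r : ℝ => Real.exp (-b * r ^ 2)) =O[atTop]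
        fun r => Real.exp (-((K : ℝ) + 2) * r) := by
      refine IsBigO.of_bound 1 ?_
      filter_upwards [eventually_ge_atTop (0 : ℝ), eventually_ge_atTop (((K : ℝ) + 2) / b)]
        with r hr0 hr
      rw [Real.norm_of_nonneg (Real.exp_pos _).le, Real.norm_of_nonneg (Real.exp_pos _).le, one_mul,
        Real.exp_le_exp]
      rw [div_le_iff₀ hb] at hr
      nlinarith
    refine ((h2.mul (h3.mul h4)).mul h1).trans (IsBigO.of_bound 1 (Eventually.of_forall fun r => ?_))
    rw [one_mul, ← Real.exp_nat_mul, ← Real.exp_add, ← Real.exp_add]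
    simp only [Real.norm_eq_abs, Real.abs_exp]
    rw [one_mul, Real.exp_le_exp]
    linarith

/-- The brackets contain negative powers of `r`. Distributing `(r^α)^m` as `∏ ((r^α)^l)^(k_l)` turns
each of them into `A r² + A' r^α`, so there is no singularity at `0`. -/
theorem integrableOn_corrIntegrand (hlamAp : 0 < P.lamAp) (hrhoAp : P.rhoAp < 1)
    (halpha : 0 < P.alpha) (hpowS : 0 < P.powS) (hnoise : 0 ≤ P.noise) (hLam : 0 ≤ P.Lam1)
    {γ : ℝ} (hγ : 0 ≤ γ) {m : ℕ} {k : Fin m → ℕ} (hk : k ∈ multiIndices m) :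
    IntegrableOn (P.corrIntegrand γ k) (Set.Ioi 0) := by
  have hb : 0 < Real.pi * (P.lamAp * (1 - P.rhoAp)) :=
    mul_pos Real.pi_pos (mul_pos hlamAp (by linarith))
  have hrα : Continuous fun r : ℝ => r ^ P.alpha := Real.continuous_rpow_const halpha.le
  have hγβ : 0 ≤ γ ^ (2 / P.alpha) := Real.rpow_nonneg hγ _
  let E : ℝ → ℝ := fun r =>
    Real.exp (-P.Lam1 * γ ^ (2 / P.alpha) * r ^ 2 - γ * r ^ P.alpha * P.noise / P.powS)
  have hE : Continuous E := by
    refine Real.continuous_exp.comp (Continuous.sub (by fun_prop) ?_)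
    exact ((continuous_const.mul hrα).mul continuous_const).div_const _
  have hE1 : ∀ r, 0 ≤ r → E r ≤ 1 := by
    intro r hr
    rw [Real.exp_le_one_iff]
    have h1 : 0 ≤ P.Lam1 * γ ^ (2 / P.alpha) * r ^ 2 := by positivity
    have h2 : 0 ≤ γ * r ^ P.alpha * P.noise / P.powS := by positivity
    linarith
  let A : Fin m → ℝ := fun l => if l.val = 0 then -(2 / P.alpha) * P.Lam1 * γ ^ (2 / P.alpha) else
    -P.Lam1 * γ ^ (2 / P.alpha) * ∏ j ∈ Finset.range (l.val + 1), (2 / P.alpha - (j : ℝ))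
  let A' : Fin m → ℝ := fun l => if l.val = 0 then -(γ * P.noise / P.powS) else 0
  have hmain := integrableOn_mul_gaussian_mul_prod halpha hb hE (fun r _ => (Real.exp_pos _).le) hE1
    A A' k
  refine hmain.congr_fun (fun r hr => ?_) measurableSet_Ioi
  have hr0 : 0 < r := hr
  have h1 : ∀ l : Fin m, A l * r ^ 2 + A' l * r ^ P.alpha =
      (r ^ P.alpha) ^ (l.val + 1) * P.bracket γ r (l.val + 1) := by
    intro l
    have h2 : (r ^ P.alpha) ^ (l.val + 1) * r ^ (2 - ((l.val + 1 : ℕ) : ℝ) * P.alpha) = r ^ 2 := by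
      rw [← Real.rpow_mul_natCast hr0.le, ← Real.rpow_add hr0, ← Real.rpow_two]
      congr 1
      ring
    by_cases hl : l.val = 0
    · simp only [hl, zero_add, pow_one, Nat.cast_one, one_mul] at h2
      simp only [A, A', hl, if_true, zero_add, pow_one, Params.bracket]
      rw [mul_sub, mul_left_comm, h2]
      ring
    · simp only [A, A', hl, if_false, Params.bracket]
      rw [if_neg (by omega), mul_left_comm, h2, zero_mul, add_zero]
  have h3 : (r ^ P.alpha) ^ m = ∏ l : Fin m, ((r ^ P.alpha) ^ (l.val + 1)) ^ k l := by
    simp only [← pow_mul]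
    rw [Finset.prod_pow_eq_pow_sum]
    congr 1
    exact (mem_multiIndices.1 hk).symm
  simp only [h1, mul_pow]
  rw [Finset.prod_mul_distrib, ← h3, Params.corrIntegrand, Params.mainIntegrand, ← Real.exp_add]
  have h4 : -P.Lam1 * γ ^ (2 / P.alpha) * r ^ 2 - γ * r ^ P.alpha * P.noise / P.powS +
      -(Real.pi * (P.lamAp * (1 - P.rhoAp))) * r ^ 2 =
      -P.Lam1 * γ ^ (2 / P.alpha) * r ^ 2 - γ * r ^ P.alpha * P.noise / P.powS -
        Real.pi * P.lamAp * (1 - P.rhoAp) * r ^ 2 := by ring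
  rw [h4]
  ring

theorem corrIntegrand_zero (P : Params) (γ : ℝ) (k : Fin 0 → ℕ) :
    P.corrIntegrand γ k = P.mainIntegrand γ := by
  funext r
  simp [Params.corrIntegrand]

theorem zero_mem_multiIndices : (0 : Fin 0 → ℕ) ∈ multiIndices 0 := by
  simp [mem_multiIndices]

theorem integrableOn_mainIntegrand (hlamAp : 0 < P.lamAp) (hrhoAp : P.rhoAp < 1)
    (halpha : 0 < P.alpha) (hpowS : 0 < P.powS) (hnoise : 0 ≤ P.noise) (hLam : 0 ≤ P.Lam1)
    {γ : ℝ} (hγ : 0 ≤ γ) : IntegrableOn (P.mainIntegrand γ) (Set.Ioi 0) := by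
  rw [← corrIntegrand_zero P γ 0]
  exact integrableOn_corrIntegrand hlamAp hrhoAp halpha hpowS hnoise hLam hγ zero_mem_multiIndices

/-- The main term is the summand `m = 0`, whose only index is the empty tuple. -/
theorem closedForm_eq_sum_range (P : Params) {M : ℕ} (hM : 1 ≤ M) (γ : ℝ) :
    P.closedForm M γ = 1 - 2 * Real.pi * P.lamAp * (1 - P.rhoAp) *
      ∑ m ∈ Finset.range M, (1 / (-1 : ℝ) ^ m) * ∑ k ∈ multiIndices m,
        (1 / ∏ l : Fin m, ((k l).factorial : ℝ) * ((l.val + 1).factorial : ℝ) ^ k l) *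
          ∫ r in Set.Ioi (0 : ℝ), P.corrIntegrand γ k r := by
  obtain ⟨K, rfl⟩ : ∃ K, M = K + 1 := ⟨M - 1, by omega⟩
  have h0 : multiIndices 0 = {0} := by
    ext k
    simp [mem_multiIndices, Subsingleton.elim k 0]
  have h1 : ∀ f : ℕ → ℝ, ∑ m ∈ Finset.Icc 1 K, f m = ∑ m ∈ Finset.range K, f (m + 1) := by
    intro f
    have h2 : Finset.Icc 1 K = Finset.Ico 1 (K + 1) := by
      ext m
      simp only [Finset.mem_Icc, Finset.mem_Ico]
      omega
    rw [h2, Finset.sum_Ico_eq_sum_range, Nat.add_sub_cancel]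
    simp only [add_comm 1]
  rw [Params.closedForm, Finset.sum_range_succ', h0, Finset.sum_singleton, corrIntegrand_zero,
    Nat.add_sub_cancel, h1]
  simp only [Finset.univ_eq_empty, Finset.prod_empty, pow_zero, div_one, one_mul]
  ring

end ClosedForm


/-! ### The law of the service distance and the closed form as a plane integral. -/

section ServiceDistance

variable {P : Params}

/-- Density, with respect to Lebesgue measure on the plane, of the position of the serving access
point relative to its sensor, at distance `r`. -/
noncomputable def serviceDensity (P : Params) (r : ℝ) : ℝ :=
  P.lamAp * (1 - P.rhoAp) * Real.exp (-(P.lamAp * (1 - P.rhoAp) * (Real.pi * r ^ 2)))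

@[fun_prop]
theorem measurable_serviceDensity (P : Params) : Measurable (serviceDensity P) := by
  unfold serviceDensity
  fun_prop

theorem serviceDensity_nonneg (hlamAp : 0 ≤ P.lamAp) (hrhoAp : P.rhoAp ≤ 1) (r : ℝ) :
    0 ≤ serviceDensity P r :=
  mul_nonneg (mul_nonneg hlamAp (by linarith)) (Real.exp_pos _).le

theorem integral_serviceDensity (hlamAp : 0 < P.lamAp) (hrhoAp : P.rhoAp < 1) :
    ∫ z : Plane, serviceDensity P ‖z‖ = 1 := by
  have hb : 0 < P.lamAp * (1 - P.rhoAp) := mul_pos hlamAp (by linarith)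
  have h := GaussianFourier.integral_rexp_neg_mul_sq_norm (V := Plane) (mul_pos hb Real.pi_pos)
  simp only [serviceDensity, integral_const_mul]
  have h1 : ∀ z : Plane, -(P.lamAp * (1 - P.rhoAp) * (Real.pi * ‖z‖ ^ 2)) =
      -(P.lamAp * (1 - P.rhoAp) * Real.pi) * ‖z‖ ^ 2 := fun z => by ring
  simp only [h1, h]
  have h2 : (Module.finrank ℝ Plane : ℝ) / 2 = 1 := by simp
  have h3 : 1 - P.rhoAp ≠ 0 := by linarith
  rw [h2, Real.rpow_one]
  field_simp

theorem integrable_serviceDensity (hlamAp : 0 < P.lamAp) (hrhoAp : P.rhoAp < 1) :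
    Integrable fun z : Plane => serviceDensity P ‖z‖ :=
  -- A function that is not integrable would have integral `0` by convention, whereas the Gaussian
  -- integral is `1`.
  not_imp_comm.1 integral_undef (by rw [integral_serviceDensity hlamAp hrhoAp]; exact one_ne_zero)

theorem lintegral_serviceDensity (hlamAp : 0 < P.lamAp) (hrhoAp : P.rhoAp < 1) :
    ∫⁻ z : Plane, ENNReal.ofReal (serviceDensity P ‖z‖) = 1 := by
  rw [← ofReal_integral_eq_lintegral_ofReal (integrable_serviceDensity hlamAp hrhoAp)
    (ae_of_all _ fun z => serviceDensity_nonneg hlamAp.le hrhoAp.le _),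
    integral_serviceDensity hlamAp hrhoAp, ENNReal.ofReal_one]

theorem sum_corrIntegrand_eq (P : Params) {γ r : ℝ} (hγ : 0 < γ) (hr : 0 < r) (hα : 0 < P.alpha)
    (M : ℕ) :
    P.lamAp * (1 - P.rhoAp) * ∑ m ∈ Finset.range M, (1 / (-1 : ℝ) ^ m) * ∑ k ∈ multiIndices m,
      (1 / ∏ l : Fin m, ((k l).factorial : ℝ) * ((l.val + 1).factorial : ℝ) ^ k l) *
        P.corrIntegrand γ k r =
      r * (serviceDensity P r *
        meanErlangTail P.Lam1 (2 / P.alpha) (P.noise / P.powS) M (γ * r ^ P.alpha)) := by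
  have h1 : ∀ m ∈ Finset.range M, (1 / (-1 : ℝ) ^ m) * ∑ k ∈ multiIndices m,
      (1 / ∏ l : Fin m, ((k l).factorial : ℝ) * ((l.val + 1).factorial : ℝ) ^ k l) *
        P.corrIntegrand γ k r = r * Real.exp (-(Real.pi * (P.lamAp * (1 - P.rhoAp)) * r ^ 2)) *
      ((-(γ * r ^ P.alpha)) ^ m * (Real.exp (laplaceExponent P.Lam1 (2 / P.alpha)
        (P.noise / P.powS) (γ * r ^ P.alpha)) * ∑ k ∈ multiIndices m, dividedMonomial
          (fun l => iteratedDeriv l (laplaceExponent P.Lam1 (2 / P.alpha) (P.noise / P.powS))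
            (γ * r ^ P.alpha) / (l.factorial : ℝ)) k)) := by
    intro m _
    rw [Finset.sum_congr rfl fun k hk => corrIntegrand_eq P hγ hr hα hk, ← Finset.mul_sum,
      ← Finset.mul_sum, mainIntegrand_eq P hγ hr hα, neg_pow (γ * r ^ P.alpha), ← one_div_pow]
    norm_num
    ring
  rw [Finset.sum_congr rfl h1, ← Finset.mul_sum, serviceDensity, meanErlangTail]
  have h2 : -(P.lamAp * (1 - P.rhoAp) * (Real.pi * r ^ 2)) =
    -(Real.pi * (P.lamAp * (1 - P.rhoAp)) * r ^ 2) := by ring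
  rw [h2]
  ring

theorem integrableOn_serviceDensity_mul_meanErlangTail (hlamAp : 0 < P.lamAp) (hrhoAp : P.rhoAp < 1)
    (halpha : 0 < P.alpha) (hpowS : 0 < P.powS) (hnoise : 0 ≤ P.noise) (hLam : 0 ≤ P.Lam1)
    {γ : ℝ} (hγ : 0 < γ) (M : ℕ) :
    IntegrableOn (fun r => r * (serviceDensity P r *
      meanErlangTail P.Lam1 (2 / P.alpha) (P.noise / P.powS) M (γ * r ^ P.alpha)))
      (Set.Ioi 0) := by
  refine IntegrableOn.congr_fun (Integrable.const_mul (integrable_finsetSum _ fun m _ =>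
    (integrable_finsetSum _ fun k hk => (integrableOn_corrIntegrand hlamAp hrhoAp halpha hpowS hnoise
      hLam hγ.le hk).const_mul _).const_mul _) _)
    (fun r hr => sum_corrIntegrand_eq P hγ hr halpha M) measurableSet_Ioi

theorem closedForm_eq_one_sub_integral (hlamAp : 0 < P.lamAp) (hrhoAp : P.rhoAp < 1)
    (halpha : 0 < P.alpha) (hpowS : 0 < P.powS) (hnoise : 0 ≤ P.noise) (hLam : 0 ≤ P.Lam1)
    {γ : ℝ} (hγ : 0 < γ) {M : ℕ} (hM : 1 ≤ M) :
    P.closedForm M γ = 1 - ∫ z : Plane, serviceDensity P ‖z‖ *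
      meanErlangTail P.Lam1 (2 / P.alpha) (P.noise / P.powS) M (γ * ‖z‖ ^ P.alpha) := by
  have hint : ∀ m, ∀ k ∈ multiIndices m, Integrable (P.corrIntegrand γ k)
      (volume.restrict (Set.Ioi 0)) := fun m k hk =>
    integrableOn_corrIntegrand hlamAp hrhoAp halpha hpowS hnoise hLam hγ.le hk
  have hsum : ∫ r in Set.Ioi (0 : ℝ), r * (serviceDensity P r *
      meanErlangTail P.Lam1 (2 / P.alpha) (P.noise / P.powS) M (γ * r ^ P.alpha)) =
      P.lamAp * (1 - P.rhoAp) *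
      ∑ m ∈ Finset.range M, (1 / (-1 : ℝ) ^ m) * ∑ k ∈ multiIndices m,
        (1 / ∏ l : Fin m, ((k l).factorial : ℝ) * ((l.val + 1).factorial : ℝ) ^ k l) *
          ∫ r in Set.Ioi (0 : ℝ), P.corrIntegrand γ k r := by
    rw [← setIntegral_congr_fun measurableSet_Ioi
      fun r hr => sum_corrIntegrand_eq P hγ hr halpha M, integral_const_mul,
      integral_finsetSum _ fun m _ => (integrable_finsetSum _ fun k hk =>
        (hint m k hk).const_mul _).const_mul _]
    refine congrArg _ (Finset.sum_congr rfl fun m _ => ?_)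
    rw [integral_const_mul, integral_finsetSum _ fun k hk => (hint m k hk).const_mul _]
    simp only [integral_const_mul]
  rw [closedForm_eq_sum_range P hM, integral_plane_norm fun r => serviceDensity P r *
      meanErlangTail P.Lam1 (2 / P.alpha) (P.noise / P.powS) M (γ * r ^ P.alpha), hsum]
  ring

/-- At `γ = 0` the point `s = γ r^α` leaves the range where the Laplace exponent is differentiated,
so this value is computed directly. All brackets vanish, every tuple of weight `m ≥ 1` has a nonzero
entry, and the main term is the total mass of the service distance. -/
theorem closedForm_zero (hlamAp : 0 < P.lamAp) (hrhoAp : P.rhoAp < 1) (halpha : 0 < P.alpha)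
    (M : ℕ) : P.closedForm M 0 = 0 := by
  have hpow : (0 : ℝ) ^ (2 / P.alpha) = 0 := Real.zero_rpow (by positivity)
  have hbr : ∀ r l, P.bracket 0 r l = 0 := by
    intro r l
    simp [Params.bracket, hpow]
  have hcorr : ∀ m ∈ Finset.Icc 1 (M - 1), ∀ k ∈ multiIndices m, P.corrIntegrand 0 k = 0 := by
    intro m hm k hk
    funext r
    obtain ⟨l, hl⟩ : ∃ l, k l ≠ 0 := by
      by_contra! h
      have h1 := mem_multiIndices.1 hk
      simp only [h, mul_zero, Finset.sum_const_zero] at h1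
      have := (Finset.mem_Icc.1 hm).1
      omega
    simp only [Params.corrIntegrand, hbr, Pi.zero_apply, mul_eq_zero]
    exact Or.inr (Finset.prod_eq_zero (Finset.mem_univ l) (zero_pow hl))
  have hsum : ∑ m ∈ Finset.Icc 1 (M - 1), (1 / (-1 : ℝ) ^ m) * ∑ k ∈ multiIndices m,
      (1 / ∏ l : Fin m, ((k l).factorial : ℝ) * ((l.val + 1).factorial : ℝ) ^ k l) *
        ∫ r in Set.Ioi (0 : ℝ), P.corrIntegrand 0 k r = 0 := by
    refine Finset.sum_eq_zero fun m hm => ?_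
    rw [Finset.sum_eq_zero fun k hk => ?_, mul_zero]
    simp [hcorr m hm k hk]
  have hmain : P.lamAp * (1 - P.rhoAp) * ∫ r in Set.Ioi (0 : ℝ), P.mainIntegrand 0 r =
      ∫ r in Set.Ioi (0 : ℝ), r * serviceDensity P r := by
    rw [← integral_const_mul]
    refine integral_congr_ae (ae_of_all _ fun r => ?_)
    simp only [Params.mainIntegrand, serviceDensity, hpow]
    have h : -P.Lam1 * 0 * r ^ 2 - 0 * r ^ P.alpha * P.noise / P.powS -
        Real.pi * P.lamAp * (1 - P.rhoAp) * r ^ 2 =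
        -(P.lamAp * (1 - P.rhoAp) * (Real.pi * r ^ 2)) := by ring
    rw [h]
    ring
  have htot := integral_serviceDensity hlamAp hrhoAp
  rw [integral_plane_norm (serviceDensity P), ← hmain] at htot
  rw [Params.closedForm, hsum]
  linarith

end ServiceDistance


/-! ### Marks of the nodes -/

section MarkFactors

variable {M : ℕ}

theorem measurable_unitVec : Measurable (unitVec : (Fin M → ℂ) → Fin M → ℂ) := by
  refine measurable_pi_lambda _ fun p => ?_
  have h : (fun v : Fin M → ℂ => unitVec v p) = fun v => ((vecNorm v : ℂ))⁻¹ * v p := rfl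
  rw [h]
  exact (Complex.measurable_ofReal.comp measurable_vecNorm).inv.mul (measurable_pi_apply p)

theorem sum_norm_unitVec_sq {v : Fin M → ℂ} (hv : vecNorm v ≠ 0) :
    ∑ p, ‖unitVec v p‖ ^ 2 = 1 := by
  have h : ∀ p, ‖unitVec v p‖ ^ 2 = (vecNorm v ^ 2)⁻¹ * ‖v p‖ ^ 2 := by
    intro p
    simp [unitVec, mul_pow]
  simp only [h]
  rw [← Finset.mul_sum, ← vecNorm_sq, inv_mul_cancel₀ (pow_ne_zero 2 hv)]

/-- The factor which a sensor at distance `d` with activity `a` and channel `h` contributes to the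
conditional Laplace transform of the interference received along `u`. -/
noncomputable def sensorMark (α s : ℝ) (u : Fin M → ℂ) (d : ℝ) (a : Bool) (h : Fin M → ℂ) : ℝ≥0∞ :=
  if a = true then expNeg (ENNReal.ofReal (s * (‖star u ⬝ᵥ h‖ ^ 2 * d ^ (-α)))) else 1

/-- The factor which an access point at `y'` with activity `b` and channel `H` contributes to the
conditional Laplace transform of the interference received along `u`, restricted to the event that
the sensor at `x` is served by the access point at `y`. -/
noncomputable def apMark (α t : ℝ) (u w : Fin M → ℂ) (x y y' : Plane) (b : Bool)
    (H : Fin M × Fin M → ℂ) : ℝ≥0∞ :=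
  if b = true then expNeg (ENNReal.ofReal (t *
    (‖star u ⬝ᵥ ((Matrix.of fun p q => H (p, q)) *ᵥ star w)‖ ^ 2 * dist y' y ^ (-α))))
  else if dist x y < dist x y' then 1 else 0

variable {α s t : ℝ}

theorem sensorMark_le_one (u : Fin M → ℂ) (d : ℝ) (a : Bool) (h : Fin M → ℂ) :
    sensorMark α s u d a h ≤ 1 := by
  unfold sensorMark
  split_ifs
  exacts [expNeg_le_one _, le_rfl]

theorem apMark_le_one (u w : Fin M → ℂ) (x y y' : Plane) (b : Bool) (H : Fin M × Fin M → ℂ) :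
    apMark α t u w x y y' b H ≤ 1 := by
  unfold apMark
  split_ifs
  exacts [expNeg_le_one _, le_rfl, zero_le]

theorem measurable_dotProduct_star {X : Type*} [MeasurableSpace X] {u h : X → Fin M → ℂ}
    (hu : Measurable u) (hh : Measurable h) : Measurable fun x => star (u x) ⬝ᵥ h x := by
  simp only [dotProduct, Pi.star_apply]
  refine Finset.measurable_fun_sum _ fun p _ => ?_
  exact (continuous_star.measurable.comp ((measurable_pi_apply p).comp hu)).mul
    ((measurable_pi_apply p).comp hh)

theorem measurable_sensorMark {X : Type*} [MeasurableSpace X] {u h : X → Fin M → ℂ} {d : X → ℝ}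
    {a : X → Bool} (hu : Measurable u) (hd : Measurable d) (ha : Measurable a) (hh : Measurable h) :
    Measurable fun x => sensorMark α s (u x) (d x) (a x) (h x) := by
  have := measurable_dotProduct_star hu hh
  refine Measurable.ite (ha (measurableSet_singleton true)) ?_ measurable_const
  fun_prop

theorem measurable_apMark {X : Type*} [MeasurableSpace X] {u w : X → Fin M → ℂ}
    {x y y' : X → Plane} {b : X → Bool} {H : X → Fin M × Fin M → ℂ} (hu : Measurable u)
    (hw : Measurable w) (hx : Measurable x) (hy : Measurable y) (hy' : Measurable y')
    (hb : Measurable b) (hH : Measurable H) :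
    Measurable fun z => apMark α t (u z) (w z) (x z) (y z) (y' z) (b z) (H z) := by
  have hHw : Measurable fun z => (Matrix.of fun p q => H z (p, q)) *ᵥ star (w z) := by
    refine measurable_pi_lambda _ fun p => ?_
    simp only [Matrix.mulVec, dotProduct, Pi.star_apply, Matrix.of_apply]
    refine Finset.measurable_fun_sum _ fun q _ => ?_
    exact ((measurable_pi_apply (p, q)).comp hH).mul
      (continuous_star.measurable.comp ((measurable_pi_apply q).comp hw))
  have := measurable_dotProduct_star hu hHw
  refine Measurable.ite (hb (measurableSet_singleton true)) (by fun_prop) ?_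
  exact Measurable.ite (measurableSet_lt (by fun_prop) (by fun_prop)) measurable_const
    measurable_const

theorem lintegral_bool {κ : Measure Bool} [IsProbabilityMeasure κ] {ρ : ℝ} (hρ0 : 0 ≤ ρ)
    (hκ : κ {true} = ENNReal.ofReal ρ) (f : Bool → ℝ≥0∞) :
    ∫⁻ a, f a ∂κ = ENNReal.ofReal ρ * f true + ENNReal.ofReal (1 - ρ) * f false := by
  have h : κ {false} = ENNReal.ofReal (1 - ρ) := by
    have h1 : ({false} : Set Bool) = {true}ᶜ := by
      ext a
      cases a <;> simp
    rw [h1, prob_compl_eq_one_sub (measurableSet_singleton _), hκ, ENNReal.ofReal_sub _ hρ0,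
      ENNReal.ofReal_one]
  rw [lintegral_fintype]
  simp [hκ, h, mul_comm]

theorem lintegral_sensorMark {κ : Measure Bool} [IsProbabilityMeasure κ] {ρ : ℝ} (hρ0 : 0 ≤ ρ)
    (hκ : κ {true} = ENNReal.ofReal ρ) {u : Fin M → ℂ} (hu : ∑ p, ‖u p‖ ^ 2 = 1) {d : ℝ}
    (hd : 0 ≤ d) (hs : 0 ≤ s) :
    ∫⁻ b : Bool × (Fin M → ℂ), sensorMark α s u d b.1 b.2
      ∂(κ.prod (Measure.pi fun _ => stdComplexGaussian)) =
      ENNReal.ofReal ρ * fadeLaplace α s d + ENNReal.ofReal (1 - ρ) * 1 := by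
  rw [lintegral_prod _ (measurable_sensorMark measurable_const measurable_const measurable_fst
    measurable_snd).aemeasurable, lintegral_bool hρ0 hκ]
  congr 2
  · have h : ∀ h : Fin M → ℂ, sensorMark α s u d true h = expNeg (ENNReal.ofReal
        (s * d ^ (-α) * ‖∑ p, star (u p) * h p‖ ^ 2)) := by
      intro h
      simp only [sensorMark, if_true, dotProduct, Pi.star_apply]
      congr 2
      ring
    simp only [h]
    rw [lintegral_expNeg_sum_mul (by simpa using hu) (by positivity), fadeLaplace]
  · simp [sensorMark]

/-- The received amplitude is linear in the matrix entries, with coefficients the conjugates of `u p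
* w q`. Their squared moduli sum to `1`, so the amplitude is standard complex Gaussian. -/
theorem lintegral_apMark {κ : Measure Bool} [IsProbabilityMeasure κ] {ρ : ℝ} (hρ0 : 0 ≤ ρ)
    (hκ : κ {true} = ENNReal.ofReal ρ) {u w : Fin M → ℂ} (hu : ∑ p, ‖u p‖ ^ 2 = 1)
    (hw : ∑ p, ‖w p‖ ^ 2 = 1) (x y y' : Plane) (ht : 0 ≤ t) :
    ∫⁻ b : Bool × (Fin M × Fin M → ℂ), apMark α t u w x y y' b.1 b.2
      ∂(κ.prod (Measure.pi fun _ => stdComplexGaussian)) = apFactor ρ α t x y y' := by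
  rw [lintegral_prod _ (measurable_apMark measurable_const measurable_const measurable_const
    measurable_const measurable_const measurable_fst measurable_snd).aemeasurable,
    lintegral_bool hρ0 hκ, apFactor_eq]
  congr 2
  · have h : ∀ H : Fin M × Fin M → ℂ, apMark α t u w x y y' true H = expNeg (ENNReal.ofReal
        (t * dist y' y ^ (-α) * ‖∑ i : Fin M × Fin M, (star (u i.1) * star (w i.2)) * H i‖ ^ 2)) := by
      intro H
      have h1 : star u ⬝ᵥ ((Matrix.of fun p q => H (p, q)) *ᵥ star w) =
          ∑ i : Fin M × Fin M, (star (u i.1) * star (w i.2)) * H i := by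
        simp only [dotProduct, Matrix.mulVec, Pi.star_apply, Matrix.of_apply, Finset.mul_sum]
        rw [Fintype.sum_prod_type]
        refine Finset.sum_congr rfl fun p _ => Finset.sum_congr rfl fun q _ => ?_
        ring
      simp only [apMark, if_true, h1]
      congr 2
      ring
    simp only [h]
    rw [lintegral_expNeg_sum_mul ?_ (by positivity), fadeLaplace]
    simp only [norm_mul, norm_star, mul_pow]
    rw [Fintype.sum_prod_type]
    simp only [← Finset.mul_sum, hw, mul_one, hu]
  · simp [apMark]

theorem erlangTail_zero (hM : 1 ≤ M) : erlangTail M 0 = 1 := by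
  rw [erlangTail, Finset.sum_eq_single_of_mem 0 (Finset.mem_range.2 hM)]
  · simp
  · intro m _ hm
    simp [hm]

theorem ae_vecNorm_ne_zero (hM : 1 ≤ M) :
    ∀ᵐ h ∂(Measure.pi fun _ : Fin M => stdComplexGaussian), vecNorm h ≠ 0 := by
  have h1 : (Measure.pi fun _ : Fin M => stdComplexGaussian) {h | 0 < vecNorm h ^ 2} = 1 := by
    rw [stdComplexGaussian_vecNorm_sq_gt hM le_rfl, erlangTail_zero hM, ENNReal.ofReal_one]
  have h2 : MeasurableSet {h : Fin M → ℂ | 0 < vecNorm h ^ 2} :=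
    measurableSet_lt measurable_const (by fun_prop)
  filter_upwards [(prob_compl_eq_zero_iff h2).2 h1 |> measure_eq_zero_iff_ae_notMem.1] with h hh h0
  exact hh (by simp [h0])

end MarkFactors

/-! ### Measurability of nearest-point indices. -/

section NearestPoint

theorem measurable_sInf_nat {Ω : Type*} [MeasurableSpace Ω] {p : ℕ → Ω → Prop}
    (hp : ∀ k, MeasurableSet {ω | p k ω}) : Measurable fun ω => sInf {k | p k ω} := by
  refine measurable_of_Iic fun N => ?_
  -- The intersection accounts for the empty set, whose `sInf` is `0`.
  have h : (fun ω => sInf {k | p k ω}) ⁻¹' Set.Iic N =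
      (⋃ k ∈ Finset.range (N + 1), {ω | p k ω}) ∪ ⋂ k, {ω | p k ω}ᶜ := by
    ext ω
    simp only [Set.mem_preimage, Set.mem_Iic, Set.mem_union, Set.mem_iUnion, Set.mem_iInter,
      Finset.mem_range, Set.mem_ofPred_eq, Set.mem_compl_iff, exists_prop]
    constructor
    · intro hN
      by_cases hne : {k | p k ω}.Nonempty
      · exact Or.inl ⟨_, Nat.lt_succ_of_le hN, Nat.sInf_mem hne⟩
      · exact Or.inr fun k hk => hne ⟨k, hk⟩
    · rintro (⟨k, hk, hpk⟩ | hall)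
      · exact (Nat.sInf_le hpk).trans (Nat.lt_succ_iff.1 hk)
      · have : {k | p k ω} = ∅ := Set.eq_empty_of_forall_notMem hall
        simp [this]
  rw [h]
  exact (Finset.measurableSet_biUnion _ fun k _ => hp k).union
    (MeasurableSet.iInter fun k => (hp k).compl)

end NearestPoint

namespace Network

variable {Ω : Type*} {M : ℕ} {W : Network Ω M}

theorem measurable_sinkOf [MeasurableSpace Ω] (hz : ∀ l, Measurable (W.sink l))
    (hy : ∀ j, Measurable (W.ap j)) (j : ℕ) : Measurable (W.sinkOf j) := by
  refine measurable_sInf_nat fun k => ?_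
  simp only [true_and, true_imp_iff]
  rw [Set.ofPred_forall]
  exact MeasurableSet.iInter fun l => measurableSet_le ((hy j).dist (hz k)) ((hy j).dist (hz l))

/-- The sink index is random, but it takes countably many values, so evaluation at it is measurable.
-/
theorem measurable_sinkVec [MeasurableSpace Ω] (hz : ∀ l, Measurable (W.sink l))
    (hy : ∀ j, Measurable (W.ap j)) (hh : ∀ j l q, Measurable (W.hSink j l q)) (j : ℕ) :
    Measurable (W.sinkVec j) := by
  refine measurable_pi_lambda _ fun q => ?_
  have h : Measurable fun p : Ω × ℕ => W.hSink j p.2 q p.1 :=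
    measurable_from_prod_countable_left fun l => hh j l q
  exact h.comp (measurable_id.prodMk (measurable_sinkOf hz hy j))

theorem measurable_sensorVec [MeasurableSpace Ω] {n k : ℕ} (hh : ∀ p, Measurable (W.hSensor n k p)) :
    Measurable (W.sensorVec n k) :=
  measurable_pi_lambda _ fun p => hh p

end Network


namespace Network

/-! ### Integrating out activities and fading -/

section Sources

variable {Ω : Type*} {M : ℕ} {W : Network Ω M} {m : MeasurableSpace Ω}

/-- The sigma-algebra `m` is arbitrary because the independence arguments need measurability with
respect to small sub-sigma-algebras; the same holds for the companions below. -/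
theorem measurable_sensor_of_le (h : W.sourceSigma .sensors ≤ m) (n : ℕ) :
    Measurable[m] (W.sensor n) := by
  have h1 : Measurable[m] fun ω n => W.sensor n ω := measurable_iff_comap_le.2 h
  exact (measurable_pi_apply n).comp h1

theorem measurable_ap_of_le (h : W.sourceSigma .aps ≤ m) (k : ℕ) : Measurable[m] (W.ap k) := by
  have h1 : Measurable[m] fun ω n => W.ap n ω := measurable_iff_comap_le.2 h
  exact (measurable_pi_apply k).comp h1

theorem measurable_sink_of_le (h : W.sourceSigma .sinks ≤ m) (l : ℕ) : Measurable[m] (W.sink l) := by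
  have h1 : Measurable[m] fun ω n => W.sink n ω := measurable_iff_comap_le.2 h
  exact (measurable_pi_apply l).comp h1

theorem measurable_sensorActive_of_le {i : ℕ} (h : W.sourceSigma (.sensorAct i) ≤ m) :
    Measurable[m] (W.sensorActive i) := measurable_iff_comap_le.2 h

theorem measurable_apActive_of_le {j : ℕ} (h : W.sourceSigma (.apAct j) ≤ m) :
    Measurable[m] (W.apActive j) := measurable_iff_comap_le.2 h

theorem measurable_hSensor_of_le {i k : ℕ} {p : Fin M} (h : W.sourceSigma (.sensorCh i k p) ≤ m) :
    Measurable[m] (W.hSensor i k p) := measurable_iff_comap_le.2 h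

theorem measurable_hAp_of_le {j k : ℕ} {p q : Fin M} (h : W.sourceSigma (.apCh j k p q) ≤ m) :
    Measurable[m] (W.hAp j k p q) := measurable_iff_comap_le.2 h

theorem measurable_hSink_of_le {j l : ℕ} {q : Fin M} (h : W.sourceSigma (.sinkCh j l q) ≤ m) :
    Measurable[m] (W.hSink j l q) := measurable_iff_comap_le.2 h

end Sources

variable {Ω : Type*} {M : ℕ}

/-- The channel coefficients from access point `j` to access point `k`, as a vector. -/
def apCoeff (W : Network Ω M) (j k : ℕ) (ω : Ω) : Fin M × Fin M → ℂ := fun i => W.hAp j k i.1 i.2 ω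

/-- The event that the sensor `n` lies in `B` and is active, the access point `k` is not active,
their distance lies in `A` and the squared norm of their channel lies in `D`. -/
noncomputable def linkIndicator (W : Network Ω M) (B : Set Plane) (A D : Set ℝ) (n k : ℕ) (ω : Ω) :
    ℝ≥0∞ :=
  B.indicator 1 (W.sensor n ω) * A.indicator 1 (dist (W.sensor n ω) (W.ap k ω)) *
    (D.indicator 1 (vecNorm (W.sensorVec n k ω) ^ 2) *
      ((if W.sensorActive n ω = true then 1 else 0) * (if W.apActive k ω = false then 1 else 0)))

/-- The product of the factors of the sensors other than `n`. -/
noncomputable def sensorProd (W : Network Ω M) (α s : ℝ) (n k : ℕ) (ω : Ω) : ℝ≥0∞ :=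
  iprod fun i => if i = n then 1 else sensorMark α s (unitVec (W.sensorVec n k ω))
    (dist (W.sensor i ω) (W.ap k ω)) (W.sensorActive i ω) (W.sensorVec i k ω)

/-- The product of the factors of the access points other than `k`. -/
noncomputable def apProd (W : Network Ω M) (α t : ℝ) (n k : ℕ) (ω : Ω) : ℝ≥0∞ :=
  iprod fun j => if j = k then 1 else apMark α t (unitVec (W.sensorVec n k ω))
    (unitVec (W.sinkVec j ω)) (W.sensor n ω) (W.ap k ω) (W.ap j ω) (W.apActive j ω)
    (W.apCoeff j k ω)

/-- The product of the mean factors of the sensors other than `n`. -/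
noncomputable def meanSensorProd (W : Network Ω M) (ρ α s : ℝ) (n k : ℕ) (ω : Ω) : ℝ≥0∞ :=
  iprod fun i => if i = n then 1 else
    ENNReal.ofReal ρ * fadeLaplace α s (dist (W.sensor i ω) (W.ap k ω)) + ENNReal.ofReal (1 - ρ) * 1

/-- The product of the mean factors of the access points other than `k`. -/
noncomputable def meanApProd (W : Network Ω M) (ρ α t : ℝ) (n k : ℕ) (ω : Ω) : ℝ≥0∞ :=
  iprod fun j => if j = k then 1 else apFactor ρ α t (W.sensor n ω) (W.ap k ω) (W.ap j ω)

variable {W : Network Ω M} {B : Set Plane} {A D : Set ℝ} {α s t : ℝ} {n k : ℕ}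

theorem linkIndicator_le_one (ω : Ω) : W.linkIndicator B A D n k ω ≤ 1 := by
  have hind : ∀ {X : Type _} (S : Set X) (x : X), S.indicator (1 : X → ℝ≥0∞) x ≤ 1 := fun S x =>
    Set.indicator_apply_le' (fun _ => le_rfl) fun _ => zero_le
  have hite : ∀ (p : Prop) [Decidable p], (if p then (1 : ℝ≥0∞) else 0) ≤ 1 := by
    intro p _
    split_ifs <;> simp
  exact mul_le_one' (mul_le_one' (hind _ _) (hind _ _))
    (mul_le_one' (hind _ _) (mul_le_one' (hite _) (hite _)))

theorem apProd_le_one (ω : Ω) : W.apProd α t n k ω ≤ 1 :=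
  iprod_le_one _

theorem meanSensorProd_le_one {ρ : ℝ} (ω : Ω) :
    W.meanSensorProd ρ α s n k ω ≤ 1 :=
  iprod_le_one _

theorem measurable_linkIndicator [MeasurableSpace Ω] (hB : MeasurableSet B) (hA : MeasurableSet A)
    (hD : MeasurableSet D) (hx : Measurable (W.sensor n)) (hy : Measurable (W.ap k))
    (hh : Measurable (W.sensorVec n k)) (ha : Measurable (W.sensorActive n))
    (hb : Measurable (W.apActive k)) : Measurable (W.linkIndicator B A D n k) := by
  have h1 : Measurable fun ω => if W.sensorActive n ω = true then (1 : ℝ≥0∞) else 0 :=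
    Measurable.ite (ha (measurableSet_singleton true)) measurable_const measurable_const
  have h2 : Measurable fun ω => if W.apActive k ω = false then (1 : ℝ≥0∞) else 0 :=
    Measurable.ite (hb (measurableSet_singleton false)) measurable_const measurable_const
  exact (((measurable_one.indicator hB).comp hx).mul ((measurable_one.indicator hA).comp
    (hx.dist hy))).mul (((measurable_one.indicator hD).comp
      ((measurable_vecNorm.comp hh).pow_const 2)).mul (h1.mul h2))

theorem measurable_apProd [MeasurableSpace Ω] (hx : Measurable (W.sensor n))
    (hy : ∀ j, Measurable (W.ap j)) (hh : Measurable (W.sensorVec n k))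
    (hb : ∀ j, Measurable (W.apActive j)) (hH : ∀ j, Measurable (W.apCoeff j k))
    (hw : ∀ j, Measurable (W.sinkVec j)) : Measurable (W.apProd α t n k) := by
  refine measurable_iprod fun j => ?_
  split_ifs
  · exact measurable_const
  · exact measurable_apMark (measurable_unitVec.comp hh) (measurable_unitVec.comp (hw j)) hx (hy k)
      (hy j) (hb j) (hH j)

theorem measurable_meanSensorProd [MeasurableSpace Ω] {ρ : ℝ} (hx : ∀ i, Measurable (W.sensor i))
    (hy : Measurable (W.ap k)) : Measurable (W.meanSensorProd ρ α s n k) := by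
  refine measurable_iprod fun i => ?_
  split_ifs
  · exact measurable_const
  · have := (hx i).dist hy
    fun_prop

theorem measurable_apCoeff [MeasurableSpace Ω] {j : ℕ} (hh : ∀ p q, Measurable (W.hAp j k p q)) :
    Measurable (W.apCoeff j k) :=
  measurable_pi_lambda _ fun i => hh i.1 i.2

section Model

variable [mΩ : MeasurableSpace Ω] {P : Params} {μ : Measure Ω} [IsProbabilityMeasure μ]

omit [IsProbabilityMeasure μ] in
theorem IsModel.sourceSigma_le (hW : W.IsModel P μ) (σ : Source M) : W.sourceSigma σ ≤ mΩ := by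
  cases σ with
  | sensors => exact measurable_iff_comap_le.1 (measurable_pi_lambda _ hW.sensor_hppp.measurable)
  | aps => exact measurable_iff_comap_le.1 (measurable_pi_lambda _ hW.ap_hppp.measurable)
  | sinks => exact measurable_iff_comap_le.1 (measurable_pi_lambda _ hW.sink_hppp.measurable)
  | sensorAct i => exact measurable_iff_comap_le.1 (hW.sensorActive_meas i)
  | apAct j => exact measurable_iff_comap_le.1 (hW.apActive_meas j)
  | sensorCh i k p => exact measurable_iff_comap_le.1 (hW.hSensor_meas i k p)
  | apCh j k p q => exact measurable_iff_comap_le.1 (hW.hAp_meas j k p q)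
  | sinkCh j l q => exact measurable_iff_comap_le.1 (hW.hSink_meas j l q)

theorem IsModel.map_pi (hW : W.IsModel P μ) {κ : Type*} [Fintype κ] {g : κ → Source M}
    (hg : Function.Injective g) {X : κ → Ω → ℂ} (hX : ∀ q, Measurable (X q))
    (hXg : ∀ q, MeasurableSpace.comap (X q) inferInstance = W.sourceSigma (g q))
    (hlaw : ∀ q, μ.map (X q) = stdComplexGaussian) :
    μ.map (fun ω q => X q ω) = Measure.pi fun _ : κ => stdComplexGaussian := by
  have h : iIndepFun X μ := by
    rw [iIndepFun_iff_iIndep]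
    simp only [hXg]
    exact hW.indep.precomp hg
  rw [(iIndepFun_iff_map_fun_eq_pi_map fun q => (hX q).aemeasurable).1 h]
  simp only [hlaw]

theorem IsModel.map_sensorVec (hW : W.IsModel P μ) (i k : ℕ) :
    μ.map (W.sensorVec i k) = Measure.pi fun _ => stdComplexGaussian :=
  hW.map_pi (g := fun p => .sensorCh i k p) (fun p q h => by simpa using h)
    (fun p => hW.hSensor_meas i k p) (fun p => rfl) fun p => hW.hSensor_law i k p

theorem IsModel.map_apCoeff (hW : W.IsModel P μ) (j k : ℕ) :
    μ.map (W.apCoeff j k) = Measure.pi fun _ => stdComplexGaussian :=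
  hW.map_pi (g := fun i : Fin M × Fin M => .apCh j k i.1 i.2)
    (fun p q h => Prod.ext (by simp at h; exact h.1) (by simp at h; exact h.2))
    (fun i => hW.hAp_meas j k i.1 i.2) (fun i => rfl) fun i => hW.hAp_law j k i.1 i.2

theorem IsModel.map_hSink (hW : W.IsModel P μ) (j l : ℕ) :
    μ.map (fun ω q => W.hSink j l q ω) = Measure.pi fun _ => stdComplexGaussian :=
  hW.map_pi (g := fun q => .sinkCh j l q) (fun p q h => by simpa using h)
    (fun p => hW.hSink_meas j l p) (fun p => rfl) fun p => hW.hSink_law j l p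

omit [IsProbabilityMeasure μ] in
theorem IsModel.indepFun (hW : W.IsModel P μ) {S T : Set (Source M)} (hST : Disjoint S T)
    {X Y : Type*} [MeasurableSpace X] [MeasurableSpace Y] {f : Ω → X} {g : Ω → Y}
    (hf : Measurable[sigmaOf W.sourceSigma S] f) (hg : Measurable[sigmaOf W.sourceSigma T] g) :
    IndepFun f g μ :=
  indep_of_indep_of_le_left (indep_of_indep_of_le_right
    (indep_iSup_of_disjoint hW.sourceSigma_le hW.indep hST) (measurable_iff_comap_le.1 hg))
    (measurable_iff_comap_le.1 hf)

/-- Sources of the mark of sensor `i` at the access point `k`. -/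
def sensorMarkSources (M n k i : ℕ) : Set (Source M) :=
  {σ | i ≠ n ∧ (σ = .sensorAct i ∨ ∃ p, σ = .sensorCh i k p)}

/-- Sources of the mark of access point `j` at the access point `k`. -/
def apMarkSources (M k j : ℕ) : Set (Source M) :=
  {σ | j ≠ k ∧ (σ = .apAct j ∨ ∃ p q, σ = .apCh j k p q)}

theorem IsModel.map_sensor_mark (hW : W.IsModel P μ) (i k : ℕ) :
    μ.map (fun ω => (W.sensorActive i ω, W.sensorVec i k ω)) =
      (μ.map (W.sensorActive i)).prod (Measure.pi fun _ => stdComplexGaussian) := by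
  have h : IndepFun (W.sensorActive i) (W.sensorVec i k) μ := by
    refine hW.indepFun (S := {.sensorAct i}) (T := Set.range fun p => .sensorCh i k p) ?_
      (measurable_sensorActive_of_le (le_sigmaOf rfl))
      (@measurable_sensorVec _ _ _ (_) _ _ fun p => measurable_hSensor_of_le (le_sigmaOf ⟨p, rfl⟩))
    simp
  rw [(indepFun_iff_map_prod_eq_prod_map_map (hW.sensorActive_meas i).aemeasurable
    (measurable_sensorVec fun p => hW.hSensor_meas i k p).aemeasurable).1 h, hW.map_sensorVec]

theorem IsModel.map_ap_mark (hW : W.IsModel P μ) (j k : ℕ) :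
    μ.map (fun ω => (W.apActive j ω, W.apCoeff j k ω)) =
      (μ.map (W.apActive j)).prod (Measure.pi fun _ => stdComplexGaussian) := by
  have h : IndepFun (W.apActive j) (W.apCoeff j k) μ := by
    refine hW.indepFun (S := {.apAct j})
      (T := Set.range fun i : Fin M × Fin M => .apCh j k i.1 i.2) ?_
      (measurable_apActive_of_le (le_sigmaOf rfl))
      (@measurable_apCoeff _ _ _ _ (_) _ fun p q => measurable_hAp_of_le (le_sigmaOf ⟨(p, q), rfl⟩))
    simp
  rw [(indepFun_iff_map_prod_eq_prod_map_map (hW.apActive_meas j).aemeasurable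
    (measurable_apCoeff fun p q => hW.hAp_meas j k p q).aemeasurable).1 h, hW.map_apCoeff]

theorem IsModel.ae_sensorVec (hW : W.IsModel P μ) (hM : 1 ≤ M) (i k : ℕ) :
    ∀ᵐ ω ∂μ, vecNorm (W.sensorVec i k ω) ≠ 0 := by
  have h := ae_vecNorm_ne_zero hM
  rw [← hW.map_sensorVec i k] at h
  exact ae_of_ae_map (measurable_sensorVec fun p => hW.hSensor_meas i k p).aemeasurable h

theorem IsModel.ae_sinkVec (hW : W.IsModel P μ) (hM : 1 ≤ M) (j : ℕ) :
    ∀ᵐ ω ∂μ, vecNorm (W.sinkVec j ω) ≠ 0 := by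
  have h : ∀ l, ∀ᵐ ω ∂μ, vecNorm (fun q => W.hSink j l q ω) ≠ 0 := by
    intro l
    have h := ae_vecNorm_ne_zero hM
    rw [← hW.map_hSink j l] at h
    exact ae_of_ae_map (measurable_pi_lambda _ fun q => hW.hSink_meas j l q).aemeasurable h
  filter_upwards [ae_all_iff.2 h] with ω hω
  exact hω _

/-- The marks are activity and channel of the sensors other than `n`. The channel of `n`, which
fixes the combiner, belongs to the environment, as do all locations and the access-point product.
Given a unit combiner, the mean of a mark does not depend on its direction. -/
theorem IsModel.lintegral_sensorProd (hW : W.IsModel P μ) (hM : 1 ≤ M)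
    (hρ0 : 0 ≤ P.rhoS) (hs : 0 ≤ s) (hB : MeasurableSet B) (hA : MeasurableSet A)
    (hD : MeasurableSet D) :
    ∫⁻ ω, W.linkIndicator B A D n k ω * W.apProd α t n k ω * W.sensorProd α s n k ω ∂μ =
      ∫⁻ ω, W.linkIndicator B A D n k ω * W.apProd α t n k ω *
        W.meanSensorProd P.rhoS α s n k ω ∂μ := by
  let T : ℕ → Set (Source M) := sensorMarkSources M n k
  let E : Ω → (Fin M → ℂ) × Plane × (ℕ → Plane) :=
    fun ω => (W.sensorVec n k ω, W.ap k ω, fun i => W.sensor i ω)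
  -- The mark of index `n` is a dummy with no sources, so that the activity and channel of sensor
  -- `n` itself stay in the environment.
  let ξ : ℕ → Ω → Bool × (Fin M → ℂ) := fun i ω =>
    if i = n then (false, 0) else (W.sensorActive i ω, W.sensorVec i k ω)
  let f : ℕ → (Fin M → ℂ) × Plane × (ℕ → Plane) → Bool × (Fin M → ℂ) → ℝ≥0∞ := fun i e b =>
    if i = n then 1 else sensorMark α s (unitVec e.1) (dist (e.2.2 i) e.2.1) b.1 b.2
  have hout : ∀ {σ : Source M}, (∀ i, σ ∉ T i) →
      W.sourceSigma σ ≤ sigmaOf W.sourceSigma (⋃ i, T i)ᶜ := fun h =>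
    le_sigmaOf (by simpa using h)
  have hx : ∀ i, Measurable[sigmaOf W.sourceSigma (⋃ i, T i)ᶜ] (W.sensor i) :=
    measurable_sensor_of_le (hout fun i => by simp [T, sensorMarkSources])
  have hy : ∀ j, Measurable[sigmaOf W.sourceSigma (⋃ i, T i)ᶜ] (W.ap j) :=
    measurable_ap_of_le (hout fun i => by simp [T, sensorMarkSources])
  have hh : Measurable[sigmaOf W.sourceSigma (⋃ i, T i)ᶜ] (W.sensorVec n k) :=
    @measurable_sensorVec _ _ _ (_) _ _ fun p => measurable_hSensor_of_le
      (hout fun i => by simp +contextual [T, sensorMarkSources, eq_comm])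
  have hE : Measurable[sigmaOf W.sourceSigma (⋃ i, T i)ᶜ] E :=
    hh.prodMk ((hy k).prodMk (@measurable_pi_lambda _ _ _ (_) _ _ hx))
  have hZ : Measurable[sigmaOf W.sourceSigma (⋃ i, T i)ᶜ]
      fun ω => W.linkIndicator B A D n k ω * W.apProd α t n k ω := by
    refine Measurable.mul ?_ ?_
    · refine @measurable_linkIndicator _ _ _ _ _ _ _ _ (_) hB hA hD (hx n) (hy k) hh
        (measurable_sensorActive_of_le (hout fun i => ?_))
        (measurable_apActive_of_le (hout fun i => ?_))
      · simp +contextual [T, sensorMarkSources, eq_comm]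
      · simp [T, sensorMarkSources]
    · refine @measurable_apProd _ _ _ _ _ _ _ (_) (hx n) hy hh (fun j =>
        measurable_apActive_of_le (hout fun i => ?_)) (fun j =>
        @measurable_apCoeff _ _ _ _ (_) _ fun p q => measurable_hAp_of_le (hout fun i => ?_))
        (@measurable_sinkVec _ _ _ (_) (fun l => measurable_sink_of_le (hout fun i => ?_) l) hy
          fun j l q => measurable_hSink_of_le (hout fun i => ?_)) <;>
      simp [T, sensorMarkSources]
  have hξ : ∀ i, Measurable[sigmaOf W.sourceSigma (T i)] (ξ i) := by
    intro i
    by_cases hi : i = n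
    · simp only [ξ, hi, if_true]
      exact measurable_const
    · simp only [ξ, hi, if_false]
      exact (measurable_sensorActive_of_le (le_sigmaOf (show _ ∈ T i from ⟨hi, Or.inl rfl⟩))).prodMk
        (@measurable_sensorVec _ _ _ (_) _ _ fun p =>
          measurable_hSensor_of_le (le_sigmaOf (show _ ∈ T i from ⟨hi, Or.inr ⟨p, rfl⟩⟩)))
  have hT : Pairwise (Function.onFun Disjoint T) := by
    intro i j hij
    refine Set.disjoint_left.2 fun σ hσ hσ' => ?_
    rcases hσ.2 with h | ⟨p, h⟩ <;> rcases hσ'.2 with h' | ⟨q, h'⟩ <;> rw [h] at h' <;>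
      simp at h' <;> tauto
  have hf : ∀ i, Measurable (Function.uncurry (f i)) := by
    intro i
    by_cases hi : i = n
    · simp only [f, hi, if_true]
      exact measurable_const
    · simp only [f, hi, if_false]
      exact measurable_sensorMark (measurable_unitVec.comp (by fun_prop)) (by fun_prop) (by fun_prop)
        (by fun_prop)
  have key := lintegral_iprod_marks (f := f) (φ := fun i ω => if i = n then 1 else
      ENNReal.ofReal P.rhoS * fadeLaplace α s (dist (W.sensor i ω) (W.ap k ω)) +
        ENNReal.ofReal (1 - P.rhoS) * 1)
    hW.sourceSigma_le hW.indep hT hE hξ hf (fun i a b => ?_) hZ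
    (fun ω => mul_le_one' (linkIndicator_le_one ω) (apProd_le_one ω)) fun i => ?_
  · refine Eq.trans (lintegral_congr fun ω => ?_) key
    congr 1
    rw [sensorProd]
    congr 1
    funext i
    by_cases hi : i = n <;> simp [f, ξ, E, hi]
  · simp only [f]
    split_ifs
    exacts [le_rfl, sensorMark_le_one _ _ _ _]
  · by_cases hi : i = n
    · have := Measure.isProbabilityMeasure_map (μ := μ)
        ((hξ n).mono (sigmaOf_le hW.sourceSigma_le _) le_rfl).aemeasurable
      simp [f, hi]
    · filter_upwards [hW.ae_sensorVec hM n k] with ω hω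
      have : IsProbabilityMeasure (μ.map (W.sensorActive i)) :=
        Measure.isProbabilityMeasure_map (hW.sensorActive_meas i).aemeasurable
      simp only [f, ξ, hi, if_false]
      rw [hW.map_sensor_mark]
      refine lintegral_sensorMark hρ0 ?_ (sum_norm_unitVec_sq hω) dist_nonneg hs
      rw [Measure.map_apply (hW.sensorActive_meas i) (measurableSet_singleton _)]
      exact hW.sensorActive_prob i

/-- Now the marks are activity and channel to `k` of the access points other than `k`. The
precoders, determined by the locations and the channels to sinks, are part of the environment and
almost surely unit vectors; their law plays no role. -/
theorem IsModel.lintegral_apProd (hW : W.IsModel P μ) (hM : 1 ≤ M)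
    (hρ0 : 0 ≤ P.rhoAp) (ht : 0 ≤ t)
    (hB : MeasurableSet B) (hA : MeasurableSet A) (hD : MeasurableSet D) :
    ∫⁻ ω, W.linkIndicator B A D n k ω * W.meanSensorProd P.rhoS α s n k ω *
        W.apProd α t n k ω ∂μ =
      ∫⁻ ω, W.linkIndicator B A D n k ω * W.meanSensorProd P.rhoS α s n k ω *
        W.meanApProd P.rhoAp α t n k ω ∂μ := by
  let T : ℕ → Set (Source M) := apMarkSources M k
  let E : Ω → (Fin M → ℂ) × (ℕ → Fin M → ℂ) × Plane × (ℕ → Plane) :=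
    fun ω => (W.sensorVec n k ω, fun j => W.sinkVec j ω, W.sensor n ω, fun j => W.ap j ω)
  let ξ : ℕ → Ω → Bool × (Fin M × Fin M → ℂ) := fun j ω =>
    if j = k then (false, 0) else (W.apActive j ω, W.apCoeff j k ω)
  let f : ℕ → (Fin M → ℂ) × (ℕ → Fin M → ℂ) × Plane × (ℕ → Plane) →
      Bool × (Fin M × Fin M → ℂ) → ℝ≥0∞ := fun j e b =>
    if j = k then 1 else
      apMark α t (unitVec e.1) (unitVec (e.2.1 j)) e.2.2.1 (e.2.2.2 k) (e.2.2.2 j) b.1 b.2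
  have hout : ∀ {σ : Source M}, (∀ i, σ ∉ T i) →
      W.sourceSigma σ ≤ sigmaOf W.sourceSigma (⋃ i, T i)ᶜ := fun h =>
    le_sigmaOf (by simpa using h)
  have hx : ∀ i, Measurable[sigmaOf W.sourceSigma (⋃ i, T i)ᶜ] (W.sensor i) :=
    measurable_sensor_of_le (hout fun i => by simp [T, apMarkSources])
  have hy : ∀ j, Measurable[sigmaOf W.sourceSigma (⋃ i, T i)ᶜ] (W.ap j) :=
    measurable_ap_of_le (hout fun i => by simp [T, apMarkSources])
  have hh : Measurable[sigmaOf W.sourceSigma (⋃ i, T i)ᶜ] (W.sensorVec n k) :=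
    @measurable_sensorVec _ _ _ (_) _ _ fun p => measurable_hSensor_of_le
      (hout fun i => by simp [T, apMarkSources])
  have hw : ∀ j, Measurable[sigmaOf W.sourceSigma (⋃ i, T i)ᶜ] (W.sinkVec j) := by
    refine @measurable_sinkVec _ _ _ (_) (fun l => measurable_sink_of_le (hout fun i => ?_) l) hy
          fun j l q => measurable_hSink_of_le (hout fun i => ?_) <;>
      simp [T, apMarkSources]
  have hE : Measurable[sigmaOf W.sourceSigma (⋃ i, T i)ᶜ] E :=
    hh.prodMk ((@measurable_pi_lambda _ _ _ (_) _ _ hw).prodMk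
      ((hx n).prodMk (@measurable_pi_lambda _ _ _ (_) _ _ hy)))
  have hZ : Measurable[sigmaOf W.sourceSigma (⋃ i, T i)ᶜ]
      fun ω => W.linkIndicator B A D n k ω * W.meanSensorProd P.rhoS α s n k ω := by
    refine Measurable.mul ?_ (@measurable_meanSensorProd _ _ _ _ _ _ _ (_) _ hx (hy k))
    refine @measurable_linkIndicator _ _ _ _ _ _ _ _ (_) hB hA hD (hx n) (hy k) hh
      (measurable_sensorActive_of_le (hout fun i => ?_))
      (measurable_apActive_of_le (hout fun i => ?_))
    · simp [T, apMarkSources]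
    · simp +contextual [T, apMarkSources, eq_comm]
  have hξ : ∀ i, Measurable[sigmaOf W.sourceSigma (T i)] (ξ i) := by
    intro i
    by_cases hi : i = k
    · simp only [ξ, hi, if_true]
      exact measurable_const
    · simp only [ξ, hi, if_false]
      exact (measurable_apActive_of_le (le_sigmaOf (show _ ∈ T i from ⟨hi, Or.inl rfl⟩))).prodMk
        (@measurable_apCoeff _ _ _ _ (_) _ fun p q =>
          measurable_hAp_of_le (le_sigmaOf (show _ ∈ T i from ⟨hi, Or.inr ⟨p, q, rfl⟩⟩)))
  have hT : Pairwise (Function.onFun Disjoint T) := by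
    intro i j hij
    refine Set.disjoint_left.2 fun σ hσ hσ' => ?_
    rcases hσ.2 with h | ⟨p, q, h⟩ <;> rcases hσ'.2 with h' | ⟨p', q', h'⟩ <;> rw [h] at h' <;>
      simp at h' <;> tauto
  have hf : ∀ i, Measurable (Function.uncurry (f i)) := by
    intro i
    by_cases hi : i = k
    · simp only [f, hi, if_true]
      exact measurable_const
    · simp only [f, hi, if_false]
      exact measurable_apMark (measurable_unitVec.comp (by fun_prop))
        (measurable_unitVec.comp (by fun_prop)) (by fun_prop) (by fun_prop) (by fun_prop)
        (by fun_prop) (by fun_prop)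
  have key := lintegral_iprod_marks (f := f) (φ := fun j ω => if j = k then 1 else
      apFactor P.rhoAp α t (W.sensor n ω) (W.ap k ω) (W.ap j ω))
    hW.sourceSigma_le hW.indep hT hE hξ hf (fun i a b => ?_) hZ
    (fun ω => mul_le_one' (linkIndicator_le_one ω) (meanSensorProd_le_one ω))
    fun i => ?_
  · refine Eq.trans (lintegral_congr fun ω => ?_) key
    congr 1
    rw [apProd]
    congr 1
    funext i
    by_cases hi : i = k <;> simp [f, ξ, E, hi]
  · simp only [f]
    split_ifs
    exacts [le_rfl, apMark_le_one _ _ _ _ _ _ _]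
  · by_cases hi : i = k
    · have := Measure.isProbabilityMeasure_map (μ := μ)
        ((hξ k).mono (sigmaOf_le hW.sourceSigma_le _) le_rfl).aemeasurable
      simp [f, hi]
    · filter_upwards [hW.ae_sensorVec hM n k, hW.ae_sinkVec hM i] with ω hω hω'
      have : IsProbabilityMeasure (μ.map (W.apActive i)) :=
        Measure.isProbabilityMeasure_map (hW.apActive_meas i).aemeasurable
      simp only [f, ξ, hi, if_false]
      rw [hW.map_ap_mark]
      refine lintegral_apMark hρ0 ?_ (sum_norm_unitVec_sq hω) (sum_norm_unitVec_sq hω') _ _ _ ht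
      rw [Measure.map_apply (hW.apActive_meas i) (measurableSet_singleton _)]
      exact hW.apActive_prob i

end Model

end Network


/-! ### The Laplace functional of typical links -/

theorem measurable_apFactor_comp {X : Type*} [MeasurableSpace X] {ρ α t : ℝ} {x y y' : X → Plane}
    (hx : Measurable x) (hy : Measurable y) (hy' : Measurable y') :
    Measurable fun z => apFactor ρ α t (x z) (y z) (y' z) := by
  simp only [apFactor_eq]
  refine ((measurable_fadeLaplace.comp (hy'.dist hy)).const_mul _).add (Measurable.const_mul ?_ _)
  exact Measurable.ite (measurableSet_lt (by fun_prop) (by fun_prop)) measurable_const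
    measurable_const

namespace Network

variable {Ω : Type*} {M : ℕ} {W : Network Ω M} {B : Set Plane} {A D : Set ℝ} {α s t : ℝ} {n k : ℕ}
  [mΩ : MeasurableSpace Ω] {P : Params} {μ : Measure Ω} [IsProbabilityMeasure μ]

/-- The part of the mean factors of a link which depends on the locations only. -/
noncomputable def locationFactor (P : Params) (B : Set Plane) (A : Set ℝ) (s t : ℝ) (n k : ℕ)
    (x y : ℕ → Plane) : ℝ≥0∞ :=
  B.indicator 1 (x n) * A.indicator 1 (dist (x n) (y k)) *
    (iprod fun j => if j = k then 1 else apFactor P.rhoAp P.alpha t (x n) (y k) (y j)) *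
    iprod fun i => if i = n then 1 else
      ENNReal.ofReal P.rhoS * fadeLaplace P.alpha s (dist (x i) (y k)) +
        ENNReal.ofReal (1 - P.rhoS) * 1

theorem measurable_locationFactor {X : Type*} {mX : MeasurableSpace X} {x y : X → ℕ → Plane}
    (hB : MeasurableSet B) (hA : MeasurableSet A) (hx : ∀ i, Measurable fun z => x z i)
    (hy : ∀ j, Measurable fun z => y z j) :
    Measurable fun z => locationFactor P B A s t n k (x z) (y z) := by
  refine ((((measurable_one.indicator hB).comp (hx n)).mul ((measurable_one.indicator hA).comp
    ((hx n).dist (hy k)))).mul (measurable_iprod fun j => ?_)).mul (measurable_iprod fun i => ?_)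
  · split_ifs
    · exact measurable_const
    · exact measurable_apFactor_comp (hx n) (hy k) (hy j)
  · split_ifs
    · exact measurable_const
    · have h1 := hx i
      have h2 := hy k
      fun_prop

/-- Once the marks are averaged, the remaining product depends on locations only. It is therefore
independent of the gain of the link and of the activities of its two ends, which factor out. -/
theorem IsModel.lintegral_mean_factors (hW : W.IsModel P μ) (hρ : 0 ≤ P.rhoAp)
    (hB : MeasurableSet B) (hA : MeasurableSet A) (hD : MeasurableSet D) :
    ∫⁻ ω, W.linkIndicator B A D n k ω * W.meanSensorProd P.rhoS P.alpha s n k ω *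
        W.meanApProd P.rhoAp P.alpha t n k ω ∂μ =
      (Measure.pi fun _ : Fin M => stdComplexGaussian) {h | vecNorm h ^ 2 ∈ D} *
        (ENNReal.ofReal P.rhoS * (ENNReal.ofReal (1 - P.rhoAp) *
          ∫⁻ ω, locationFactor P B A s t n k (fun i => W.sensor i ω) (fun j => W.ap j ω) ∂μ)) := by
  set Q : Ω → ℝ≥0∞ := fun ω =>
    locationFactor P B A s t n k (fun i => W.sensor i ω) (fun j => W.ap j ω) with hQ
  let d : Ω → ℝ≥0∞ := fun ω => D.indicator 1 (vecNorm (W.sensorVec n k ω) ^ 2)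
  let a : Ω → ℝ≥0∞ := fun ω => if W.sensorActive n ω = true then 1 else 0
  let b : Ω → ℝ≥0∞ := fun ω => if W.apActive k ω = false then 1 else 0
  have hQm : Measurable[sigmaOf W.sourceSigma {.sensors, .aps}] Q :=
    measurable_locationFactor hB hA
      (measurable_sensor_of_le (le_sigmaOf (by simp)))
      (measurable_ap_of_le (le_sigmaOf (by simp)))
  have hd : Measurable[sigmaOf W.sourceSigma (Set.range fun p => .sensorCh n k p)] d :=
    (measurable_one.indicator hD).comp ((measurable_vecNorm.comp (@measurable_sensorVec _ _ _ (_) _ _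
      fun p => measurable_hSensor_of_le (le_sigmaOf (Set.mem_range_self p)))).pow_const 2)
  have ha : Measurable[sigmaOf W.sourceSigma {.sensorAct n}] a :=
    (Measurable.of_discrete (f := fun a : Bool => if a = true then (1 : ℝ≥0∞) else 0)).comp
      (measurable_sensorActive_of_le (le_sigmaOf rfl))
  have hb : Measurable[sigmaOf W.sourceSigma {.apAct k}] b :=
    (Measurable.of_discrete (f := fun a : Bool => if a = false then (1 : ℝ≥0∞) else 0)).comp
      (measurable_apActive_of_le (le_sigmaOf rfl))
  have hle := sigmaOf_le hW.sourceSigma_le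
  have hbQ : Measurable[sigmaOf W.sourceSigma {.apAct k, .sensors, .aps}] fun ω => b ω * Q ω :=
    (hb.mono (sigmaOf_mono (by simp)) le_rfl).mul (hQm.mono (sigmaOf_mono (by simp)) le_rfl)
  have habQ : Measurable[sigmaOf W.sourceSigma {.sensorAct n, .apAct k, .sensors, .aps}]
      fun ω => a ω * (b ω * Q ω) :=
    (ha.mono (sigmaOf_mono (by simp)) le_rfl).mul (hbQ.mono (sigmaOf_mono (by simp)) le_rfl)
  have hdint : ∫⁻ ω, d ω ∂μ =
      (Measure.pi fun _ : Fin M => stdComplexGaussian) {h | vecNorm h ^ 2 ∈ D} := by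
    have h1 : MeasurableSet {h : Fin M → ℂ | vecNorm h ^ 2 ∈ D} :=
      (measurable_vecNorm.pow_const 2) hD
    rw [← hW.map_sensorVec n k, Measure.map_apply (measurable_sensorVec fun p =>
      hW.hSensor_meas n k p) h1, ← lintegral_indicator_one]
    · rfl
    · exact (measurable_sensorVec fun p => hW.hSensor_meas n k p) h1
  have hms : ∀ i, MeasurableSet {ω | W.sensorActive i ω = true} := fun i =>
    hW.sensorActive_meas i (measurableSet_singleton true)
  have hma : ∀ (c : Bool), MeasurableSet {ω | W.apActive k ω = c} := fun c =>
    hW.apActive_meas k (measurableSet_singleton c)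
  have haint : ∫⁻ ω, a ω ∂μ = ENNReal.ofReal P.rhoS := by
    rw [← hW.sensorActive_prob n, ← lintegral_indicator_one (hms n)]
    refine lintegral_congr fun ω => ?_
    simp [a, Set.indicator_apply]
  have hbint : ∫⁻ ω, b ω ∂μ = ENNReal.ofReal (1 - P.rhoAp) := by
    have h1 : {ω | W.apActive k ω = true}ᶜ = {ω | W.apActive k ω = false} := by
      ext ω
      simp
    have h2 : μ {ω | W.apActive k ω = false} = ENNReal.ofReal (1 - P.rhoAp) := by
      rw [← h1, prob_compl_eq_one_sub (hma true),
        hW.apActive_prob, ENNReal.ofReal_sub _ hρ, ENNReal.ofReal_one]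
    rw [← h2, ← lintegral_indicator_one (hma false)]
    refine lintegral_congr fun ω => ?_
    simp [b, Set.indicator_apply]
  calc _ = ∫⁻ ω, d ω * (a ω * (b ω * Q ω)) ∂μ := by
        refine lintegral_congr fun ω => ?_
        simp only [linkIndicator, meanSensorProd, meanApProd, d, a, b, hQ, locationFactor]
        ring
    _ = _ := by
        rw [lintegral_mul_eq_lintegral_mul_lintegral_of_indepFun'' (hd.mono (hle _) le_rfl).aemeasurable
          (habQ.mono (hle _) le_rfl).aemeasurable (hW.indepFun ?_ hd habQ),
          lintegral_mul_eq_lintegral_mul_lintegral_of_indepFun'' (ha.mono (hle _) le_rfl).aemeasurable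
          (hbQ.mono (hle _) le_rfl).aemeasurable (hW.indepFun ?_ ha hbQ),
          lintegral_mul_eq_lintegral_mul_lintegral_of_indepFun'' (hb.mono (hle _) le_rfl).aemeasurable
          (hQm.mono (hle _) le_rfl).aemeasurable (hW.indepFun ?_ hb hQm), hdint, haint, hbint]
        all_goals simp

theorem lintegral_one_sub_sensor {ρ : ℝ} (hρ0 : 0 ≤ ρ) (hρ1 : ρ ≤ 1) (hα : 2 < α) (hs : 0 ≤ s)
    (y : Plane) :
    ∫⁻ x, (1 - (ENNReal.ofReal ρ * fadeLaplace α s (dist x y) + ENNReal.ofReal (1 - ρ) * 1)) =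
      ENNReal.ofReal ρ * ENNReal.ofReal (Real.pi * Real.Gamma (1 + 2 / α) *
        Real.Gamma (1 - 2 / α) * s ^ (2 / α)) := by
  rw [← lintegral_one_sub_fadeLaplace hα hs y, ← lintegral_const_mul _ (by fun_prop)]
  refine lintegral_congr fun x => ?_
  rw [one_sub_convex_combination hρ0 hρ1 (fadeLaplace_le_one hs dist_nonneg) le_rfl]
  simp

/-- The interference-free part of the mean number of links at distances in `A`. -/
theorem lintegral_apDensity (hρ1 : P.rhoAp ≤ 1) {K : ℝ}
    (hA : MeasurableSet A) (x : Plane) :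
    ENNReal.ofReal (1 - P.rhoAp) * ∫⁻ y, A.indicator 1 (dist x y) * ENNReal.ofReal (P.lamAp *
      Real.exp (-(P.lamAp * (P.rhoAp * K + (1 - P.rhoAp) * (Real.pi * dist x y ^ 2))))) =
      ENNReal.ofReal (Real.exp (-(P.lamAp * P.rhoAp * K))) *
        ∫⁻ z : Plane, A.indicator 1 ‖z‖ * ENNReal.ofReal (serviceDensity P ‖z‖) := by
  have hm : Measurable fun z : Plane =>
      A.indicator (1 : ℝ → ℝ≥0∞) ‖z‖ * ENNReal.ofReal (serviceDensity P ‖z‖) :=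
    ((measurable_one.indicator hA).comp measurable_norm).mul (by fun_prop)
  have hm2 : Measurable fun y : Plane => A.indicator (1 : ℝ → ℝ≥0∞) (dist x y) :=
    (measurable_one.indicator hA).comp (by fun_prop)
  rw [← lintegral_sub_right_eq_self (fun z : Plane =>
    A.indicator (1 : ℝ → ℝ≥0∞) ‖z‖ * ENNReal.ofReal (serviceDensity P ‖z‖)) x,
    ← lintegral_const_mul _ (by fun_prop),
    ← lintegral_const_mul _ (by fun_prop)]
  refine lintegral_congr fun y => ?_
  have h1 : ‖y - x‖ = dist x y := by rw [dist_comm, dist_eq_norm]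
  rw [h1, mul_left_comm, mul_left_comm (ENNReal.ofReal (Real.exp _)),
    ← ENNReal.ofReal_mul (by linarith), ← ENNReal.ofReal_mul (Real.exp_pos _).le, serviceDensity]
  congr 2
  have h2 : -(P.lamAp * (P.rhoAp * K + (1 - P.rhoAp) * (Real.pi * dist x y ^ 2))) =
      -(P.lamAp * P.rhoAp * K) + -(P.lamAp * (1 - P.rhoAp) * (Real.pi * dist x y ^ 2)) := by ring
  rw [h2, Real.exp_add]
  ring

/-- Sensors and access points are independent; the double integral allows the Mecke formula to be
used for one process with the other one held fixed. -/
theorem IsModel.lintegral_locationFactor (hW : W.IsModel P μ) (hB : MeasurableSet B)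
    (hA : MeasurableSet A) (n k : ℕ) :
    ∫⁻ ω, locationFactor P B A s t n k (fun i => W.sensor i ω) (fun j => W.ap j ω) ∂μ =
      ∫⁻ ω, ∫⁻ ω', locationFactor P B A s t n k (fun i => W.sensor i ω') (fun j => W.ap j ω)
        ∂μ ∂μ := by
  have hE : Measurable[sigmaOf W.sourceSigma {.aps}] fun ω j => W.ap j ω :=
    @measurable_pi_lambda _ _ _ (_) _ _ (measurable_ap_of_le (le_sigmaOf rfl))
  have hξ : Measurable[sigmaOf W.sourceSigma {.sensors}] fun ω i => W.sensor i ω :=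
    @measurable_pi_lambda _ _ _ (_) _ _ (measurable_sensor_of_le (le_sigmaOf rfl))
  have hind : IndepFun (fun ω j => W.ap j ω) (fun ω i => W.sensor i ω) μ :=
    hW.indepFun (by simp) hE hξ
  have hE' : Measurable fun ω j => W.ap j ω := hE.mono (sigmaOf_le hW.sourceSigma_le _) le_rfl
  have hξ' : Measurable fun ω i => W.sensor i ω :=
    hξ.mono (sigmaOf_le hW.sourceSigma_le _) le_rfl
  have hf : Measurable (Function.uncurry fun y x : ℕ → Plane =>
      locationFactor P B A s t n k x y) :=
    measurable_locationFactor hB hA (fun i => (measurable_pi_apply i).comp measurable_snd)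
      (fun j => (measurable_pi_apply j).comp measurable_fst)
  refine (lintegral_indepFun hE' hξ' hind hf).trans (lintegral_congr fun ω => ?_)
  have hfω : Measurable fun x : ℕ → Plane => locationFactor P B A s t n k x fun j => W.ap j ω :=
    measurable_locationFactor hB hA measurable_pi_apply fun _ => measurable_const
  exact lintegral_map hfω hξ'

/-- The Mecke formula is applied twice, first to the sensors and then to the access points.
Translation invariance makes each exponential factor independent of where the link lies, so the
result is a product. -/
theorem IsModel.tsum_locationFactor (hW : W.IsModel P μ) (hlamS : 0 ≤ P.lamS)
    (hlamAp : 0 ≤ P.lamAp) (hρS0 : 0 ≤ P.rhoS) (hρS1 : P.rhoS ≤ 1) (hρ0 : 0 ≤ P.rhoAp)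
    (hρ1 : P.rhoAp ≤ 1) (hα : 2 < P.alpha) (hs : 0 ≤ s) (ht : 0 ≤ t) (hB : MeasurableSet B)
    (hA : MeasurableSet A) :
    ENNReal.ofReal (1 - P.rhoAp) * ∑' n, ∑' k, ∫⁻ ω, locationFactor P B A s t n k
      (fun i => W.sensor i ω) (fun j => W.ap j ω) ∂μ =
      ENNReal.ofReal P.lamS * volume B *
        (∫⁻ z : Plane, A.indicator 1 ‖z‖ * ENNReal.ofReal (serviceDensity P ‖z‖)) *
        ENNReal.ofReal (Real.exp (-(Real.pi * Real.Gamma (1 + 2 / P.alpha) *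
          Real.Gamma (1 - 2 / P.alpha) * (P.lamS * P.rhoS * s ^ (2 / P.alpha) +
            P.lamAp * P.rhoAp * t ^ (2 / P.alpha))))) := by
  set G := Real.pi * Real.Gamma (1 + 2 / P.alpha) * Real.Gamma (1 - 2 / P.alpha) with hG
  set c := ENNReal.ofReal P.lamS * expNeg (ENNReal.ofReal P.lamS *
    (ENNReal.ofReal P.rhoS * ENNReal.ofReal (G * s ^ (2 / P.alpha)))) with hc
  have hxm := hW.sensor_hppp.measurable
  have hym := hW.ap_hppp.measurable
  have hG0 : 0 ≤ G := by
    have hα0 : 0 < P.alpha := by linarith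
    have h2a : 2 / P.alpha < 1 := (div_lt_one hα0).2 hα
    have hG1 : 0 < Real.Gamma (1 + 2 / P.alpha) := Real.Gamma_pos_of_pos (by positivity)
    have hG2 : 0 < Real.Gamma (1 - 2 / P.alpha) := Real.Gamma_pos_of_pos (by linarith)
    positivity
  let R : ℕ → Ω → Plane → ℝ≥0∞ := fun k ω x =>
    iprod fun j => if j = k then 1 else apFactor P.rhoAp P.alpha t x (W.ap k ω) (W.ap j ω)
  have hR : ∀ k, Measurable fun p : Ω × Plane => R k p.1 p.2 := by
    intro k
    refine measurable_iprod fun j => ?_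
    split_ifs
    · exact measurable_const
    · exact measurable_apFactor_comp measurable_snd ((hym k).comp measurable_fst)
        ((hym j).comp measurable_fst)
  have hRx : ∀ k x, Measurable fun ω => R k ω x := by
    intro k x
    refine measurable_iprod fun j => ?_
    split_ifs
    · exact measurable_const
    · exact measurable_apFactor_comp measurable_const (hym k) (hym j)
  have hBm : Measurable (B.indicator (1 : Plane → ℝ≥0∞)) := measurable_one.indicator hB
  have hAm : Measurable (A.indicator (1 : ℝ → ℝ≥0∞)) := measurable_one.indicator hA
  have hF : ∀ k, Measurable fun p : Ω × Plane =>
      B.indicator 1 p.2 * A.indicator 1 (dist p.2 (W.ap k p.1)) * R k p.1 p.2 := fun k =>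
    ((hBm.comp measurable_snd).mul (hAm.comp (measurable_snd.dist
      ((hym k).comp measurable_fst)))).mul (hR k)
  -- With the access points fixed, the sensor interference contributes a constant `c`, the same for
  -- every receiver position.
  have hsensor : ∀ k ω, ∑' n, ∫⁻ ω', locationFactor P B A s t n k (fun i => W.sensor i ω')
      (fun j => W.ap j ω) ∂μ = c * ∫⁻ x, B.indicator 1 x *
        A.indicator 1 (dist x (W.ap k ω)) * R k ω x := by
    intro k ω
    have h1 := hW.sensor_hppp.mecke hlamS
      (v := fun x => ENNReal.ofReal P.rhoS * fadeLaplace P.alpha s (dist x (W.ap k ω)) +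
        ENNReal.ofReal (1 - P.rhoS) * 1) (by fun_prop)
      (fun x => convex_combination_le_one hρS0 hρS1 (fadeLaplace_le_one hs dist_nonneg) le_rfl)
      (f := fun x => B.indicator 1 x * A.indicator 1 (dist x (W.ap k ω)) * R k ω x)
      ((hF k).comp measurable_prodMk_left)
    rw [lintegral_one_sub_sensor hρS0 hρS1 hα hs] at h1
    exact h1
  -- With the sensor fixed at `x`, the remaining density depends on the serving point only through
  -- its distance, so the integral does not depend on `x`.
  have hap : ∀ x, ENNReal.ofReal (1 - P.rhoAp) * ∑' k, ∫⁻ ω, B.indicator 1 x *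
      A.indicator 1 (dist x (W.ap k ω)) * R k ω x ∂μ = B.indicator 1 x *
      (ENNReal.ofReal (Real.exp (-(P.lamAp * P.rhoAp * (G * t ^ (2 / P.alpha))))) *
        ∫⁻ z : Plane, A.indicator 1 ‖z‖ * ENNReal.ofReal (serviceDensity P ‖z‖)) := by
    intro x
    have h1 := hW.ap_hppp.mecke_apFactor (x := x) hlamAp hρ0 hρ1 hα ht
      (f := fun y => A.indicator 1 (dist x y)) (hAm.comp (by fun_prop))
    rw [← lintegral_apDensity hρ1 hA x, ← h1, mul_left_comm (B.indicator _ _),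
      ← ENNReal.tsum_mul_left (a := B.indicator 1 x)]
    congr 1
    refine tsum_congr fun k => ?_
    simp only [mul_assoc]
    rw [lintegral_const_mul]
    have h2 : Measurable fun ω => A.indicator (1 : ℝ → ℝ≥0∞) (dist x (W.ap k ω)) :=
      hAm.comp (measurable_const.dist (hym k))
    exact h2.mul (hRx k x)
  have htot : ENNReal.ofReal (1 - P.rhoAp) * ∑' n, ∑' k, ∫⁻ ω, locationFactor P B A s t n k
      (fun i => W.sensor i ω) (fun j => W.ap j ω) ∂μ = c * (volume B *
      (ENNReal.ofReal (Real.exp (-(P.lamAp * P.rhoAp * (G * t ^ (2 / P.alpha))))) *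
        ∫⁻ z : Plane, A.indicator 1 ‖z‖ * ENNReal.ofReal (serviceDensity P ‖z‖))) := by
    rw [ENNReal.tsum_comm]
    have h1 : ∀ k, ∑' n, ∫⁻ ω, locationFactor P B A s t n k
        (fun i => W.sensor i ω) (fun j => W.ap j ω) ∂μ = c * ∫⁻ x, ∫⁻ ω, B.indicator 1 x *
          A.indicator 1 (dist x (W.ap k ω)) * R k ω x ∂μ := by
      intro k
      simp only [hW.lintegral_locationFactor hB hA]
      rw [← lintegral_tsum]
      · simp only [hsensor]
        rw [lintegral_const_mul _ (hF k).lintegral_prod_right',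
          lintegral_lintegral_swap (hF k).aemeasurable]
      · intro n
        refine Measurable.aemeasurable ?_
        exact Measurable.lintegral_prod_right' (f := fun p : Ω × Ω => locationFactor P B A s t n k
          (fun i => W.sensor i p.2) (fun j => W.ap j p.1)) (measurable_locationFactor hB hA
            (fun i => (hxm i).comp measurable_snd) (fun j => (hym j).comp measurable_fst))
    simp only [h1]
    rw [ENNReal.tsum_mul_left, mul_left_comm, ← lintegral_tsum fun k =>
      (hF k).lintegral_prod_left'.aemeasurable, ← lintegral_const_mul]
    · simp only [hap]
      rw [lintegral_mul_const _ hBm, lintegral_indicator_one hB]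
    · exact Measurable.tsum fun k => (hF k).lintegral_prod_left'
  have hexp : expNeg (ENNReal.ofReal P.lamS *
      (ENNReal.ofReal P.rhoS * ENNReal.ofReal (G * s ^ (2 / P.alpha)))) =
      ENNReal.ofReal (Real.exp (-(P.lamS * (P.rhoS * (G * s ^ (2 / P.alpha)))))) := by
    rw [← ENNReal.ofReal_mul hρS0, ← ENNReal.ofReal_mul hlamS, expNeg_ofReal (by positivity)]
  have hsum : -(G * (P.lamS * P.rhoS * s ^ (2 / P.alpha) +
      P.lamAp * P.rhoAp * t ^ (2 / P.alpha))) = -(P.lamS * (P.rhoS * (G * s ^ (2 / P.alpha)))) +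
      -(P.lamAp * P.rhoAp * (G * t ^ (2 / P.alpha))) := by ring
  rw [htot, hc, hexp, hsum, Real.exp_add, ENNReal.ofReal_mul (Real.exp_pos _).le]
  ring

end Network


namespace Network

/-! ### Links and their interference -/

variable {Ω : Type*} {M : ℕ} {W : Network Ω M} {P : Params} {B : Set Plane} {A D : Set ℝ}
  {s : ℝ} {n k : ℕ}

/-- The event that the sensor `n` lies in `B`, is active and has the access point `k` as its unique
nearest access point that is not active. -/
def linkEvent (W : Network Ω M) (B : Set Plane) (n k : ℕ) : Set Ω :=
  {ω | W.sensor n ω ∈ B ∧ W.sensorActive n ω = true ∧ W.apActive k ω = false ∧ ∀ l, l ≠ k →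
    W.apActive l ω = false → dist (W.sensor n ω) (W.ap k ω) < dist (W.sensor n ω) (W.ap l ω)}

/-- Strict minimality makes the set of nearest indices a singleton, so the tie-breaking in
`nearestIdx` is irrelevant on a link event. -/
theorem apOf_eq_of_mem_linkEvent {ω : Ω} (h : ω ∈ W.linkEvent B n k) : W.apOf n ω = k := by
  have hset : {k' | W.apActive k' ω = false ∧ ∀ l, W.apActive l ω = false →
      dist (W.sensor n ω) (W.ap k' ω) ≤ dist (W.sensor n ω) (W.ap l ω)} = {k} := by
    ext k'
    simp only [Set.mem_ofPred_eq, Set.mem_singleton_iff]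
    constructor
    · rintro ⟨h1, h2⟩
      by_contra hk
      exact absurd (h2 k h.2.2.1) (not_le.2 (h.2.2.2 k' hk h1))
    · rintro rfl
      refine ⟨h.2.2.1, fun l hl => ?_⟩
      by_cases hlk : l = k'
      · rw [hlk]
      · exact (h.2.2.2 l hlk hl).le
  rw [apOf, nearestIdx, hset, csInf_singleton]

theorem measurableSet_linkEvent [MeasurableSpace Ω] (hB : MeasurableSet B)
    (hx : Measurable (W.sensor n)) (hy : ∀ j, Measurable (W.ap j))
    (ha : Measurable (W.sensorActive n)) (hb : ∀ j, Measurable (W.apActive j)) :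
    MeasurableSet (W.linkEvent B n k) := by
  have h1 : ∀ l (c : Bool), MeasurableSet {ω | W.apActive l ω = c} := fun l c =>
    hb l (measurableSet_singleton c)
  have h2 : ∀ l, MeasurableSet
      {ω | dist (W.sensor n ω) (W.ap k ω) < dist (W.sensor n ω) (W.ap l ω)} := fun l =>
    measurableSet_lt (hx.dist (hy k)) (hx.dist (hy l))
  have h3 : MeasurableSet {ω | W.sensor n ω ∈ B} := hx hB
  have h4 : MeasurableSet {ω | W.sensorActive n ω = true} := ha (measurableSet_singleton true)
  refine h3.inter (h4.inter ((h1 k false).inter ?_))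
  have h5 : {ω | ∀ l, l ≠ k → W.apActive l ω = false →
      dist (W.sensor n ω) (W.ap k ω) < dist (W.sensor n ω) (W.ap l ω)} =
      ⋂ l, {ω | l ≠ k}ᶜ ∪ ({ω | W.apActive l ω = false}ᶜ ∪
        {ω | dist (W.sensor n ω) (W.ap k ω) < dist (W.sensor n ω) (W.ap l ω)}) := by
    ext ω
    simp only [Set.mem_ofPred_eq, Set.mem_iInter, Set.mem_union, Set.mem_compl_iff]
    refine forall_congr' fun l => ?_
    tauto
  change MeasurableSet {ω | ∀ l, l ≠ k → W.apActive l ω = false →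
      dist (W.sensor n ω) (W.ap k ω) < dist (W.sensor n ω) (W.ap l ω)}
  rw [h5]
  exact MeasurableSet.iInter fun l => (MeasurableSet.const _).compl.union
    ((h1 l false).compl.union (h2 l))

theorem disjoint_linkEvent {k k' : ℕ} (h : k ≠ k') :
    Disjoint (W.linkEvent B n k) (W.linkEvent B n k') := by
  refine Set.disjoint_left.2 fun ω h1 h2 => h ?_
  rw [← apOf_eq_of_mem_linkEvent h1, ← apOf_eq_of_mem_linkEvent h2]

/-- Distance, squared norm of the channel and interference of the link from sensor `n` to
access point `k`. -/
noncomputable def linkData (W : Network Ω M) (P : Params) (n k : ℕ) (ω : Ω) : ℝ × ℝ × ℝ≥0∞ :=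
  (dist (W.sensor n ω) (W.ap k ω), vecNorm (W.sensorVec n k ω) ^ 2,
    W.interfSensor P n k ω + W.interfAp P n k ω)

theorem sensorProd_eq (hs : 0 ≤ s) (ω : Ω) :
    W.sensorProd P.alpha s n k ω = expNeg (ENNReal.ofReal s * W.interfSensor P n k ω) := by
  rw [sensorProd, interfSensor, ← ENNReal.tsum_mul_left, expNeg_tsum]
  congr 1
  funext i
  by_cases hi : i = n
  · simp [hi]
  · by_cases ha : W.sensorActive i ω = true
    · simp only [hi, ha, sensorMark, if_false, if_true, ne_eq, not_false_eq_true, and_self]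
      rw [← ENNReal.ofReal_mul hs]
    · simp [hi, ha, sensorMark]

theorem apProd_eq_of_forall (hs : 0 ≤ s) (hp : 0 ≤ P.powAp / P.powS) {ω : Ω}
    (h : ∀ l, l ≠ k → W.apActive l ω = false →
      dist (W.sensor n ω) (W.ap k ω) < dist (W.sensor n ω) (W.ap l ω)) :
    W.apProd P.alpha (s * (P.powAp / P.powS)) n k ω =
      expNeg (ENNReal.ofReal s * W.interfAp P n k ω) := by
  rw [apProd, interfAp, ← mul_assoc, ← ENNReal.ofReal_mul hs, ← ENNReal.tsum_mul_left, expNeg_tsum]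
  congr 1
  funext j
  by_cases hj : j = k
  · simp [hj]
  · by_cases ha : W.apActive j ω = true
    · simp only [hj, ha, apMark, if_false, if_true, ne_eq, not_false_eq_true, and_self]
      rw [← ENNReal.ofReal_mul (by positivity)]
      rfl
    · simp only [hj, ha, apMark, if_false, ne_eq, not_false_eq_true, and_true]
      rw [if_neg Bool.false_ne_true, if_neg Bool.false_ne_true,
        if_pos (h j hj (by simpa using ha)), mul_zero, expNeg_zero]

theorem apProd_eq_zero {ω : Ω} {α t : ℝ} {l : ℕ} (hl : l ≠ k) (hb : W.apActive l ω = false)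
    (h : ¬ dist (W.sensor n ω) (W.ap k ω) < dist (W.sensor n ω) (W.ap l ω)) :
    W.apProd α t n k ω = 0 := by
  rw [apProd, iprod_pull _ l]
  · simp [hl, apMark, hb, h]
  · intro j
    split_ifs
    exacts [le_rfl, apMark_le_one _ _ _ _ _ _ _]

/-- The marks encode the association: one idle access point at least as near as `k` makes a factor,
hence the whole product, vanish. If there is none, idle points contribute `1` and active ones their
share of `exp(-s I)`. -/
theorem linkIndicator_mul_prods (hs : 0 ≤ s) (hp : 0 ≤ P.powAp / P.powS) (ω : Ω) :
    W.linkIndicator B A D n k ω * W.apProd P.alpha (s * (P.powAp / P.powS)) n k ω *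
      W.sensorProd P.alpha s n k ω = (W.linkEvent B n k).indicator (fun ω =>
        A.indicator 1 (W.linkData P n k ω).1 * (D.indicator 1 (W.linkData P n k ω).2.1 *
          expNeg (ENNReal.ofReal s * (W.linkData P n k ω).2.2))) ω := by
  by_cases h : ω ∈ W.linkEvent B n k
  · rw [Set.indicator_of_mem h, sensorProd_eq hs, apProd_eq_of_forall hs hp h.2.2.2, linkIndicator,
      Set.indicator_of_mem h.1, if_pos h.2.1, if_pos h.2.2.1]
    simp only [linkData]
    rw [mul_add, expNeg_add]
    simp only [Pi.one_apply]
    ring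
  · rw [Set.indicator_of_notMem h]
    by_cases h1 : W.sensor n ω ∈ B
    · by_cases h2 : W.sensorActive n ω = true
      · by_cases h3 : W.apActive k ω = false
        · have h4 : ∃ l, l ≠ k ∧ W.apActive l ω = false ∧
              ¬ dist (W.sensor n ω) (W.ap k ω) < dist (W.sensor n ω) (W.ap l ω) := by
            by_contra! hall
            exact h ⟨h1, h2, h3, hall⟩
          obtain ⟨l, hl, hb, hd⟩ := h4
          rw [apProd_eq_zero hl hb hd, mul_zero, zero_mul]
        · simp [linkIndicator, h3]
      · simp [linkIndicator, h2]
    · simp [linkIndicator, h1]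

theorem measurable_linkData [MeasurableSpace Ω] (hx : ∀ i, Measurable (W.sensor i))
    (hy : ∀ j, Measurable (W.ap j)) (hh : ∀ i, Measurable (W.sensorVec i k))
    (ha : ∀ i, Measurable (W.sensorActive i)) (hb : ∀ j, Measurable (W.apActive j))
    (hH : ∀ j, Measurable (W.apCoeff j k)) (hw : ∀ j, Measurable (W.sinkVec j)) :
    Measurable (W.linkData P n k) := by
  have hu : Measurable fun ω => unitVec (W.sensorVec n k ω) := measurable_unitVec.comp (hh n)
  have h1 : Measurable (W.interfSensor P n k) := by
    refine Measurable.tsum fun i => Measurable.ite ?_ ?_ measurable_const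
    · exact (ha i (measurableSet_singleton true)).inter (MeasurableSet.const _)
    · have h2 := measurable_dotProduct_star hu (hh i)
      have h3 := (hx i).dist (hy k)
      fun_prop
  have h2 : Measurable (W.interfAp P n k) := by
    refine Measurable.const_mul (Measurable.tsum fun j => Measurable.ite ?_ ?_ measurable_const) _
    · exact (hb j (measurableSet_singleton true)).inter (MeasurableSet.const _)
    · have hHw : Measurable fun ω => W.apMat j k ω *ᵥ star (unitVec (W.sinkVec j ω)) := by
        refine measurable_pi_lambda _ fun p => ?_
        simp only [Matrix.mulVec, dotProduct, Pi.star_apply, apMat, Matrix.of_apply]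
        refine Finset.measurable_fun_sum _ fun q _ => ?_
        exact ((measurable_pi_apply (p, q)).comp (hH j)).mul (continuous_star.measurable.comp
          ((measurable_pi_apply q).comp (measurable_unitVec.comp (hw j))))
      have h2 := measurable_dotProduct_star hu hHw
      have h3 := (hy j).dist (hy k)
      fun_prop
  exact ((hx n).dist (hy k)).prodMk (((measurable_vecNorm.comp (hh n)).pow_const 2).prodMk
    (h1.add h2))

section Model

variable [mΩ : MeasurableSpace Ω] {μ : Measure Ω} [IsProbabilityMeasure μ]

omit [IsProbabilityMeasure μ] in
theorem IsModel.measurable_linkData (hW : W.IsModel P μ) (n k : ℕ) :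
    Measurable (W.linkData P n k) :=
  Network.measurable_linkData hW.sensor_hppp.measurable hW.ap_hppp.measurable
    (fun i => measurable_sensorVec fun p => hW.hSensor_meas i k p) hW.sensorActive_meas
    hW.apActive_meas (fun j => measurable_apCoeff fun p q => hW.hAp_meas j k p q)
    (measurable_sinkVec hW.sink_hppp.measurable hW.ap_hppp.measurable hW.hSink_meas)

omit [IsProbabilityMeasure μ] in
theorem IsModel.measurableSet_linkEvent (hW : W.IsModel P μ) (hB : MeasurableSet B) (n k : ℕ) :
    MeasurableSet (W.linkEvent B n k) :=
  Network.measurableSet_linkEvent hB (hW.sensor_hppp.measurable n) hW.ap_hppp.measurable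
    (hW.sensorActive_meas n) hW.apActive_meas

/-- The law of the distance between a sensor and its access point. -/
noncomputable def distLaw (P : Params) : Measure ℝ :=
  (volume.withDensity fun z : Plane => ENNReal.ofReal (serviceDensity P ‖z‖)).map norm

/-- The law of the squared norm of a channel vector. -/
noncomputable def gainLaw (M : ℕ) : Measure ℝ :=
  (Measure.pi fun _ : Fin M => stdComplexGaussian).map fun h => vecNorm h ^ 2

theorem lintegral_distLaw {f : ℝ → ℝ≥0∞} (hf : Measurable f) :
    ∫⁻ r, f r ∂(distLaw P) = ∫⁻ z : Plane, f ‖z‖ * ENNReal.ofReal (serviceDensity P ‖z‖) := by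
  rw [distLaw, lintegral_map hf measurable_norm,
    lintegral_withDensity_eq_lintegral_mul _ (by fun_prop) (by fun_prop)]
  refine lintegral_congr fun z => ?_
  rw [Pi.mul_apply, mul_comm]

/-- The mean number of links in `B` with given data. -/
noncomputable def linkMeasure (W : Network Ω M) (P : Params) (μ : Measure Ω) (B : Set Plane) :
    Measure (ℝ × ℝ × ℝ≥0∞) :=
  Measure.sum fun p : ℕ × ℕ => (μ.restrict (W.linkEvent B p.1 p.2)).map (W.linkData P p.1 p.2)

omit [IsProbabilityMeasure μ] in
theorem IsModel.lintegral_linkMeasure (hW : W.IsModel P μ) (hB : MeasurableSet B)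
    {f : ℝ × ℝ × ℝ≥0∞ → ℝ≥0∞} (hf : Measurable f) :
    ∫⁻ q, f q ∂(W.linkMeasure P μ B) =
      ∑' n, ∑' k, ∫⁻ ω, (W.linkEvent B n k).indicator (fun ω => f (W.linkData P n k ω)) ω ∂μ := by
  rw [linkMeasure, lintegral_sum_measure, ENNReal.tsum_prod']
  refine tsum_congr fun n => tsum_congr fun k => ?_
  rw [lintegral_map hf (hW.measurable_linkData n k),
    lintegral_indicator (hW.measurableSet_linkEvent hB n k)]

/-- The sensor marks are averaged, then the access-point marks, then the locations. The power ratio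
rescales `s` for the access points, which produces the factor `(P_ap / P_s)^(2/α)` inside `Λ₁`. -/
theorem IsModel.laplace_linkMeasure (hW : W.IsModel P μ) (hM : 1 ≤ M) (hlamS : 0 ≤ P.lamS)
    (hlamAp : 0 ≤ P.lamAp) (hρS0 : 0 ≤ P.rhoS) (hρS1 : P.rhoS ≤ 1) (hρ0 : 0 ≤ P.rhoAp)
    (hρ1 : P.rhoAp ≤ 1) (hα : 2 < P.alpha) (hpowS : 0 ≤ P.powS) (hpowAp : 0 ≤ P.powAp)
    (hs : 0 ≤ s) (hB : MeasurableSet B) (hA : MeasurableSet A) (hD : MeasurableSet D) :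
    ∫⁻ q, A.indicator 1 q.1 * (D.indicator 1 q.2.1 * expNeg (ENNReal.ofReal s * q.2.2))
        ∂(W.linkMeasure P μ B) =
      ENNReal.ofReal (P.lamS * P.rhoS) * volume B * distLaw P A * gainLaw M D *
        ENNReal.ofReal (Real.exp (-P.Lam1 * s ^ (2 / P.alpha))) := by
  have hp : 0 ≤ P.powAp / P.powS := div_nonneg hpowAp hpowS
  have hm : Measurable fun q : ℝ × ℝ × ℝ≥0∞ =>
      A.indicator 1 q.1 * (D.indicator 1 q.2.1 * expNeg (ENNReal.ofReal s * q.2.2)) :=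
    ((measurable_one.indicator hA).comp measurable_fst).mul
      (((measurable_one.indicator hD).comp (measurable_fst.comp measurable_snd)).mul (by fun_prop))
  have hterm : ∀ n k, ∫⁻ ω, (W.linkEvent B n k).indicator (fun ω =>
        A.indicator 1 (W.linkData P n k ω).1 * (D.indicator 1 (W.linkData P n k ω).2.1 *
          expNeg (ENNReal.ofReal s * (W.linkData P n k ω).2.2))) ω ∂μ =
      gainLaw M D * (ENNReal.ofReal P.rhoS * (ENNReal.ofReal (1 - P.rhoAp) *
          ∫⁻ ω, locationFactor P B A s (s * (P.powAp / P.powS)) n k (fun i => W.sensor i ω)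
            (fun j => W.ap j ω) ∂μ)) := by
    intro n k
    simp only [← linkIndicator_mul_prods hs hp]
    rw [hW.lintegral_sensorProd hM hρS0 hs hB hA hD]
    simp only [mul_right_comm _ (W.apProd _ _ _ _ _)]
    rw [hW.lintegral_apProd hM hρ0 (mul_nonneg hs hp) hB hA hD, hW.lintegral_mean_factors hρ0 hB hA hD,
      gainLaw, Measure.map_apply (by fun_prop) hD]
    rfl
  have hdist : distLaw P A =
      ∫⁻ z : Plane, A.indicator 1 ‖z‖ * ENNReal.ofReal (serviceDensity P ‖z‖) := by
    rw [← lintegral_distLaw (measurable_one.indicator hA), lintegral_indicator_one hA]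
  have hexp : -(Real.pi * Real.Gamma (1 + 2 / P.alpha) * Real.Gamma (1 - 2 / P.alpha) *
      (P.lamS * P.rhoS * s ^ (2 / P.alpha) +
        P.lamAp * P.rhoAp * (s * (P.powAp / P.powS)) ^ (2 / P.alpha))) =
      -P.Lam1 * s ^ (2 / P.alpha) := by
    rw [Real.mul_rpow hs hp, Params.Lam1]
    ring
  rw [hW.lintegral_linkMeasure hB hm]
  simp only [hterm, ENNReal.tsum_mul_left]
  rw [hW.tsum_locationFactor hlamS hlamAp hρS0 hρS1 hρ0 hρ1 hα hs (mul_nonneg hs hp) hB hA, hexp,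
    hdist, ENNReal.ofReal_mul hlamS]
  ring

end Model

end Network


/-! ### The law of the data of a typical link -/

/-- For fixed `A` and `D`, the third marginal over `A × D` has a multiple of `L` as transform, so by
uniqueness it is that multiple of one law `ν`; boxes then determine the measure. The law `ν` arises
as the normalised full marginal, so no existence theorem for a law with transform `L` is needed. -/
theorem exists_prod_of_laplace {κ : Measure (ℝ × ℝ × ℝ≥0∞)} {R G : Measure ℝ}
    [IsProbabilityMeasure R] [IsProbabilityMeasure G] {C : ℝ≥0∞} (hC0 : C ≠ 0) (hCtop : C ≠ ∞)
    {L : ℝ → ℝ≥0∞} (hL0 : L 0 = 1)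
    (h : ∀ A D : Set ℝ, MeasurableSet A → MeasurableSet D → ∀ s : ℝ, 0 ≤ s →
      ∫⁻ q, A.indicator 1 q.1 * (D.indicator 1 q.2.1 * expNeg (ENNReal.ofReal s * q.2.2)) ∂κ =
        C * R A * G D * L s) :
    ∃ ν : Measure ℝ≥0∞, IsProbabilityMeasure ν ∧
      (∀ s : ℝ, 0 ≤ s → ∫⁻ x, expNeg (ENNReal.ofReal s * x) ∂ν = L s) ∧
      κ = C • R.prod (G.prod ν) := by
  let m : Set ℝ → Set ℝ → Measure ℝ≥0∞ := fun A D =>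
    (κ.restrict (A ×ˢ D ×ˢ Set.univ)).map fun q => q.2.2
  have hm : ∀ A D : Set ℝ, MeasurableSet A → MeasurableSet D → ∀ s : ℝ, 0 ≤ s →
      ∫⁻ x, expNeg (ENNReal.ofReal s * x) ∂(m A D) = C * R A * G D * L s := by
    intro A D hA hD s hs
    rw [lintegral_map (by fun_prop) (by fun_prop),
      ← lintegral_indicator (hA.prod (hD.prod MeasurableSet.univ)), ← h A D hA hD s hs]
    refine lintegral_congr fun q => ?_
    by_cases h1 : q.1 ∈ A <;> by_cases h2 : q.2.1 ∈ D <;> simp [h1, h2]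
  have hmuniv : ∀ A D : Set ℝ, MeasurableSet A → MeasurableSet D →
      m A D Set.univ = C * R A * G D := by
    intro A D hA hD
    have h1 := hm A D hA hD 0 le_rfl
    simpa [hL0] using h1
  have hmfin : ∀ A D : Set ℝ, MeasurableSet A → MeasurableSet D → IsFiniteMeasure (m A D) := by
    intro A D hA hD
    refine ⟨?_⟩
    rw [hmuniv A D hA hD]
    exact ENNReal.mul_lt_top (ENNReal.mul_lt_top hCtop.lt_top (measure_lt_top R A))
      (measure_lt_top G D)
  let ν : Measure ℝ≥0∞ := C⁻¹ • m Set.univ Set.univ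
  have hν : ∀ s : ℝ, 0 ≤ s → ∫⁻ x, expNeg (ENNReal.ofReal s * x) ∂ν = L s := by
    intro s hs
    rw [lintegral_smul_measure, hm _ _ MeasurableSet.univ MeasurableSet.univ s hs, measure_univ,
      measure_univ, mul_one, mul_one, smul_eq_mul, ← mul_assoc, ENNReal.inv_mul_cancel hC0 hCtop,
      one_mul]
  have hνprob : IsProbabilityMeasure ν := by
    refine ⟨?_⟩
    have h1 := hν 0 le_rfl
    simpa [hL0] using h1
  refine ⟨ν, hνprob, hν, ?_⟩
  have hprod : ∀ A D : Set ℝ, MeasurableSet A → MeasurableSet D →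
      m A D = (C * R A * G D) • ν := by
    intro A D hA hD
    have := hmfin A D hA hD
    have : IsFiniteMeasure ((C * R A * G D) • ν) := by
      refine ⟨?_⟩
      rw [Measure.smul_apply, measure_univ, smul_eq_mul, mul_one]
      exact ENNReal.mul_lt_top (ENNReal.mul_lt_top hCtop.lt_top (measure_lt_top R A))
        (measure_lt_top G D)
    refine ext_of_laplace fun k => ?_
    rw [lintegral_smul_measure, ← ENNReal.ofReal_natCast, hm A D hA hD k k.cast_nonneg,
      hν k k.cast_nonneg, smul_eq_mul]
  clear_value ν
  have hκfin : IsFiniteMeasure κ := by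
    refine ⟨?_⟩
    have h1 := hmuniv _ _ MeasurableSet.univ MeasurableSet.univ
    simp only [m, Set.univ_prod_univ, Measure.restrict_univ, measure_univ, mul_one] at h1
    rw [Measure.map_apply (by fun_prop) MeasurableSet.univ, Set.preimage_univ] at h1
    rw [h1]
    exact hCtop.lt_top
  refine Measure.ext_prod₃ fun {A D U} hA hD hU => ?_
  have h1 : κ (A ×ˢ D ×ˢ U) = m A D U := by
    rw [Measure.map_apply (by fun_prop) hU,
      Measure.restrict_apply (hU.preimage (by fun_prop))]
    congr 1
    ext q
    simp only [Set.mem_prod, Set.mem_inter_iff, Set.mem_preimage, Set.mem_univ, and_true]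
    tauto
  rw [h1, hprod A D hA hD, Measure.smul_apply _ ν, Measure.smul_apply, Measure.prod_prod,
    Measure.prod_prod, smul_eq_mul, smul_eq_mul]
  ring

/-- The SINR of a link, as a function of its data. -/
noncomputable def linkSinr (α c : ℝ) (q : ℝ × ℝ × ℝ≥0∞) : ℝ≥0∞ :=
  ENNReal.ofReal (q.2.1 * q.1 ^ (-α)) / (q.2.2 + ENNReal.ofReal c)

theorem measurable_linkSinr (α c : ℝ) : Measurable (linkSinr α c) := by
  unfold linkSinr
  fun_prop

/-- The conditions on `x` keep the denominator positive and finite even when `c = 0`, so the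
extended division is an ordinary one. -/
theorem lt_linkSinr_iff {α c γ r H : ℝ} {x : ℝ≥0∞} (hγ : 0 ≤ γ) (hc : 0 ≤ c) (hr : 0 < r)
    (hx0 : x ≠ 0) (hx : x ≠ ∞) :
    ENNReal.ofReal γ < linkSinr α c (r, H, x) ↔ γ * r ^ α * (x.toReal + c) < H := by
  have hxpos : 0 < x.toReal := ENNReal.toReal_pos hx0 hx
  have h1 : x + ENNReal.ofReal c = ENNReal.ofReal (x.toReal + c) := by
    rw [ENNReal.ofReal_add hxpos.le hc, ENNReal.ofReal_toReal hx]
  have hrα : 0 < r ^ α := Real.rpow_pos_of_pos hr α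
  rw [linkSinr, h1, ENNReal.lt_div_iff_mul_lt
    (Or.inl (ENNReal.ofReal_pos.2 (by positivity)).ne') (Or.inl ENNReal.ofReal_ne_top),
    ← ENNReal.ofReal_mul hγ, ENNReal.ofReal_lt_ofReal_iff_of_nonneg (by positivity),
    Real.rpow_neg hr.le, ← div_eq_mul_inv, lt_div_iff₀ hrα]
  constructor <;> intro h <;> linarith

theorem gainLaw_Ioi {M : ℕ} (hM : 1 ≤ M) {t : ℝ} (ht : 0 ≤ t) :
    Network.gainLaw M (Set.Ioi t) = ENNReal.ofReal (erlangTail M t) := by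
  rw [Network.gainLaw, Measure.map_apply (by fun_prop) measurableSet_Ioi,
    ← stdComplexGaussian_vecNorm_sq_gt hM ht]
  rfl

instance isProbabilityMeasure_gainLaw (M : ℕ) : IsProbabilityMeasure (Network.gainLaw M) :=
  Measure.isProbabilityMeasure_map (by fun_prop)

theorem isProbabilityMeasure_distLaw {P : Params} (hlamAp : 0 < P.lamAp) (hrhoAp : P.rhoAp < 1) :
    IsProbabilityMeasure (Network.distLaw P) := by
  have h := Network.lintegral_distLaw (P := P) (f := fun _ => 1) measurable_const
  simp only [lintegral_one, one_mul, lintegral_serviceDensity hlamAp hrhoAp] at h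
  exact ⟨h⟩

/-! ### The tail of the SINR under the product law. -/

section Tail

variable {P : Params} {M : ℕ} {ν : Measure ℝ≥0∞} [IsProbabilityMeasure ν]

/-- Integrate over the gain first: for given distance and interference the event says that the gain
exceeds a threshold. -/
theorem prod_lt_linkSinr (hM : 1 ≤ M) (hα : 0 < P.alpha) (hLam : 0 < P.Lam1)
    (hlamAp : 0 < P.lamAp) (hrhoAp : P.rhoAp < 1)
    (hν : ∀ s : ℝ, 0 ≤ s → ∫⁻ x, expNeg (ENNReal.ofReal s * x) ∂ν =
      ENNReal.ofReal (Real.exp (-P.Lam1 * s ^ (2 / P.alpha)))) {c γ : ℝ} (hc : 0 ≤ c)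
    (hγ : 0 ≤ γ) :
    (Network.distLaw P).prod ((Network.gainLaw M).prod ν)
      {q | ENNReal.ofReal γ < linkSinr P.alpha c q} =
      ∫⁻ z : Plane, (∫⁻ x, ENNReal.ofReal (erlangTail M (γ * ‖z‖ ^ P.alpha * (x.toReal + c))) ∂ν) *
        ENNReal.ofReal (serviceDensity P ‖z‖) := by
  have hβ : 0 < 2 / P.alpha := by positivity
  have := isProbabilityMeasure_distLaw hlamAp hrhoAp
  have hU : MeasurableSet {q | ENNReal.ofReal γ < linkSinr P.alpha c q} :=
    measurableSet_lt measurable_const (measurable_linkSinr _ _)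
  rw [Measure.prod_apply hU, Network.lintegral_distLaw (measurable_measure_prodMk_left hU)]
  refine lintegral_congr_ae ?_
  filter_upwards [norm_pos_ae] with z hz
  congr 1
  rw [Measure.prod_apply_symm (hU.preimage measurable_prodMk_left)]
  refine lintegral_congr_ae ?_
  filter_upwards [ae_ne_top_of_laplace hβ hν, ae_ne_zero_of_laplace hLam hβ hν] with x hx hx0
  rw [← gainLaw_Ioi hM (by positivity)]
  congr 1
  ext H
  exact lt_linkSinr_iff hγ hc hz hx0 hx

theorem prod_linkSinr_le (hM : 1 ≤ M) (hα : 0 < P.alpha) (hLam : 0 < P.Lam1)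
    (hlamAp : 0 < P.lamAp) (hrhoAp : P.rhoAp < 1) (hpowS : 0 < P.powS) (hnoise : 0 ≤ P.noise)
    (hν : ∀ s : ℝ, 0 ≤ s → ∫⁻ x, expNeg (ENNReal.ofReal s * x) ∂ν =
      ENNReal.ofReal (Real.exp (-P.Lam1 * s ^ (2 / P.alpha)))) {γ : ℝ} (hγ : 0 ≤ γ) :
    ((Network.distLaw P).prod ((Network.gainLaw M).prod ν)
      {q | linkSinr P.alpha (P.noise / P.powS) q ≤ ENNReal.ofReal γ}).toReal =
      P.closedForm M γ := by
  have hβ : 0 < 2 / P.alpha := by positivity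
  have hc : 0 ≤ P.noise / P.powS := by positivity
  have := isProbabilityMeasure_distLaw hlamAp hrhoAp
  have hU : MeasurableSet {q | ENNReal.ofReal γ < linkSinr P.alpha (P.noise / P.powS) q} :=
    measurableSet_lt measurable_const (measurable_linkSinr _ _)
  have hcompl : {q | linkSinr P.alpha (P.noise / P.powS) q ≤ ENNReal.ofReal γ} =
      {q | ENNReal.ofReal γ < linkSinr P.alpha (P.noise / P.powS) q}ᶜ := by
    ext q
    simp
  rw [hcompl, prob_compl_eq_one_sub hU, ENNReal.toReal_sub_of_le prob_le_one ENNReal.one_ne_top,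
    ENNReal.toReal_one, prod_lt_linkSinr hM hα hLam hlamAp hrhoAp hν hc hγ]
  rcases hγ.eq_or_lt with rfl | hγ
  · simp only [zero_mul, erlangTail_zero hM, ENNReal.ofReal_one, lintegral_one, measure_univ,
      one_mul]
    rw [lintegral_serviceDensity hlamAp hrhoAp, closedForm_zero hlamAp hrhoAp hα]
    simp
  · rw [closedForm_eq_one_sub_integral hlamAp hrhoAp hα hpowS hnoise hLam.le hγ hM,
      integral_eq_lintegral_of_nonneg_ae]
    · congr 2
      refine lintegral_congr_ae ?_
      filter_upwards [norm_pos_ae] with z hz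
      have hs : 0 < γ * ‖z‖ ^ P.alpha := by positivity
      rw [(lintegral_erlangTail hβ hν hc hs M).2,
        ENNReal.ofReal_mul (serviceDensity_nonneg hlamAp.le hrhoAp.le _), mul_comm]
    · filter_upwards [norm_pos_ae] with z hz
      have hs : 0 < γ * ‖z‖ ^ P.alpha := by positivity
      exact mul_nonneg (serviceDensity_nonneg hlamAp.le hrhoAp.le _)
        (lintegral_erlangTail hβ hν hc hs M).1
    · exact (integrable_plane_norm.2 (integrableOn_serviceDensity_mul_meanErlangTail hlamAp hrhoAp
        hα hpowS hnoise hLam.le hγ M)).aestronglyMeasurable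

end Tail

/-! ### The typical active sensor and its CDF. -/

namespace Network

variable {Ω : Type*} {M : ℕ} {W : Network Ω M} {P : Params} {B : Set Plane}
  [mΩ : MeasurableSpace Ω] {μ : Measure Ω} [IsProbabilityMeasure μ]

/-- The event that the sensor `n` lies in `B` and is active. -/
def activeEvent (W : Network Ω M) (B : Set Plane) (n : ℕ) : Set Ω :=
  {ω | W.sensor n ω ∈ B ∧ W.sensorActive n ω = true}

/-- Campbell's formula, which is the Mecke formula with weight `1`, thinned by the independent
activities. -/
theorem IsModel.tsum_activeEvent (hW : W.IsModel P μ) (hlamS : 0 ≤ P.lamS)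
    (hB : MeasurableSet B) :
    ∑' n, μ (W.activeEvent B n) = ENNReal.ofReal (P.lamS * P.rhoS) * volume B := by
  have h1 : ∀ n, μ (W.activeEvent B n) =
      (∫⁻ ω, B.indicator 1 (W.sensor n ω) ∂μ) * ENNReal.ofReal P.rhoS := by
    intro n
    have hx : ∀ n, Measurable[sigmaOf W.sourceSigma {.sensors}] (W.sensor n) :=
      measurable_sensor_of_le (le_sigmaOf (Set.mem_singleton _))
    have ha : Measurable[sigmaOf W.sourceSigma {.sensorAct n}] (W.sensorActive n) :=
      measurable_sensorActive_of_le (le_sigmaOf (Set.mem_singleton _))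
    have hind : IndepFun (W.sensor n) (W.sensorActive n) μ := hW.indepFun (by simp) (hx n) ha
    have h2 := hind.measure_inter_preimage_eq_mul B {true} hB (measurableSet_singleton true)
    have h3 : ∫⁻ ω, B.indicator 1 (W.sensor n ω) ∂μ = μ (W.sensor n ⁻¹' B) := by
      rw [← lintegral_indicator_one (hW.sensor_hppp.measurable n hB)]
      rfl
    rw [h3, ← hW.sensorActive_prob n]
    exact h2
  have h2 := hW.sensor_hppp.mecke hlamS (v := fun _ => 1) measurable_const (fun _ => le_rfl)
    (f := B.indicator 1) (measurable_one.indicator hB)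
  simp only [ite_self, iprod_one, mul_one, tsub_self, lintegral_zero, mul_zero, expNeg_zero,
    lintegral_indicator_one hB] at h2
  simp only [h1]
  rw [ENNReal.tsum_mul_right, h2, ENNReal.ofReal_mul hlamS]
  ring

variable (hW : W.IsModel P μ) (hM : 1 ≤ M) (hlamS : 0 < P.lamS) (hlamAp : 0 < P.lamAp)
  (hrhoS : 0 < P.rhoS ∧ P.rhoS < 1) (hrhoAp : 0 < P.rhoAp ∧ P.rhoAp < 1) (halpha : 2 < P.alpha)
  (hpowS : 0 < P.powS) (hpowAp : 0 < P.powAp) (hB : MeasurableSet B)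

include hW hM hlamS hlamAp hrhoS hrhoAp halpha hpowS hpowAp hB in
theorem IsModel.exists_linkMeasure_eq (hB0 : volume B ≠ 0) (hBtop : volume B ≠ ∞) :
    ∃ ν : Measure ℝ≥0∞, IsProbabilityMeasure ν ∧
      (∀ s : ℝ, 0 ≤ s → ∫⁻ x, expNeg (ENNReal.ofReal s * x) ∂ν =
        ENNReal.ofReal (Real.exp (-P.Lam1 * s ^ (2 / P.alpha)))) ∧
      W.linkMeasure P μ B = (ENNReal.ofReal (P.lamS * P.rhoS) * volume B) •
        (distLaw P).prod ((gainLaw M).prod ν) := by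
  have := isProbabilityMeasure_distLaw hlamAp hrhoAp.2
  have hpos : 0 < P.lamS * P.rhoS := mul_pos hlamS hrhoS.1
  refine exists_prod_of_laplace (mul_ne_zero (ENNReal.ofReal_pos.2 hpos).ne' hB0)
    (ENNReal.mul_ne_top ENNReal.ofReal_ne_top hBtop)
    (L := fun s => ENNReal.ofReal (Real.exp (-P.Lam1 * s ^ (2 / P.alpha)))) ?_ ?_
  · have h1 : (0 : ℝ) ^ (2 / P.alpha) = 0 :=
      Real.zero_rpow (div_pos two_pos (by linarith)).ne'
    simp [h1]
  · intro A D hA hD s hs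
    exact hW.laplace_linkMeasure hM hlamS.le hlamAp.le hrhoS.1.le hrhoS.2.le hrhoAp.1.le hrhoAp.2.le
      halpha hpowS.le hpowAp.le hs hB hA hD

-- A comparison of masses. Link events of one sensor are disjoint subsets of its activity event, and
-- summed over the sensors both families have the same finite total. Hence active sensors without a
-- link have mean number `0`.
include hW hM hlamS hlamAp hrhoS hrhoAp halpha hpowS hpowAp hB in
theorem IsModel.ae_exists_link (hB0 : volume B ≠ 0) (hBtop : volume B ≠ ∞) :
    ∀ᵐ ω ∂μ, ∀ n, ω ∈ W.activeEvent B n → ∃ k, ω ∈ W.linkEvent B n k := by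
  obtain ⟨ν, hν, -, hprod⟩ := hW.exists_linkMeasure_eq hM hlamS hlamAp hrhoS hrhoAp halpha hpowS
    hpowAp hB hB0 hBtop
  have := isProbabilityMeasure_distLaw hlamAp hrhoAp.2
  set C := ENNReal.ofReal (P.lamS * P.rhoS) * volume B with hC
  have hCtop : C ≠ ∞ := ENNReal.mul_ne_top ENNReal.ofReal_ne_top hBtop
  have hlink := hW.measurableSet_linkEvent hB
  have hunion : ∀ n, μ (⋃ k, W.linkEvent B n k) = ∑' k, μ (W.linkEvent B n k) := fun n =>
    measure_iUnion (fun k k' h => disjoint_linkEvent h) (hlink n)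
  have h1 : ∑' n, μ (⋃ k, W.linkEvent B n k) = C := by
    have h2 := hW.lintegral_linkMeasure hB (f := fun _ => 1) measurable_const
    rw [lintegral_one, hprod, Measure.smul_apply, measure_univ, smul_eq_mul, mul_one] at h2
    simp only [hunion]
    rw [h2]
    refine tsum_congr fun n => tsum_congr fun k => ?_
    exact (lintegral_indicator_one (hlink n k)).symm
  have hsub : ∀ n, (⋃ k, W.linkEvent B n k) ⊆ W.activeEvent B n := fun n =>
    Set.iUnion_subset fun k ω hω => ⟨hω.1, hω.2.1⟩
  have h3 : C + ∑' n, μ (W.activeEvent B n \ ⋃ k, W.linkEvent B n k) = C := by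
    nth_rewrite 1 [← h1]
    rw [← ENNReal.tsum_add, hC, ← hW.tsum_activeEvent hlamS.le hB]
    refine tsum_congr fun n => ?_
    rw [← measure_inter_add_sdiff (W.activeEvent B n) (MeasurableSet.iUnion (hlink n)),
      Set.inter_eq_self_of_subset_right (hsub n)]
  have h4 : ∑' n, μ (W.activeEvent B n \ ⋃ k, W.linkEvent B n k) = 0 := by
    have h5 : C + ∑' n, μ (W.activeEvent B n \ ⋃ k, W.linkEvent B n k) = C + 0 := by
      rw [h3, add_zero]
    exact (ENNReal.add_right_inj hCtop).1 h5
  rw [ENNReal.tsum_eq_zero] at h4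
  refine ae_all_iff.2 fun n => ?_
  filter_upwards [measure_eq_zero_iff_ae_notMem.1 (h4 n)] with ω hω hact
  by_contra hnone
  exact hω ⟨hact, by simpa using hnone⟩

-- Almost surely each active sensor in `B` has exactly one link, so counting sensors is counting
-- links, and an event of the sensor need only be described on its link.
include hW hM hlamS hlamAp hrhoS hrhoAp halpha hpowS hpowAp hB in
theorem IsModel.meanActive_eq (hB0 : volume B ≠ 0) (hBtop : volume B ≠ ∞) {E : ℕ → Ω → Prop}
    {U : Set (ℝ × ℝ × ℝ≥0∞)} (hU : MeasurableSet U)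
    (hE : ∀ n k ω, ω ∈ W.linkEvent B n k → (E n ω ↔ W.linkData P n k ω ∈ U)) :
    W.meanActive μ B E = W.linkMeasure P μ B U := by
  have hUm : Measurable (U.indicator (1 : ℝ × ℝ × ℝ≥0∞ → ℝ≥0∞)) := measurable_one.indicator hU
  have hterm : ∀ n k, Measurable
      ((W.linkEvent B n k).indicator fun ω => U.indicator (1 : ℝ × ℝ × ℝ≥0∞ → ℝ≥0∞)
        (W.linkData P n k ω)) :=
    fun n k => (hUm.comp (hW.measurable_linkData n k)).indicator
      (hW.measurableSet_linkEvent hB n k)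
  rw [← lintegral_indicator_one hU, hW.lintegral_linkMeasure hB hUm]
  simp only [← lintegral_tsum fun k => (hterm _ k).aemeasurable]
  rw [← lintegral_tsum fun n => (Measurable.tsum (hterm n)).aemeasurable, meanActive]
  refine lintegral_congr_ae ?_
  filter_upwards [hW.ae_exists_link hM hlamS hlamAp hrhoS hrhoAp halpha hpowS hpowAp hB hB0 hBtop]
    with ω hω
  refine tsum_congr fun n => ?_
  by_cases hact : ω ∈ W.activeEvent B n
  · obtain ⟨k, hk⟩ := hω n hact
    rw [tsum_eq_single k fun k' hk' => Set.indicator_of_notMem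
      (Set.disjoint_right.1 (disjoint_linkEvent hk') hk) _, Set.indicator_of_mem hk]
    by_cases hEn : E n ω
    · rw [if_pos ⟨hact.1, hact.2, hEn⟩, Set.indicator_of_mem ((hE n k ω hk).1 hEn), Pi.one_apply]
    · rw [if_neg fun h => hEn h.2.2, Set.indicator_of_notMem fun h => hEn ((hE n k ω hk).2 h)]
  · rw [if_neg fun h => hact ⟨h.1, h.2.1⟩, ENNReal.tsum_eq_zero.2 fun k =>
      Set.indicator_of_notMem (fun h => hact ⟨h.1, h.2.1⟩) _]

omit mΩ in
theorem sinr_eq_linkSinr {n k : ℕ} {ω : Ω} (h : ω ∈ W.linkEvent B n k) :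
    W.sinr P n ω = linkSinr P.alpha (P.noise / P.powS) (W.linkData P n k ω) := by
  rw [sinr, apOf_eq_of_mem_linkEvent h]
  rfl

include hW hM hlamS hlamAp hrhoS hrhoAp halpha hpowS hpowAp hB in
theorem IsModel.typicalCdf_toReal (hnoise : 0 ≤ P.noise) (hLam : 0 < P.Lam1)
    (hB0 : volume B ≠ 0) (hBtop : volume B ≠ ∞) {γ : ℝ} (hγ : 0 ≤ γ) :
    (W.typicalCdf P μ B γ).toReal = P.closedForm M γ := by
  obtain ⟨ν, hνprob, hν, hprod⟩ := hW.exists_linkMeasure_eq hM hlamS hlamAp hrhoS hrhoAp halpha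
    hpowS hpowAp hB hB0 hBtop
  have := isProbabilityMeasure_distLaw hlamAp hrhoAp.2
  have hC0 : ENNReal.ofReal (P.lamS * P.rhoS) * volume B ≠ 0 :=
    mul_ne_zero (ENNReal.ofReal_pos.2 (mul_pos hlamS hrhoS.1)).ne' hB0
  have hCtop : ENNReal.ofReal (P.lamS * P.rhoS) * volume B ≠ ∞ :=
    ENNReal.mul_ne_top ENNReal.ofReal_ne_top hBtop
  have hU : MeasurableSet {q | linkSinr P.alpha (P.noise / P.powS) q ≤ ENNReal.ofReal γ} :=
    measurableSet_le (measurable_linkSinr _ _) measurable_const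
  rw [typicalCdf, hW.meanActive_eq hM hlamS hlamAp hrhoS hrhoAp halpha hpowS hpowAp hB hB0 hBtop hU
    fun n k ω h => by rw [sinr_eq_linkSinr h]; rfl,
    hW.meanActive_eq hM hlamS hlamAp hrhoS hrhoAp halpha hpowS hpowAp hB hB0 hBtop
      MeasurableSet.univ fun n k ω h => by simp,
    hprod, Measure.smul_apply, Measure.smul_apply, measure_univ, smul_eq_mul, smul_eq_mul, mul_one,
    ENNReal.mul_div_right_comm, ENNReal.div_self hC0 hCtop, one_mul]
  exact prod_linkSinr_le hM (by linarith) hLam hlamAp hrhoAp.2 hpowS hnoise hν hγ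

end Network

theorem Params.Lam1_pos {P : Params} (hlamS : 0 < P.lamS) (hlamAp : 0 < P.lamAp)
    (hrhoS : 0 < P.rhoS) (hrhoAp : 0 < P.rhoAp) (halpha : 2 < P.alpha) (hpowS : 0 < P.powS)
    (hpowAp : 0 < P.powAp) : 0 < P.Lam1 := by
  have hα0 : 0 < P.alpha := by linarith
  have h2a : 2 / P.alpha < 1 := (div_lt_one hα0).2 halpha
  have hG1 : 0 < Real.Gamma (1 + 2 / P.alpha) := Real.Gamma_pos_of_pos (by positivity)
  have hG2 : 0 < Real.Gamma (1 - 2 / P.alpha) := Real.Gamma_pos_of_pos (by linarith)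
  unfold Params.Lam1
  positivity

end WSN

theorem lemma1 {Ω : Type*} [MeasurableSpace Ω] (μ : Measure Ω) [IsProbabilityMeasure μ]
    (M : ℕ) (hM : 1 ≤ M) (P : WSN.Params)
    (hlamS : 0 < P.lamS) (hlamAp : 0 < P.lamAp) (hlamSk : 0 < P.lamSk)
    (hrhoS : 0 < P.rhoS ∧ P.rhoS < 1) (hrhoAp : 0 < P.rhoAp ∧ P.rhoAp < 1)
    (halpha : 2 < P.alpha) (hpowS : 0 < P.powS) (hpowAp : 0 < P.powAp) (hnoise : 0 ≤ P.noise)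
    (W : WSN.Network Ω M) (hW : W.IsModel P μ)
    (B : Set WSN.Plane) (hB : MeasurableSet B) (hB0 : volume B ≠ 0) (hBtop : volume B ≠ ∞)
    (γ : ℝ) (hγ : 0 ≤ γ) :
    IntegrableOn (P.mainIntegrand γ) (Set.Ioi 0) ∧
    (∀ m ∈ Finset.Icc 1 (M - 1), ∀ k ∈ WSN.multiIndices m,
      IntegrableOn (P.corrIntegrand γ k) (Set.Ioi 0)) ∧
    (W.typicalCdf P μ B γ).toReal = P.closedForm M γ := by
  have hα : 0 < P.alpha := by linarith
  have hLam : 0 < P.Lam1 :=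
    WSN.Params.Lam1_pos hlamS hlamAp hrhoS.1 hrhoAp.1 halpha hpowS hpowAp
  exact ⟨WSN.integrableOn_mainIntegrand hlamAp hrhoAp.2 hα hpowS hnoise hLam.le hγ,
    fun m _ k hk =>
      WSN.integrableOn_corrIntegrand hlamAp hrhoAp.2 hα hpowS hnoise hLam.le hγ hk,
    hW.typicalCdf_toReal hM hlamS hlamAp hrhoS hrhoAp halpha hpowS hpowAp hB hnoise hLam hB0 hBtop
      hγ⟩
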